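/- Conventions. All graphs are finite and simple; a graph of size $n$ is labeled, with vertex labels $1,\dots,n$. A module of a graph $(V,E)$ is a set $M\subseteq V$ such that, for all $x,y\in M$ and $z\in V\setminus M$, $\{x,z\}\in E$ if and only if $\{y,z\}\in E$. A graph is prime if it has at least $3$ vertices and its only modules are $\varnothing$, $V$ and the singletons. Let $\mathcal P$ be a set of prime graphs that is stable under relabeling of the vertices, let $\mathcal P_n$ be the set of its elements of size $n$, let $P(z)=\sum_{n}|\mathcal P_n|\frac{z^n}{n!}$, let $R_0\in[0,+\infty]$ be the radius of convergence of $P$, and put $R_\Lambda=\log(1+R_0)\in[0,+\infty]$ and $$\Lambda(w)=P(e^w-1)+e^w-1-w .$$ Trees are rooted and non-plane, with distinctly labeled leaves; the size of a tree is its number $n$ of leaves, and the leaf labels are $1,\dots,n$. The children of a node are ordered by the minimal leaf labels of their subtrees. Let $\mathcal T_{\mathcal P}$ be the set of such trees in which every internal node has at least two children and is decorated with $\oplus$, with $\ominus$, or with a graph of $\mathcal P$ whose size is the number of children of the node (vertex $i$ of the graph corresponding to the $i$-th child), and in which no child of a node decorated with $\oplus$ (resp. $\ominus$) is decorated with $\oplus$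 (resp. $\ominus$). Let $\mathcal T_{\mathrm{not}\oplus}$ be the set of $t\in\mathcal T_{\mathcal P}$ whose root is not decorated with $\oplus$. A blossomed tree is obtained from some $t\in\mathcal T_{\mathcal P}$ and a leaf $\ell$ of $t$ by replacing the label of $\ell$ by $*$ (the blossom), replacing by $*$, in the graph decorating each node on the path from the root to $\ell$, the label of the vertex that corresponds to the child on this path, and reducing the remaining labels of the tree and of these graphs to initial intervals $\{1,\dots,m\}$ in the order-preserving way. Its size is the number of its leaves other than the blossom. The blossom is $\oplus$-replaceable if it has no parent decorated with $\oplus$ (in particular if it is the whole tree). Let $\mathcal T^{\oplus}$ be the set of blossomed trees whose blossom is $\oplus$-replaceable. Let $T$, $T_{\mathrm{not}\oplus}$, $T^{\oplus}$ be the exponential generating functions $\sum_n a_n\frac{z^n}{n!}$ of $\mathcal T_{\mathcal P}$, $\mathcal T_{\mathrm{not}\oplus}$, $\mathcal T^{\oplus}$, where $a_n$ is the number of elements of size $n$. A $\Delta$-domain at $w\in\mathbb C^*$ is a set $\{zw : |z|\le r,\ z\ne 1,\ |\arg(1-z)|<\varphi\}$ with $r>1$ and $\frac{\pi}{2}<\varphi<\pi$.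 A power series is $\Delta$-analytic if it has a positive finite radius of convergence $\rho$ and an analytic continuation to a $\Delta$-domain at $\rho$. A dominant singularity is a point of the circle of convergence to no neighbourhood of which the sum of the series extends analytically. Powers are principal values. **Proposition.** Assume Condition (C): $R_0>0$ and $\lim_{w\to R_\Lambda^-}\Lambda'(w)>1$ (the limit is taken in $[0,+\infty]$). Then the equation $\Lambda'(\kappa)=1$ has exactly one solution $\kappa\in[0,R_\Lambda)$. Put $$R=\kappa-\Lambda(\kappa),\qquad K=e^{\kappa}-1,\qquad \mu=\sqrt{2R\,\Lambda''(\kappa)} .$$ Then $R>0$ and $\mu>0$. Both $T$ and $T_{\mathrm{not}\oplus}$ have radius of convergence $R$ and a unique dominant singularity, at $R$, and both are $\Delta$-analytic. The series $T^{\oplus}$ also has radius of convergence $R$ and an analytic continuation to a $\Delta$-domain at $R$. As $z\to R$ in a $\Delta$-domain at $R$, the analytic continuations satisfy $$T_{\mathrm{not}\oplus}(z)=\kappa-\frac{2R}{\mu}\sqrt{1-\frac zR}+O\Big(1-\frac zR\Big),$$ $$T(z)=K-(1+K)\frac{2R}{\mu}\sqrt{1-\frac zR}+O\Big(1-\frac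 zR\Big),$$ $$T^{\oplus}(z)=\frac1\mu\Big(1-\frac zR\Big)^{-1/2}+O(1).$$ -/

import Mathlib

open scoped Nat Topology ENNReal Asymptotics

/-! ### Prime graphs -/

/-- A module of a graph: no vertex outside `M` distinguishes two vertices of `M`. -/
def SimpleGraph.IsGraphModule {V : Type} (G : SimpleGraph V) (M : Set V) : Prop :=
  ∀ x ∈ M, ∀ y ∈ M, ∀ z, z ∉ M → (G.Adj x z ↔ G.Adj y z)

/-- A labeled graph of size `n` (vertex `i : Fin n` carries the label `i + 1`) is prime if it has
at least three vertices and all its modules are trivial. -/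
def SimpleGraph.IsPrimeGraph {n : ℕ} (G : SimpleGraph (Fin n)) : Prop :=
  3 ≤ n ∧ ∀ M : Set (Fin n), G.IsGraphModule M → M = ∅ ∨ M = Set.univ ∨ ∃ v, M = {v}

/-- A set of labeled graphs, given by its sets of elements of each size. -/
abbrev GraphSet : Type := ∀ n : ℕ, Set (SimpleGraph (Fin n))

/-- Stability under every relabeling of the vertices. -/
def GraphSet.StableByRelabeling (P : GraphSet) : Prop :=
  ∀ n : ℕ, ∀ G ∈ P n, ∀ σ : Equiv.Perm (Fin n), G.comap σ ∈ P n

/-! ### Decorated trees -/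

/-- Decorations of internal nodes: `⊕` (`join`), `⊖` (`union`), or a graph with vertex set `V`. -/
inductive Decoration (V : Type) : Type
  | join : Decoration V
  | union : Decoration V
  | graph (G : SimpleGraph V) : Decoration V

/-- Decorated trees with leaves labeled by natural numbers. A node comes with the list
`c 0, c 1, …` of its subtrees; in the trees considered below this list is the one in which the
subtrees are sorted by minimal leaf label, so each non-plane tree has exactly one
representative. A graph decoration of a node with `k` children has size `k`, its vertex `i`
corresponding to the `i`-th subtree in this order. -/
inductive DecoratedTree : Type
  | leaf (a : ℕ) : DecoratedTree
  | node (k : ℕ) (d : Decoration (Fin k)) (c : Fin k → DecoratedTree) : DecoratedTree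

namespace DecoratedTree

/-- The set of leaf labels. -/
def labels : DecoratedTree → Set ℕ
  | leaf a => {a}
  | node _ _ c => ⋃ i, (c i).labels

/-- The number of leaves. -/
def size : DecoratedTree → ℕ
  | leaf _ => 1
  | node _ _ c => ∑ i, (c i).size

/-- The minimal leaf label. -/
noncomputable def minLabel (t : DecoratedTree) : ℕ := sInf t.labels

/-- Leaves have distinct labels, each internal node has at least two children, and the children
of a node are listed in increasing order of their minimal leaf labels. -/
def IsTree : DecoratedTree → Prop
  | leaf _ => True
  | node k _ c => 2 ≤ k ∧ (∀ i, (c i).IsTree) ∧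
      (∀ i j, i ≠ j → Disjoint (c i).labels (c j).labels) ∧ StrictMono fun i => (c i).minLabel

/-- Substitution trees: the leaf labels are `1, …, n`, where `n` is the size. -/
def IsSubstitutionTree (t : DecoratedTree) : Prop :=
  t.IsTree ∧ t.labels = Set.Icc 1 t.size

/-- The root is an internal node decorated with `⊕`. -/
def RootIsJoin : DecoratedTree → Prop
  | node _ .join _ => True
  | _ => False

/-- The root is an internal node decorated with `⊖`. -/
def RootIsUnion : DecoratedTree → Prop
  | node _ .union _ => True
  | _ => False

/-- Each internal node is decorated with `⊕`, `⊖` or a prime graph, and no child of a `⊕`-node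
(resp. `⊖`-node) is a `⊕`-node (resp. `⊖`-node). -/
def IsReduced : DecoratedTree → Prop
  | leaf _ => True
  | node _ .join c => ∀ i, (c i).IsReduced ∧ ¬ (c i).RootIsJoin
  | node _ .union c => ∀ i, (c i).IsReduced ∧ ¬ (c i).RootIsUnion
  | node _ (.graph G) c => G.IsPrimeGraph ∧ ∀ i, (c i).IsReduced

/-- Modular decomposition trees. -/
def IsModularDecompositionTree (t : DecoratedTree) : Prop :=
  t.IsSubstitutionTree ∧ t.IsReduced

/-- Every graph decorating an internal node belongs to `P`. -/
def GraphsIn (P : GraphSet) : DecoratedTree → Prop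
  | leaf _ => True
  | node _ .join c => ∀ i, (c i).GraphsIn P
  | node _ .union c => ∀ i, (c i).GraphsIn P
  | node k (.graph G) c => G ∈ P k ∧ ∀ i, (c i).GraphsIn P

/-- Apply `f` to all leaf labels. -/
def relabel (f : ℕ → ℕ) : DecoratedTree → DecoratedTree
  | leaf a => leaf (f a)
  | node k d c => node k d fun i => (c i).relabel f

end DecoratedTree

/-- The class `𝒯_P`: modular decomposition trees whose nodes are either linear or in `P`. -/
def treeClass (P : GraphSet) : Set DecoratedTree :=
  {t | t.IsModularDecompositionTree ∧ t.GraphsIn P}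

/-- The trees of `𝒯_P` whose root is not decorated with `⊕`. -/
def treeClassNotJoin (P : GraphSet) : Set DecoratedTree :=
  {t | t ∈ treeClass P ∧ ¬ t.RootIsJoin}

/-! ### Blossomed trees -/

/-- Trees with one blossom `*`. In a node on the path from the root to the blossom, `b` is the
subtree that contains the blossom and `c` lists the other ones (by minimal leaf label); a graph
decoration is a graph with one blossom: its vertex `none` is labeled `*` and corresponds to `b`,
its vertex `some i` is labeled `i + 1` and corresponds to `c i`. -/
inductive BlossomTree : Type
  | blossom : BlossomTree
  | node (k : ℕ) (d : Decoration (Option (Fin k))) (b : BlossomTree)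
      (c : Fin k → DecoratedTree) : BlossomTree

/-- Turn the vertex `i` of the decoration into a blossom and reduce the remaining labels. -/
def Decoration.blossom {k : ℕ} (i : Fin (k + 1)) :
    Decoration (Fin (k + 1)) → Decoration (Option (Fin k))
  | .join => .join
  | .union => .union
  | .graph G => .graph (G.comap (finSuccEquiv' i).symm)

/-- `Blossoms t l b`: replacing the leaf of label `l` of `t` by a blossom, and accordingly the
vertex leading to it by a blossom in each decoration on its path to the root, gives `b`
(before the leaf labels are reduced). -/
inductive Blossoms : DecoratedTree → ℕ → BlossomTree → Prop
  | leaf (a : ℕ) : Blossoms (.leaf a) a .blossom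
  | node {k : ℕ} (d : Decoration (Fin (k + 1))) (c : Fin (k + 1) → DecoratedTree)
      (i : Fin (k + 1)) {l : ℕ} {b : BlossomTree} (h : Blossoms (c i) l b) :
      Blossoms (.node (k + 1) d c) l (.node k (d.blossom i) b fun j => c (i.succAbove j))

namespace BlossomTree

/-- The number of leaves, the blossom not counted. -/
def size : BlossomTree → ℕ
  | blossom => 0
  | node _ _ b c => b.size + ∑ i, (c i).size

/-- Apply `f` to all leaf labels. -/
def relabel (f : ℕ → ℕ) : BlossomTree → BlossomTree
  | blossom => blossom
  | node k d b c => node k d (b.relabel f) fun i => (c i).relabel f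

/-- The blossom is `⊕`-replaceable: it has no parent decorated with `⊕`. -/
def JoinReplaceable : BlossomTree → Prop
  | blossom => True
  | node _ .join blossom _ => False
  | node _ _ blossom _ => True
  | node _ _ (node k d b c) _ => (node k d b c).JoinReplaceable

end BlossomTree

/-- The order-preserving reduction of the labels `{1, …, n} \ {l}` to `{1, …, n - 1}`. -/
def reduceLabel (l j : ℕ) : ℕ := if l < j then j - 1 else j

/-- The trees obtained by blossoming a leaf of a tree in `𝒯_P`. -/
def blossomedClass (P : GraphSet) : Set BlossomTree :=
  {b | ∃ t ∈ treeClass P, ∃ (l : ℕ) (b₀ : BlossomTree),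
    Blossoms t l b₀ ∧ b = b₀.relabel (reduceLabel l)}

/-- The class `𝒯^⊕`: blossomed trees whose blossom is `⊕`-replaceable. -/
def blossomedClassJoin (P : GraphSet) : Set BlossomTree :=
  {b | b ∈ blossomedClass P ∧ b.JoinReplaceable}

/-! ### Exponential generating functions -/

/-- The exponential generating function `∑ aₙ zⁿ / n!`. -/
noncomputable def egf (𝕜 : Type) [RCLike 𝕜] (a : ℕ → ℕ) : FormalMultilinearSeries 𝕜 𝕜 𝕜 :=
  FormalMultilinearSeries.ofScalars 𝕜 fun n => (a n : 𝕜) / (n ! : 𝕜)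

/-- The series `P(z)`, `∑ |P_n| zⁿ / n!`. -/
noncomputable def seriesP (P : GraphSet) : FormalMultilinearSeries ℝ ℝ ℝ :=
  egf ℝ fun n => (P n).ncard

/-- The series `T`. -/
noncomputable def seriesT (P : GraphSet) : FormalMultilinearSeries ℂ ℂ ℂ :=
  egf ℂ fun n => {t | t ∈ treeClass P ∧ t.size = n}.ncard

/-- The series `T_{not ⊕}`. -/
noncomputable def seriesTNotJoin (P : GraphSet) : FormalMultilinearSeries ℂ ℂ ℂ :=
  egf ℂ fun n => {t | t ∈ treeClassNotJoin P ∧ t.size = n}.ncard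

/-- The series `T^⊕`. -/
noncomputable def seriesTJoin (P : GraphSet) : FormalMultilinearSeries ℂ ℂ ℂ :=
  egf ℂ fun n => {b | b ∈ blossomedClassJoin P ∧ b.size = n}.ncard

/-- `Λ(w) = P(exp w - 1) + exp w - 1 - w`. -/
noncomputable def Lam (P : GraphSet) (w : ℝ) : ℝ :=
  (seriesP P).sum (Real.exp w - 1) + Real.exp w - 1 - w

/-- `R_Λ = log (1 + R₀) ∈ [0, ∞]`, where `R₀` is the radius of convergence of `P`. -/
noncomputable def radiusLam (P : GraphSet) : EReal := ENNReal.log (1 + (seriesP P).radius)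

/-- Condition (C): `R₀ > 0`, and the limit in `[0, ∞]` of `Λ'` at `R_Λ` from the left exceeds `1`. -/
def ConditionC (P : GraphSet) : Prop :=
  0 < (seriesP P).radius ∧ ∃ L : EReal, 1 < L ∧
    Filter.Tendsto (fun w : ℝ => ((deriv (Lam P) w : ℝ) : EReal))
      (Filter.comap Real.toEReal (𝓝[<] radiusLam P)) (𝓝 L)

/-! ### Singularities and Δ-analyticity -/

/-- `ζ` (on the circle of convergence) is a singularity of `A`: the sum of `A` on the disk
`|z| < |ζ|` does not extend analytically to a neighbourhood of `ζ`. -/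
def IsSingularPoint (A : FormalMultilinearSeries ℂ ℂ ℂ) (ζ : ℂ) : Prop :=
  ¬ ∃ g : ℂ → ℂ, AnalyticAt ℂ g ζ ∧ ∀ᶠ z in 𝓝[Metric.ball 0 ‖ζ‖] ζ, g z = A.sum z

/-- `ρ` is the radius of convergence of `A` and the unique singularity of modulus `ρ`. -/
def HasUniqueDominantSingularity (A : FormalMultilinearSeries ℂ ℂ ℂ) (ρ : ℝ) : Prop :=
  A.radius = ENNReal.ofReal ρ ∧ ∀ ζ : ℂ, ‖ζ‖ = ρ → (IsSingularPoint A ζ ↔ ζ = (ρ : ℂ))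

/-- `Δ`-domains at `w`. -/
def IsDeltaDomain (w : ℂ) (D : Set ℂ) : Prop :=
  ∃ r θ : ℝ, 1 < r ∧ Real.pi / 2 < θ ∧ θ < Real.pi ∧
    D = (fun z : ℂ => z * w) '' {z : ℂ | ‖z‖ ≤ r ∧ z ≠ 1 ∧ |Complex.arg (1 - z)| < θ}

/-- `F` is an analytic continuation to a `Δ`-domain `D` at `ρ` of the series `A`, whose radius of
convergence is `ρ > 0`. -/
def IsDeltaContinuation (A : FormalMultilinearSeries ℂ ℂ ℂ) (ρ : ℝ) (D : Set ℂ) (F : ℂ → ℂ) :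
    Prop :=
  0 < ρ ∧ A.radius = ENNReal.ofReal ρ ∧ IsDeltaDomain ρ D ∧ AnalyticOnNhd ℂ F D ∧
    ∀ z : ℂ, ‖z‖ < ρ → F z = A.sum z

/-- `A` is `Δ`-analytic. -/
def IsDeltaAnalytic (A : FormalMultilinearSeries ℂ ℂ ℂ) : Prop :=
  ∃ (ρ : ℝ) (D : Set ℂ) (F : ℂ → ℂ), IsDeltaContinuation A ρ D F

/-- `A(z) = f(z) + O(e(z))` as `z → ρ` in a `Δ`-domain at `ρ`, the radius of convergence of `A`;
outside the disk of convergence `A(z)` stands for the analytic continuation. -/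
def HasDeltaExpansion (A : FormalMultilinearSeries ℂ ℂ ℂ) (ρ : ℝ) (f e : ℂ → ℂ) : Prop :=
  ∃ (D : Set ℂ) (F : ℂ → ℂ), IsDeltaContinuation A ρ D F ∧
    (fun z => F z - f z) =O[𝓝[D] (ρ : ℂ)] e

/-! ### Labels and relabelings of decorated trees -/

namespace DecoratedTree

/-! Write `N`, `M`, `T` for the exponential generating functions of the trees whose root is not `⊕`,
not `⊖`, arbitrary. A tree with a `⊕`-root is a set of at least two trees without `⊕`-root, so `T =
exp N - 1`; likewise `T = exp M - 1`, hence `M = N`. Sorting the trees counted by `N` by their root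
gives `N = z + (exp M - 1 - M) + P(T)`, that is `N = z + Λ(N)`: the series `N` is the compositional
inverse of `w ↦ w - Λ(w)`. Splitting blossomed trees at the root gives a linear system with the same
coefficients as the derivative of this equation, and its solution is `T^⊕ = N'`. These identities
hold between formal power series (`egfSeries_equations`, `egfSeries_blossomCount_replaceable`).

The rest is complex analysis of an inverse function. `Λ` is built from series with nonnegative
coefficients, so `Λ'` increases from `0` and Condition (C) yields a unique `κ` with `Λ'(κ) = 1`. On
`|w| < κ` one has `|Λ'(w)| < 1`, so `w - Λ(w)` is injective there with open image. On `|w| = κ`, `w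
≠ κ`, one has `|Λ(w)| < Λ(κ)`, because `exp w - 1 - w` contains both `w ^ 2` and `w ^ 3`. Hence the
image contains the closed disk of radius `R = κ - Λ(κ)` except the point `R` itself, and the inverse
is analytic there (`InversionData.closedBall_subset_image`, `InversionData.analyticAt_inverse`). By
uniqueness of the formal solution its Taylor series is `N` (`eq_of_functional_equation`).

At `κ` the function `R - (w - Λ(w))` has a double zero. Extracting a square root shows that near `R`
the inverse is an analytic function `ω` of `s = √(1 - z / R)` with `ω'(0) = -2R / μ`
(`InversionData.exists_local_param`), at least in a sector where `ω(s)` stays in `|w| < κ`.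
Compactness glues this sector to a neighbourhood of the rest of the disk, which gives the
`Δ`-domain. The expansions of `N`, of `T = exp N - 1` and of `T^⊕ = N'` are read off from `ω`. The
point `R` is a singularity since `N'` is unbounded there. -/

lemma finite_labels (t : DecoratedTree) : t.labels.Finite := by
  induction t with
  | leaf a => exact Set.finite_singleton a
  | node k d c ih => exact Set.finite_iUnion ih

lemma IsTree.nonempty_labels {t : DecoratedTree} (ht : t.IsTree) : t.labels.Nonempty := by
  induction t with
  | leaf a => exact Set.singleton_nonempty a
  | node k d c ih =>
    obtain ⟨hk, hc, -, -⟩ := ht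
    exact Set.nonempty_iUnion.2 ⟨⟨0, by lia⟩, ih _ (hc _)⟩

lemma IsTree.minLabel_mem {t : DecoratedTree} (ht : t.IsTree) : t.minLabel ∈ t.labels :=
  Nat.sInf_mem ht.nonempty_labels

lemma minLabel_le {t : DecoratedTree} {a : ℕ} (ha : a ∈ t.labels) : t.minLabel ≤ a :=
  Nat.sInf_le ha

lemma IsTree.ncard_labels {t : DecoratedTree} (ht : t.IsTree) : t.labels.ncard = t.size := by
  induction t with
  | leaf a => simp [labels, size]
  | node k d c ih =>
    obtain ⟨hk, hc, hd, -⟩ := ht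
    rw [labels, size, Set.ncard_iUnion_of_finite (fun i => (c i).finite_labels)
      (fun i j hij => hd i j hij), finsum_eq_sum_of_fintype]
    exact Finset.sum_congr rfl fun i _ => ih i (hc i)

lemma labels_relabel (f : ℕ → ℕ) (t : DecoratedTree) :
    (t.relabel f).labels = f '' t.labels := by
  induction t with
  | leaf a => simp [relabel, labels]
  | node k d c ih => simp [relabel, labels, ih, Set.image_iUnion]

lemma relabel_relabel (f g : ℕ → ℕ) (t : DecoratedTree) :
    (t.relabel f).relabel g = t.relabel (g ∘ f) := by
  induction t with
  | leaf a => rfl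
  | node k d c ih => simp [relabel, ih]

lemma relabel_congr {f g : ℕ → ℕ} {t : DecoratedTree} (h : ∀ a ∈ t.labels, f a = g a) :
    t.relabel f = t.relabel g := by
  induction t with
  | leaf a => simpa [relabel, labels] using h
  | node k d c ih =>
    simp only [relabel, node.injEq, heq_eq_eq, true_and]
    exact funext fun i => ih i fun a ha => h a (Set.mem_iUnion.2 ⟨i, ha⟩)

lemma relabel_id (t : DecoratedTree) : t.relabel id = t := by
  induction t with
  | leaf a => rfl
  | node k d c ih => simp [relabel, ih]

lemma relabel_eq_self {f : ℕ → ℕ} {t : DecoratedTree} (h : ∀ a ∈ t.labels, f a = a) :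
    t.relabel f = t :=
  (relabel_congr h).trans t.relabel_id

lemma IsTree.minLabel_relabel {f : ℕ → ℕ} {t : DecoratedTree} (ht : t.IsTree)
    (hf : StrictMonoOn f t.labels) : (t.relabel f).minLabel = f t.minLabel := by
  have h : f t.minLabel ∈ (t.relabel f).labels := by
    rw [labels_relabel]; exact Set.mem_image_of_mem f ht.minLabel_mem
  refine le_antisymm (minLabel_le h) ?_
  have h' : (t.relabel f).minLabel ∈ (t.relabel f).labels := Nat.sInf_mem ⟨_, h⟩
  rw [labels_relabel] at h'
  obtain ⟨a, ha, ha'⟩ := h'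
  rw [← ha']
  exact hf.monotoneOn ht.minLabel_mem ha (minLabel_le ha)

/-- An increasing relabeling keeps the minimal labels of siblings in the same order; injectivity
alone would not preserve the sorting of the children. -/
lemma IsTree.relabel {f : ℕ → ℕ} {t : DecoratedTree} (ht : t.IsTree)
    (hf : StrictMonoOn f t.labels) : (t.relabel f).IsTree := by
  induction t with
  | leaf a => trivial
  | node k d c ih =>
    obtain ⟨hk, hc, hd, hm⟩ := ht
    have hs : ∀ i, (c i).labels ⊆ (node k d c).labels := fun i =>
      Set.subset_iUnion (fun i => (c i).labels) i
    refine ⟨hk, fun i => ih i (hc i) (hf.mono (hs i)), fun i j hij => ?_, fun i j hij => ?_⟩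
    · simp only [labels_relabel]
      refine Set.disjoint_left.2 ?_
      rintro _ ⟨a, ha, rfl⟩ ⟨b, hb, hab⟩
      rw [hf.injOn (hs j hb) (hs i ha) hab] at hb
      exact Set.disjoint_left.1 (hd i j hij) ha hb
    · simp only [(hc i).minLabel_relabel (hf.mono (hs i)),
        (hc j).minLabel_relabel (hf.mono (hs j))]
      exact hf (hs i (hc i).minLabel_mem) (hs j (hc j).minLabel_mem) (hm hij)

/-- A property of trees that does not depend on the leaf labels. -/
def LabelFree (Q : DecoratedTree → Prop) : Prop := ∀ f t, Q (t.relabel f) ↔ Q t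

lemma labelFree_rootIsJoin : LabelFree RootIsJoin := by
  rintro f (a | ⟨k, (_ | _ | G), c⟩) <;> rfl

lemma labelFree_rootIsUnion : LabelFree RootIsUnion := by
  rintro f (a | ⟨k, (_ | _ | G), c⟩) <;> rfl

lemma labelFree_isReduced : LabelFree IsReduced := by
  intro f t
  induction t with
  | leaf a => rfl
  | node k d c ih =>
    cases d <;>
    simp [relabel, IsReduced, ih, labelFree_rootIsJoin f _, labelFree_rootIsUnion f _]

lemma labelFree_graphsIn (P : GraphSet) : LabelFree (GraphsIn P) := by
  intro f t
  induction t with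
  | leaf a => rfl
  | node k d c ih => cases d <;> simp [relabel, GraphsIn, ih]

lemma LabelFree.and {Q Q' : DecoratedTree → Prop} (h : LabelFree Q) (h' : LabelFree Q') :
    LabelFree fun t => Q t ∧ Q' t := fun f t => and_congr (h f t) (h' f t)

lemma LabelFree.not {Q : DecoratedTree → Prop} (h : LabelFree Q) :
    LabelFree fun t => ¬ Q t := fun f t => not_congr (h f t)

end DecoratedTree

instance Decoration.instFinite {V : Type} [Finite V] : Finite (Decoration V) := by
  have : Function.Injective (fun d : Decoration V =>
      (match d with
        | .join => none
        | .union => some none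
        | .graph G => some (some G) : Option (Option (SimpleGraph V)))) := by
    rintro (_ | _ | G) (_ | _ | G') h <;> simp_all
  exact Finite.of_injective _ this

/-! ### Counting trees and forests with a given set of labels -/

namespace DecoratedTree

/-- The trees with property `Q` and label set `S`. -/
def treesOn (Q : DecoratedTree → Prop) (S : Finset ℕ) : Set DecoratedTree :=
  {t | t.IsTree ∧ t.labels = S ∧ Q t}

/-- The families of `k` trees with property `Q`, disjoint label sets with union `S`, sorted by
minimal labels. -/
def forestsOn (Q : DecoratedTree → Prop) (k : ℕ) (S : Finset ℕ) : Set (Fin k → DecoratedTree) :=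
  {c | (∀ i, (c i).IsTree ∧ Q (c i)) ∧ (∀ i j, i ≠ j → Disjoint (c i).labels (c j).labels) ∧
    (StrictMono fun i => (c i).minLabel) ∧ ⋃ i, (c i).labels = S}

/-- The minimal labels of the trees are `k` distinct elements of `S`. -/
lemma card_le_of_mem_forestsOn {Q : DecoratedTree → Prop} {k : ℕ} {S : Finset ℕ}
    {c : Fin k → DecoratedTree} (hc : c ∈ forestsOn Q k S) : k ≤ S.card := by
  obtain ⟨hc, -, hm, hS⟩ := hc
  have : (Finset.univ.image fun i => (c i).minLabel) ⊆ S := by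
    intro a ha
    obtain ⟨i, -, rfl⟩ := Finset.mem_image.1 ha
    rw [← Finset.mem_coe, ← hS]
    exact Set.mem_iUnion.2 ⟨i, (hc i).1.minLabel_mem⟩
  simpa [Finset.card_image_of_injective _ hm.injective] using Finset.card_le_card this

/-- Induction on the number of labels: the arity of the root is at most `S.card`, and each subtree
has a strictly smaller label set because the root has another child. -/
lemma finite_treesOn (Q : DecoratedTree → Prop) (S : Finset ℕ) : (treesOn Q S).Finite := by
  suffices h : ∀ n (S : Finset ℕ), S.card ≤ n → (treesOn (fun _ => True) S).Finite from
    (h _ S le_rfl).subset fun t ht => ⟨ht.1, ht.2.1, trivial⟩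
  intro n
  induction n with
  | zero =>
    intro S hS
    refine Set.Finite.subset Set.finite_empty fun t ht => ?_
    have := ht.1.nonempty_labels
    rw [ht.2.1] at this
    simp_all
  | succ n ih =>
    intro S hS
    let A : Set DecoratedTree := ⋃ S' ∈ {S' ∈ S.powerset | S'.card ≤ n}, treesOn (fun _ => True) S'
    have hA : A.Finite := Set.Finite.biUnion (Finset.finite_toSet _) fun S' hS' =>
      ih S' (Finset.mem_filter.1 hS').2
    have hfin : (leaf '' S ∪ ⋃ k ∈ Finset.range (S.card + 1), ⋃ d : Decoration (Fin k),
        node k d '' (Set.univ.pi fun _ => A)).Finite := by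
      refine (S.finite_toSet.image _).union (Set.Finite.biUnion (Finset.finite_toSet _)
        fun k _ => Set.finite_iUnion fun d => Set.Finite.image _ ?_)
      exact Set.Finite.pi fun _ => hA
    refine hfin.subset ?_
    rintro (a | ⟨k, d, c⟩) ⟨ht, hl, -⟩
    · left
      refine ⟨a, ?_, rfl⟩
      rw [← hl]; exact rfl
    · right
      obtain ⟨hk, hc, hd, hm⟩ := ht
      have hf : c ∈ forestsOn (fun _ => True) k S := ⟨fun i => ⟨hc i, trivial⟩, hd, hm, hl⟩
      have hkS := card_le_of_mem_forestsOn hf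
      simp only [Set.mem_iUnion]
      refine ⟨k, by simpa using by lia, d, c, fun i _ => ?_, rfl⟩
      have hi : (c i).labels ⊆ S := by rw [← hl]; exact Set.subset_iUnion (fun i => (c i).labels) i
      simp only [A, Set.mem_iUnion]
      refine ⟨(c i).finite_labels.toFinset, ?_, hc i, by simp, trivial⟩
      simp only [Finset.mem_filter, Finset.mem_powerset]
      refine ⟨by simpa using hi, ?_⟩
      -- A second child exists since `2 ≤ k`; its minimal label is missing from the `i`-th one.
      obtain ⟨j, hj⟩ : ∃ j : Fin k, j ≠ i := by
        have : Nontrivial (Fin k) := Fin.nontrivial_iff_two_le.2 hk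
        exact exists_ne i
      have hlt : (c i).finite_labels.toFinset ⊂ S := by
        refine Finset.ssubset_iff_subset_ne.2 ⟨by simpa using hi, fun h => ?_⟩
        have hjS : (c j).minLabel ∈ S := by
          rw [← Finset.mem_coe, ← hl]
          exact Set.mem_iUnion.2 ⟨j, (hc j).minLabel_mem⟩
        rw [← h, Set.Finite.mem_toFinset] at hjS
        exact Set.disjoint_left.1 (hd j i hj) (hc j).minLabel_mem hjS
      have := Finset.card_lt_card hlt
      lia

lemma finite_forestsOn (Q : DecoratedTree → Prop) (k : ℕ) (S : Finset ℕ) :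
    (forestsOn Q k S).Finite := by
  have hA : (⋃ S' ∈ S.powerset, treesOn Q S').Finite :=
    Set.Finite.biUnion (Finset.finite_toSet _) fun S' _ => finite_treesOn Q S'
  refine (Set.Finite.pi' fun _ : Fin k => hA).subset fun c hc i => ?_
  simp only [Set.mem_iUnion]
  refine ⟨(c i).finite_labels.toFinset, ?_, (hc.1 i).1, by simp, (hc.1 i).2⟩
  have hi : (c i).labels ⊆ S := by
    rw [← hc.2.2.2]; exact Set.subset_iUnion (fun i => (c i).labels) i
  simpa using hi

/-- The number of trees with property `Q` and labels `0, …, n - 1`. -/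
noncomputable def treeCount (Q : DecoratedTree → Prop) (n : ℕ) : ℕ :=
  (treesOn Q (Finset.range n)).ncard

/-- The number of forests of `k` trees with property `Q`, on `n` labels. -/
noncomputable def forestCount (Q : DecoratedTree → Prop) (k n : ℕ) : ℕ :=
  (forestsOn Q k (Finset.range n)).ncard

end DecoratedTree

/-- The increasing bijection between two finite sets of equal size, extended by `0` outside `S`.
Relabeling along it shows that counts depend only on the number of labels. -/
lemma exists_strictMonoOn_image_eq {S S' : Finset ℕ} (h : S.card = S'.card) :
    ∃ f : ℕ → ℕ, StrictMonoOn f S ∧ S.image f = S' := by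
  classical
  let e := (S.orderIsoOfFin rfl).symm.trans (S'.orderIsoOfFin h.symm)
  have he : ∀ a (ha : a ∈ S), (fun a => if ha : a ∈ S then (e ⟨a, ha⟩ : ℕ) else 0) a = e ⟨a, ha⟩ :=
    fun a ha => dif_pos ha
  refine ⟨fun a => if ha : a ∈ S then (e ⟨a, ha⟩ : ℕ) else 0, fun a ha b hb hab => ?_, ?_⟩
  · rw [he a ha, he b hb]
    exact e.strictMono (a := ⟨a, ha⟩) (b := ⟨b, hb⟩) hab
  · ext b
    simp only [Finset.mem_image]
    constructor
    · rintro ⟨a, ha, rfl⟩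
      rw [dif_pos ha]
      exact (e ⟨a, ha⟩).2
    · intro hb
      refine ⟨e.symm ⟨b, hb⟩, (e.symm ⟨b, hb⟩).2, ?_⟩
      simp

namespace DecoratedTree

lemma ncard_treesOn_le {Q : DecoratedTree → Prop} (hQ : LabelFree Q) {S S' : Finset ℕ}
    (h : S.card = S'.card) : (treesOn Q S).ncard ≤ (treesOn Q S').ncard := by
  obtain ⟨f, hf, hfS⟩ := exists_strictMonoOn_image_eq h
  refine Set.ncard_le_ncard_of_injOn (relabel f) ?_ ?_ (finite_treesOn Q S')
  · rintro t ⟨ht, hl, hq⟩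
    refine ⟨ht.relabel (hl ▸ hf), ?_, (hQ f t).2 hq⟩
    rw [labels_relabel, hl, ← hfS, Finset.coe_image]
  · intro t ht t' ht' htt
    have key : ∀ t ∈ treesOn Q S, (t.relabel f).relabel (Function.invFunOn f S) = t := by
      rintro t ⟨-, hl, -⟩
      rw [relabel_relabel]
      refine relabel_eq_self fun a ha => ?_
      exact hf.injOn.leftInvOn_invFunOn (hl ▸ ha)
    rw [← key t ht, htt, key t' ht']

lemma ncard_treesOn {Q : DecoratedTree → Prop} (hQ : LabelFree Q) (S : Finset ℕ) :
    (treesOn Q S).ncard = treeCount Q S.card :=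
  le_antisymm (ncard_treesOn_le hQ (by simp)) (ncard_treesOn_le hQ (by simp))

end DecoratedTree

/-- The counting device for all root decompositions: a disjoint union indexed by the shape of the
root and the distribution of the labels. -/
lemma Set.ncard_eq_sum_of_mem_iff {α β : Type*} {X : Set α} (I : Finset β) (A : β → Set α)
    (hfin : ∀ b ∈ I, (A b).Finite)
    (hdisj : ∀ b ∈ I, ∀ b' ∈ I, ∀ x ∈ A b, x ∈ A b' → b = b')
    (hX : ∀ x, x ∈ X ↔ ∃ b ∈ I, x ∈ A b) : X.ncard = ∑ b ∈ I, (A b).ncard := by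
  have hXe : X = ⋃ b : {b // b ∈ I}, A b.1 := by
    ext x
    simp [hX]
  rw [hXe, Set.ncard_iUnion_of_finite (s := fun b : {b // b ∈ I} => A b.1) (fun b => hfin b b.2), finsum_eq_sum_of_fintype,
    Finset.sum_coe_sort I fun b => (A b).ncard]
  intro b b' hbb'
  exact Set.disjoint_left.2 fun x hx hx' => hbb' (Subtype.ext (hdisj b b.2 b' b'.2 x hx hx'))

namespace DecoratedTree

lemma ncard_forestsOn_zero (Q : DecoratedTree → Prop) (S : Finset ℕ) :
    (forestsOn Q 0 S).ncard = if S.card = 0 then 1 else 0 := by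
  have h : ∀ c : Fin 0 → DecoratedTree, c ∈ forestsOn Q 0 S ↔ S = ∅ := by
    intro c
    simp only [forestsOn, Set.mem_ofPred_eq, IsEmpty.forall_iff, true_and, Set.iUnion_of_empty,
      eq_comm (a := (∅ : Set ℕ)), Finset.coe_eq_empty, and_iff_right_iff_imp]
    exact fun _ i => i.elim0
  split_ifs with hS
  · rw [Finset.card_eq_zero] at hS
    rw [Set.ncard_eq_one]
    exact ⟨Fin.elim0, Set.eq_singleton_iff_unique_mem.2
      ⟨(h _).2 hS, fun c _ => Subsingleton.elim _ _⟩⟩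
  · rw [Finset.card_eq_zero] at hS
    rw [Set.eq_empty_of_forall_notMem fun c hc => hS ((h c).1 hc), Set.ncard_empty]

lemma ncard_forestsOn_succ_empty (Q : DecoratedTree → Prop) (k : ℕ) :
    (forestsOn Q (k + 1) ∅).ncard = 0 := by
  rw [Set.eq_empty_of_forall_notMem (s := forestsOn Q (k + 1) ∅), Set.ncard_empty]
  intro c hc
  simpa using card_le_of_mem_forestsOn hc

lemma cons_mem_forestsOn {Q : DecoratedTree → Prop} {k : ℕ} {S : Finset ℕ} {m : ℕ}
    (hmin : ∀ a ∈ S, m < a) {S₀ : Finset ℕ} (hS₀ : S₀ ⊆ S) (t : DecoratedTree)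
    (c : Fin k → DecoratedTree) (ht : t ∈ treesOn Q (insert m S₀))
    (hc : c ∈ forestsOn Q k (S \ S₀)) :
    (Fin.cons t c : Fin (k + 1) → DecoratedTree) ∈ forestsOn Q (k + 1) (insert m S) := by
  obtain ⟨ht, hl, hq⟩ := ht
  obtain ⟨hcQ, hd, hm, hu⟩ := hc
  have hci : ∀ i, (c i).labels ⊆ (S \ S₀ : Finset ℕ) := fun i => by
    rw [← hu]; exact Set.subset_iUnion (fun i => (c i).labels) i
  have hdis : ∀ i, Disjoint t.labels (c i).labels := fun i => by
    refine Set.disjoint_left.2 fun a ha ha' => ?_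
    have h1 := hci i ha'
    rw [hl] at ha
    simp only [Finset.coe_insert, Set.mem_insert_iff, Finset.mem_coe, Finset.coe_sdiff,
      Set.mem_sdiff] at ha h1
    rcases ha with rfl | ha
    · exact lt_irrefl _ (hmin _ h1.1)
    · exact h1.2 ha
  have htm : t.minLabel ≤ m := minLabel_le (by rw [hl]; simp)
  refine ⟨fun i => ?_, fun i j => ?_, ?_, ?_⟩
  · refine Fin.cases ?_ (fun i => ?_) i
    · exact ⟨ht, hq⟩
    · simpa using hcQ i
  · refine Fin.cases ?_ (fun i => ?_) i <;> refine Fin.cases ?_ (fun j => ?_) j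
    · simp
    · exact fun _ => by simpa using hdis j
    · exact fun _ => by simpa using (hdis i).symm
    · intro hij
      simpa using hd i j fun h => hij (congrArg _ h)
  · refine Fin.strictMono_iff_lt_succ.2 ?_ |> fun h => h
    intro i
    rcases i with ⟨_ | i, hi⟩
    · refine lt_of_le_of_lt htm (hmin _ ?_)
      have := hci ⟨0, hi⟩ (hcQ ⟨0, hi⟩).1.minLabel_mem
      rw [Finset.mem_coe, Finset.mem_sdiff] at this
      exact this.1
    · exact hm (show (⟨i, by lia⟩ : Fin k) < ⟨i + 1, hi⟩ by simp)
  · ext a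
    have hu' := Set.ext_iff.1 hu a
    simp only [Set.mem_iUnion, Finset.coe_sdiff, Set.mem_sdiff, Finset.mem_coe] at hu'
    simp only [Set.mem_iUnion, Fin.exists_fin_succ, Fin.cons_zero, Fin.cons_succ, hu', hl,
      Finset.coe_insert, Set.mem_insert_iff, Finset.mem_coe]
    have := @hS₀ a
    tauto

/-- As the trees are sorted by minimal label, the first one is the tree that contains the minimum
`m`. Its other labels `S₀` are arbitrary, and what remains is a sorted forest on `S \ S₀`. -/
lemma ncard_forestsOn_succ (Q : DecoratedTree → Prop) (k : ℕ) {S : Finset ℕ} {m : ℕ}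
    (hmin : ∀ a ∈ S, m < a) :
    (forestsOn Q (k + 1) (insert m S)).ncard =
      ∑ S₀ ∈ S.powerset, (treesOn Q (insert m S₀)).ncard * (forestsOn Q k (S \ S₀)).ncard := by
  have hmS : m ∉ S := fun h => lt_irrefl _ (hmin m h)
  let F : DecoratedTree × (Fin k → DecoratedTree) → (Fin (k + 1) → DecoratedTree) :=
    fun p => Fin.cons p.1 p.2
  have hF : Function.Injective F := fun p p' h => by
    obtain ⟨h1, h2⟩ := Fin.cons_injective2 h
    exact Prod.ext h1 h2
  rw [Set.ncard_eq_sum_of_mem_iff S.powerset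
    fun S₀ => F '' (treesOn Q (insert m S₀) ×ˢ forestsOn Q k (S \ S₀))]
  · refine Finset.sum_congr rfl fun S₀ _ => ?_
    rw [Set.ncard_image_of_injective _ hF, Set.ncard_prod]
  · exact fun S₀ _ => ((finite_treesOn _ _).prod (finite_forestsOn _ _ _)).image _
  · rintro S₀ hS₀ S₁ hS₁ _ ⟨⟨t, c⟩, ⟨ht, -⟩, rfl⟩ ⟨⟨t', c'⟩, ⟨ht', -⟩, h⟩
    obtain ⟨rfl, -⟩ := Prod.ext_iff.1 (hF h)
    have := ht.2.1.symm.trans ht'.2.1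
    rw [Finset.coe_inj] at this
    rw [Finset.mem_powerset] at hS₀ hS₁
    rw [← Finset.erase_insert (fun h => hmS (hS₀ h)), this,
      Finset.erase_insert (fun h => hmS (hS₁ h))]
  · intro c
    constructor
    · rintro ⟨hQ, hd, hm, hu⟩
      have hsub : ∀ i, (c i).labels ⊆ (insert m S : Finset ℕ) := fun i => by
        rw [← hu]; exact Set.subset_iUnion (fun i => (c i).labels) i
      -- The tree containing `m` has minimal label at most `m`, hence so has the first tree, and no
      -- label lies below `m`.
      have hm0 : m ∈ (c 0).labels := by
        have : m ∈ ⋃ i, (c i).labels := by rw [hu]; simp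
        obtain ⟨i, hi⟩ := Set.mem_iUnion.1 this
        have h1 : (c 0).minLabel ≤ (c i).minLabel := hm.monotone (Fin.zero_le i)
        have h2 : (c i).minLabel ≤ m := minLabel_le hi
        have h3 := hsub 0 (hQ 0).1.minLabel_mem
        simp only [Finset.coe_insert, Set.mem_insert_iff, Finset.mem_coe] at h3
        rcases h3 with h3 | h3
        · rw [← h3]; exact (hQ 0).1.minLabel_mem
        · have := hmin _ h3
          lia
      have hins : insert m ((c 0).finite_labels.toFinset.erase m) =
          (c 0).finite_labels.toFinset := Finset.insert_erase (by simpa using hm0)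
      refine ⟨(c 0).finite_labels.toFinset.erase m, ?_, ⟨c 0, fun i => c i.succ⟩, ⟨?_, ?_⟩, ?_⟩
      · rw [Finset.mem_powerset]
        intro a ha
        rw [Finset.mem_erase, Set.Finite.mem_toFinset] at ha
        have := hsub 0 ha.2
        simp only [Finset.coe_insert, Set.mem_insert_iff, Finset.mem_coe] at this
        exact this.resolve_left ha.1
      · refine ⟨(hQ 0).1, ?_, (hQ 0).2⟩
        rw [hins, Set.Finite.coe_toFinset]
      · refine ⟨fun i => hQ _, fun i j hij => hd _ _ fun h => hij (Fin.succ_injective _ h),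
          hm.comp (Fin.strictMono_succ), ?_⟩
        ext a
        have hu' := Set.ext_iff.1 hu a
        simp only [Set.mem_iUnion, Fin.exists_fin_succ, Finset.coe_insert, Set.mem_insert_iff,
          Finset.mem_coe] at hu'
        simp only [Set.mem_iUnion, Finset.coe_sdiff, Set.mem_sdiff, Finset.mem_coe,
          Finset.mem_erase, Set.Finite.mem_toFinset]
        have h0 : ∀ i : Fin k, a ∈ (c i.succ).labels → a ∉ (c 0).labels := fun i hi h0 =>
          Set.disjoint_left.1 (hd _ _ (Fin.succ_ne_zero i)) hi h0
        constructor
        · rintro ⟨i, hi⟩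
          have h1 := h0 i hi
          refine ⟨(hu'.1 (Or.inr ⟨i, hi⟩)).resolve_left ?_, fun h => h1 h.2⟩
          rintro rfl
          exact h1 hm0
        · rintro ⟨haS, ha⟩
          refine (hu'.2 (Or.inr haS)).resolve_left fun h => ha ⟨?_, h⟩
          rintro rfl
          exact hmS haS
      · exact Fin.cons_self_tail c
    · rintro ⟨S₀, hS₀, ⟨t, d⟩, ⟨ht, hd⟩, rfl⟩
      exact cons_mem_forestsOn hmin (Finset.mem_powerset.1 hS₀) t d ht hd

/-- The two claims are proved together: the recursion in `k` needs that forests of `k` trees are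
counted by the number of labels alone, and the recursion carries this independence over to `k + 1`.
-/
lemma ncard_forestsOn_and_succ {Q : DecoratedTree → Prop} (hQ : LabelFree Q) (k : ℕ) :
    (∀ S, (forestsOn Q k S).ncard = forestCount Q k S.card) ∧
      ∀ n, forestCount Q (k + 1) (n + 1) = ∑ j ∈ Finset.range (n + 1),
        n.choose j * (treeCount Q (j + 1) * forestCount Q k (n - j)) := by
  have key : ∀ k, (∀ S, (forestsOn Q k S).ncard = forestCount Q k S.card) →
      ∀ {S : Finset ℕ} {m : ℕ}, (∀ a ∈ S, m < a) → (forestsOn Q (k + 1) (insert m S)).ncard =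
        ∑ j ∈ Finset.range (S.card + 1), S.card.choose j *
          (treeCount Q (j + 1) * forestCount Q k (S.card - j)) := by
    intro k hk S m hmin
    rw [ncard_forestsOn_succ Q k hmin]
    have := Finset.sum_powerset_apply_card
      (fun j => treeCount Q (j + 1) * forestCount Q k (S.card - j)) (x := S)
    simp only [smul_eq_mul] at this
    rw [← this]
    refine Finset.sum_congr rfl fun S₀ hS₀ => ?_
    rw [Finset.mem_powerset] at hS₀
    rw [ncard_treesOn hQ, hk, Finset.card_insert_of_notMem
      (fun h => lt_irrefl _ (hmin m (hS₀ h))), Finset.card_sdiff_of_subset hS₀]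
  -- The label `0` plays the role of the minimum, the `n` other labels being a shifted copy of
  -- `range n`.
  have hrange : ∀ n, Finset.range (n + 1) = insert 0 ((Finset.range n).image Nat.succ) := by
    intro n
    ext a
    rcases a with _ | a <;> simp
  have hcard : ∀ n, ((Finset.range n).image Nat.succ).card = n := fun n => by
    rw [Finset.card_image_of_injective _ Nat.succ_injective, Finset.card_range]
  have hsucc : ∀ k, (∀ S, (forestsOn Q k S).ncard = forestCount Q k S.card) →
      ∀ n, forestCount Q (k + 1) (n + 1) = ∑ j ∈ Finset.range (n + 1),
        n.choose j * (treeCount Q (j + 1) * forestCount Q k (n - j)) := by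
    intro k hk n
    have h := key k hk (S := (Finset.range n).image Nat.succ) (m := 0) (by simp)
    rwa [← hrange, hcard] at h
  have hall : ∀ k S, (forestsOn Q k S).ncard = forestCount Q k S.card := by
    intro k
    induction k with
    | zero => intro S; rw [forestCount, ncard_forestsOn_zero, ncard_forestsOn_zero]; simp
    | succ k ih =>
      intro S
      rcases S.eq_empty_or_nonempty with rfl | hS
      · simp [forestCount]
      · have hmin : ∀ a ∈ S.erase (S.min' hS), S.min' hS < a := fun a ha =>
          Finset.min'_lt_of_mem_erase_min' S hS ha
        have h1 := key k ih hmin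
        rw [Finset.insert_erase (S.min'_mem hS)] at h1
        have hc : S.card = (S.erase (S.min' hS)).card + 1 :=
          (Finset.card_erase_add_one (S.min'_mem hS)).symm
        rw [h1, hc, hsucc k ih]
  exact ⟨hall k, hsucc k (hall k)⟩

lemma ncard_forestsOn {Q : DecoratedTree → Prop} (hQ : LabelFree Q) (k : ℕ) (S : Finset ℕ) :
    (forestsOn Q k S).ncard = forestCount Q k S.card :=
  (ncard_forestsOn_and_succ hQ k).1 S

lemma forestCount_succ_succ {Q : DecoratedTree → Prop} (hQ : LabelFree Q) (k n : ℕ) :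
    forestCount Q (k + 1) (n + 1) = ∑ j ∈ Finset.range (n + 1),
      n.choose j * (treeCount Q (j + 1) * forestCount Q k (n - j)) :=
  (ncard_forestsOn_and_succ hQ k).2 n

lemma forestCount_zero (Q : DecoratedTree → Prop) (n : ℕ) :
    forestCount Q 0 n = if n = 0 then 1 else 0 := by
  simp [forestCount, ncard_forestsOn_zero]

lemma forestCount_succ_zero (Q : DecoratedTree → Prop) (k : ℕ) :
    forestCount Q (k + 1) 0 = 0 := ncard_forestsOn_succ_empty Q k

lemma treeCount_zero (Q : DecoratedTree → Prop) : treeCount Q 0 = 0 := by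
  rw [treeCount, Set.eq_empty_of_forall_notMem (s := treesOn Q _), Set.ncard_empty]
  intro t ht
  have := ht.1.nonempty_labels
  rw [ht.2.1] at this
  simp_all

/-- The root is an internal node with decoration in `D` and subtrees with property `Q`. -/
def RootIn (D : ∀ k, Set (Decoration (Fin k))) (Q : DecoratedTree → Prop) : DecoratedTree → Prop
  | leaf _ => False
  | node k d c => d ∈ D k ∧ ∀ i, Q (c i)

/-- For a fixed arity `k` the decoration and the forest of subtrees are chosen independently.
Arities below `2` are excluded by `IsTree`, those above `n` by the number of labels. -/
lemma treeCount_rootIn (D : ∀ k, Set (Decoration (Fin k))) (Q : DecoratedTree → Prop) (n : ℕ) :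
    treeCount (RootIn D Q) n = ∑ k ∈ Finset.range (n + 1),
      (if 2 ≤ k then (D k).ncard else 0) * forestCount Q k n := by
  rw [treeCount, Set.ncard_eq_sum_of_mem_iff ({k ∈ Finset.range (n + 1) | 2 ≤ k})
    (fun k => (fun p : Decoration (Fin k) × (Fin k → DecoratedTree) => node k p.1 p.2) ''
      (D k ×ˢ forestsOn Q k (Finset.range n))), Finset.sum_filter]
  · refine Finset.sum_congr rfl fun k _ => ?_
    split_ifs
    · rw [Set.ncard_image_of_injective, Set.ncard_prod, forestCount]
      rintro ⟨d, c⟩ ⟨d', c'⟩ h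
      simpa using h
    · simp
  · exact fun k _ => ((Set.toFinite _).prod (finite_forestsOn _ _ _)).image _
  · rintro k - k' - _ ⟨⟨d, c⟩, -, rfl⟩ ⟨⟨d', c'⟩, -, h⟩
    simp only [node.injEq] at h
    exact h.1.symm
  · rintro (a | ⟨k, d, c⟩)
    · simp [treesOn, RootIn]
    · constructor
      · rintro ⟨⟨hk, hc, hd, hm⟩, hl, hD, hQ⟩
        have hf : c ∈ forestsOn Q k (Finset.range n) := ⟨fun i => ⟨hc i, hQ i⟩, hd, hm, hl⟩
        have := card_le_of_mem_forestsOn hf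
        rw [Finset.card_range] at this
        exact ⟨k, by simp; lia, ⟨d, c⟩, ⟨hD, hf⟩, rfl⟩
      · rintro ⟨k', hk', ⟨d', c'⟩, ⟨hd', hc'⟩, h⟩
        simp only [node.injEq] at h
        obtain ⟨rfl, h1, h2⟩ := h
        obtain rfl := eq_of_heq h1
        obtain rfl := eq_of_heq h2
        exact ⟨⟨(Finset.mem_filter.1 hk').2, fun i => (hc'.1 i).1, hc'.2.1, hc'.2.2.1⟩, hc'.2.2.2,
          hd', fun i => (hc'.1 i).2⟩

lemma treeCount_or {Q Q' : DecoratedTree → Prop} (h : ∀ t, Q t → ¬ Q' t) (n : ℕ) :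
    treeCount (fun t => Q t ∨ Q' t) n = treeCount Q n + treeCount Q' n := by
  rw [treeCount, treeCount, treeCount, ← Set.ncard_union_eq _ (finite_treesOn _ _)
    (finite_treesOn _ _)]
  · congr 1
    ext t
    simp only [treesOn, Set.mem_ofPred_eq, Set.mem_union]
    tauto
  · exact Set.disjoint_left.2 fun t ht ht' => h t ht.2.2 ht'.2.2

lemma treeCount_congr {Q Q' : DecoratedTree → Prop} (h : ∀ t, Q t ↔ Q' t) :
    treeCount Q = treeCount Q' := by
  rw [show Q = Q' from funext fun t => propext (h t)]

/-- Trees reduced to a leaf. -/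
def IsLeaf : DecoratedTree → Prop
  | leaf _ => True
  | node _ _ _ => False

lemma treeCount_isLeaf (n : ℕ) : treeCount IsLeaf n = if n = 1 then 1 else 0 := by
  have h : ∀ t, t ∈ treesOn IsLeaf (Finset.range n) ↔ t = leaf 0 ∧ n = 1 := by
    rintro (a | ⟨k, d, c⟩)
    · simp only [treesOn, IsTree, labels, IsLeaf, and_true, true_and, Set.mem_ofPred_eq,
        ← Finset.coe_singleton, Finset.coe_inj, leaf.injEq]
      constructor
      · intro h
        have hn : n = 1 := by simpa using congrArg Finset.card h.symm
        subst hn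
        simpa using h
      · rintro ⟨rfl, rfl⟩; rfl
    · simp [treesOn, IsLeaf]
  rw [treeCount]
  split_ifs with hn
  · rw [Set.ncard_eq_one]
    exact ⟨leaf 0, by ext t; rw [h]; simp [hn]⟩
  · rw [Set.eq_empty_of_forall_notMem (fun t ht => hn ((h t).1 ht).2), Set.ncard_empty]

end DecoratedTree

/-! ### Blossomed trees -/

/-- The graphs on `Option (Fin k)` that belong to `P` up to relabeling. -/
def GraphSet.blossomed (P : GraphSet) (k : ℕ) : Set (SimpleGraph (Option (Fin k))) :=
  {G | G.comap (finSuccEquiv' (0 : Fin (k + 1))) ∈ P (k + 1)}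

/-- Two identifications of `Option (Fin k)` with `Fin (k + 1)` differ by a permutation, so stability
makes the choice of the vertex turned into a blossom irrelevant. -/
lemma GraphSet.StableByRelabeling.comap_mem_iff {P : GraphSet} (hP : P.StableByRelabeling) {k : ℕ}
    (i : Fin (k + 1)) (G : SimpleGraph (Option (Fin k))) :
    G.comap (finSuccEquiv' i) ∈ P (k + 1) ↔ G ∈ P.blossomed k := by
  have key : ∀ i j : Fin (k + 1), G.comap (finSuccEquiv' i) ∈ P (k + 1) →
      G.comap (finSuccEquiv' j) ∈ P (k + 1) := by
    intro i j h
    have := hP _ _ h ((finSuccEquiv' j).trans (finSuccEquiv' i).symm)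
    rw [SimpleGraph.comap_comap] at this
    convert this using 2
    ext x
    simp
  exact ⟨key i 0, key 0 i⟩

/-- The shift `k + 1` turns the series `P` into its derivative when a graph has a blossom. -/
lemma GraphSet.ncard_blossomed (P : GraphSet) (k : ℕ) :
    (P.blossomed k).ncard = (P (k + 1)).ncard := by
  refine Set.ncard_congr (fun G _ => G.comap (finSuccEquiv' (0 : Fin (k + 1)))) (fun G h => h)
    (fun G G' _ _ h => ?_) (fun H hH => ⟨H.comap (finSuccEquiv' (0 : Fin (k + 1))).symm, ?_, ?_⟩)
  · have := congrArg (SimpleGraph.comap (finSuccEquiv' (0 : Fin (k + 1))).symm) h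
    simpa [SimpleGraph.comap_comap] using this
  · simpa [GraphSet.blossomed, SimpleGraph.comap_comap] using hH
  · simp [SimpleGraph.comap_comap]

/-- The graphs of the tree belong to `P`, and the tree is reduced. -/
def DecoratedTree.IsDecorated (P : GraphSet) (t : DecoratedTree) : Prop :=
  t.IsReduced ∧ t.GraphsIn P

lemma DecoratedTree.labelFree_isDecorated (P : GraphSet) : LabelFree (IsDecorated P) :=
  labelFree_isReduced.and (labelFree_graphsIn P)

namespace BlossomTree

/-- The set of leaf labels. -/
def labels : BlossomTree → Set ℕ
  | blossom => ∅
  | node _ _ b c => b.labels ∪ ⋃ i, (c i).labels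

/-- Leaves have distinct labels, the children are sorted by minimal leaf labels, and each internal
node has at least one child outside the path to the blossom. -/
def IsTree : BlossomTree → Prop
  | blossom => True
  | node k _ b c => 1 ≤ k ∧ b.IsTree ∧ (∀ i, (c i).IsTree) ∧
      (∀ i, Disjoint b.labels (c i).labels) ∧
      (∀ i j, i ≠ j → Disjoint (c i).labels (c j).labels) ∧ StrictMono fun i => (c i).minLabel

/-- The root is an internal node decorated with `⊕`. -/
def RootIsJoin : BlossomTree → Prop
  | node _ .join _ _ => True
  | _ => False

/-- The root is an internal node decorated with `⊖`. -/
def RootIsUnion : BlossomTree → Prop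
  | node _ .union _ _ => True
  | _ => False

/-- The graphs of the tree belong to `P` up to relabeling, and the tree is reduced. -/
def IsDecorated (P : GraphSet) : BlossomTree → Prop
  | blossom => True
  | node _ .join b c => (b.IsDecorated P ∧ ¬ b.RootIsJoin) ∧
      ∀ i, (c i).IsDecorated P ∧ ¬ (c i).RootIsJoin
  | node _ .union b c => (b.IsDecorated P ∧ ¬ b.RootIsUnion) ∧
      ∀ i, (c i).IsDecorated P ∧ ¬ (c i).RootIsUnion
  | node k (.graph G) b c => G ∈ P.blossomed k ∧ b.IsDecorated P ∧ ∀ i, (c i).IsDecorated P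

lemma finite_labels (b : BlossomTree) : b.labels.Finite := by
  induction b with
  | blossom => exact Set.finite_empty
  | node k d b c ih => exact ih.union (Set.finite_iUnion fun i => (c i).finite_labels)

lemma IsTree.ncard_labels {b : BlossomTree} (hb : b.IsTree) : b.labels.ncard = b.size := by
  induction b with
  | blossom => simp [labels, size]
  | node k d b c ih =>
    obtain ⟨hk, hb, hc, hbd, hd, -⟩ := hb
    rw [labels, size, Set.ncard_union_eq (Set.disjoint_iUnion_right.2 hbd) b.finite_labels
      (Set.finite_iUnion fun i => (c i).finite_labels), ih hb,
      Set.ncard_iUnion_of_finite (fun i => (c i).finite_labels)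
      (fun i j hij => hd i j hij), finsum_eq_sum_of_fintype]
    congr 1
    exact Finset.sum_congr rfl fun i _ => (hc i).ncard_labels

lemma labels_relabel (f : ℕ → ℕ) (b : BlossomTree) : (b.relabel f).labels = f '' b.labels := by
  induction b with
  | blossom => simp [relabel, labels]
  | node k d b c ih =>
    simp [relabel, labels, ih, Set.image_iUnion, Set.image_union, DecoratedTree.labels_relabel]

lemma relabel_relabel (f g : ℕ → ℕ) (b : BlossomTree) :
    (b.relabel f).relabel g = b.relabel (g ∘ f) := by
  induction b with
  | blossom => rfl
  | node k d b c ih => simp [relabel, ih, DecoratedTree.relabel_relabel]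

lemma relabel_eq_self {f : ℕ → ℕ} {b : BlossomTree} (h : ∀ a ∈ b.labels, f a = a) :
    b.relabel f = b := by
  induction b with
  | blossom => rfl
  | node k d b c ih =>
    simp only [relabel, node.injEq, heq_eq_eq, true_and]
    exact ⟨ih fun a ha => h a (Or.inl ha), funext fun i =>
      DecoratedTree.relabel_eq_self fun a ha => h a (Or.inr (Set.mem_iUnion.2 ⟨i, ha⟩))⟩

lemma IsTree.relabel {f : ℕ → ℕ} {b : BlossomTree} (hb : b.IsTree)
    (hf : StrictMonoOn f b.labels) : (b.relabel f).IsTree := by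
  induction b with
  | blossom => trivial
  | node k d b c ih =>
    obtain ⟨hk, hb, hc, hbd, hd, hm⟩ := hb
    have hs : ∀ i, (c i).labels ⊆ (node k d b c).labels := fun i a ha =>
      Or.inr (Set.mem_iUnion.2 ⟨i, ha⟩)
    have hsb : b.labels ⊆ (node k d b c).labels := fun a ha => Or.inl ha
    refine ⟨hk, ih hb (hf.mono hsb), fun i => (hc i).relabel (hf.mono (hs i)), fun i => ?_,
      fun i j hij => ?_, fun i j hij => ?_⟩
    · rw [labels_relabel, DecoratedTree.labels_relabel]
      exact (hbd i).image hf.injOn hsb (hs i)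
    · simp only [DecoratedTree.labels_relabel]
      exact (hd i j hij).image hf.injOn (hs i) (hs j)
    · simp only [(hc i).minLabel_relabel (hf.mono (hs i)),
        (hc j).minLabel_relabel (hf.mono (hs j))]
      exact hf (hs i (hc i).minLabel_mem) (hs j (hc j).minLabel_mem) (hm hij)

/-- A property of blossomed trees that does not depend on the leaf labels. -/
def LabelFree (B : BlossomTree → Prop) : Prop := ∀ f b, B (b.relabel f) ↔ B b

lemma labelFree_rootIsJoin : LabelFree RootIsJoin := by
  rintro f (_ | ⟨k, (_ | _ | G), b, c⟩) <;> rfl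

lemma labelFree_rootIsUnion : LabelFree RootIsUnion := by
  rintro f (_ | ⟨k, (_ | _ | G), b, c⟩) <;> rfl

lemma labelFree_isDecorated (P : GraphSet) : LabelFree (IsDecorated P) := by
  intro f b
  induction b with
  | blossom => rfl
  | node k d b c ih =>
    cases d <;>
    simp [relabel, IsDecorated, ih, labelFree_rootIsJoin f _, labelFree_rootIsUnion f _,
      DecoratedTree.labelFree_isDecorated P f _, DecoratedTree.labelFree_rootIsJoin f _,
      DecoratedTree.labelFree_rootIsUnion f _]

/-- A one-step recursion replacing the nested pattern matching: the decoration only matters at the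
node directly above the blossom. -/
lemma joinReplaceable_node {k : ℕ} {d : Decoration (Option (Fin k))} {b : BlossomTree}
    {c : Fin k → DecoratedTree} :
    (node k d b c).JoinReplaceable ↔ b.JoinReplaceable ∧ (d = .join → b ≠ blossom) := by
  cases b <;> cases d <;> simp [JoinReplaceable]

lemma labelFree_joinReplaceable : LabelFree JoinReplaceable := by
  intro f b
  induction b with
  | blossom => rfl
  | node k d b c ih =>
    rw [relabel, joinReplaceable_node, joinReplaceable_node, ih]
    cases b <;> simp [relabel]

end BlossomTree

/-- The index `i` is the rank of `m` in the increasing enumeration of the values of `f` together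
with `m`. It locates the subtree of the blossom among its sorted siblings. -/
lemma Fin.exists_strictMono_insertNth {k : ℕ} {f : Fin k → ℕ} (hf : StrictMono f) {m : ℕ}
    (hm : ∀ i, f i ≠ m) : ∃ i : Fin (k + 1), StrictMono (i.insertNth (α := fun _ => ℕ) m f) := by
  classical
  let A : Finset ℕ := insert m (Finset.univ.image f)
  have hA : A.card = k + 1 := by
    rw [Finset.card_insert_of_notMem (by simpa using hm),
      Finset.card_image_of_injective _ hf.injective]
    simp
  let e := A.orderEmbOfFin hA
  have hr : Set.range e = A := A.range_orderEmbOfFin hA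
  obtain ⟨i, hi⟩ : m ∈ Set.range e := by rw [hr]; simp [A]
  have hfe : (fun j => e (i.succAbove j)) = f := by
    refine (StrictMono.range_inj (e.strictMono.comp (Fin.strictMono_succAbove i)) hf).1 ?_
    ext a
    have ha : a ∈ Set.range e ↔ a = m ∨ ∃ j, f j = a := by rw [hr]; simp [A]
    simp only [Set.mem_range, Function.comp_apply] at ha ⊢
    constructor
    · rintro ⟨j, rfl⟩
      refine (ha.1 ⟨_, rfl⟩).resolve_left fun h => Fin.succAbove_ne i j (e.injective ?_)
      rw [h, hi]
    · intro h
      obtain ⟨j, rfl⟩ := ha.2 (Or.inr h)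
      obtain ⟨j', hj'⟩ := h
      have hji : j ≠ i := by
        rintro rfl
        exact hm j' (hj'.trans hi)
      obtain ⟨j₀, rfl⟩ := Fin.exists_succAbove_eq hji
      exact ⟨j₀, rfl⟩
  refine ⟨i, ?_⟩
  have : i.insertNth (α := fun _ => ℕ) m f = e := by
    rw [Fin.insertNth_eq_iff]
    exact ⟨hi.symm, hfe.symm⟩
  rw [this]
  exact e.strictMono

lemma Blossoms.mem_labels {t : DecoratedTree} {l : ℕ} {b : BlossomTree} (h : Blossoms t l b) :
    l ∈ t.labels := by
  induction h with
  | leaf a => exact rfl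
  | node d c i h ih => exact Set.mem_iUnion.2 ⟨i, ih⟩

lemma Blossoms.isTree_and_labels {t : DecoratedTree} {l : ℕ} {b : BlossomTree}
    (h : Blossoms t l b) (ht : t.IsTree) : b.IsTree ∧ b.labels = t.labels \ {l} := by
  induction h with
  | leaf a => exact ⟨trivial, by simp [BlossomTree.labels, DecoratedTree.labels]⟩
  | @node k d c i l b h ih =>
    obtain ⟨hk, hc, hd, hm⟩ := ht
    obtain ⟨hb, hl⟩ := ih (hc i)
    refine ⟨⟨by lia, hb, fun j => hc _, fun j => ?_, fun j j' hj => hd _ _ fun h => hj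
      (Fin.succAbove_right_injective h), hm.comp (Fin.strictMono_succAbove i)⟩, ?_⟩
    · rw [hl]
      exact (hd _ _ (Fin.succAbove_ne i j).symm).mono_left Set.sdiff_subset
    · ext a
      simp only [BlossomTree.labels, hl, DecoratedTree.labels, Set.mem_union, Set.mem_sdiff,
        Set.mem_iUnion, Set.mem_singleton_iff, Fin.exists_iff_succAbove i]
      have : ∀ j, a ∈ (c (i.succAbove j)).labels → a ≠ l := by
        rintro j ha rfl
        exact Set.disjoint_left.1 (hd _ _ (Fin.succAbove_ne i j)) ha h.mem_labels
      constructor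
      · rintro (h | ⟨j, hj⟩)
        · exact ⟨Or.inl h.1, h.2⟩
        · exact ⟨Or.inr ⟨j, hj⟩, this j hj⟩
      · rintro ⟨h | h, h'⟩
        · exact Or.inl ⟨h, h'⟩
        · exact Or.inr h

lemma Blossoms.rootIsJoin_iff {t : DecoratedTree} {l : ℕ} {b : BlossomTree} (h : Blossoms t l b) :
    b.RootIsJoin ↔ t.RootIsJoin := by
  cases h with
  | leaf => rfl
  | node d c i h => cases d <;> rfl

lemma Blossoms.rootIsUnion_iff {t : DecoratedTree} {l : ℕ} {b : BlossomTree}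
    (h : Blossoms t l b) : b.RootIsUnion ↔ t.RootIsUnion := by
  cases h with
  | leaf => rfl
  | node d c i h => cases d <;> rfl

lemma Decoration.blossom_graph_mem_iff {P : GraphSet} (hP : P.StableByRelabeling) {k : ℕ}
    (i : Fin (k + 1)) (G : SimpleGraph (Fin (k + 1))) :
    G.comap (finSuccEquiv' i).symm ∈ P.blossomed k ↔ G ∈ P (k + 1) := by
  rw [← hP.comap_mem_iff i, SimpleGraph.comap_comap]
  simp

lemma Blossoms.isDecorated_iff {P : GraphSet} (hprime : ∀ (n : ℕ), ∀ G ∈ P n, G.IsPrimeGraph)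
    (hP : P.StableByRelabeling) {t : DecoratedTree} {l : ℕ}
    {b : BlossomTree} (h : Blossoms t l b) : b.IsDecorated P ↔ t.IsDecorated P := by
  induction h with
  | leaf a => simp [BlossomTree.IsDecorated, DecoratedTree.IsDecorated, DecoratedTree.IsReduced,
      DecoratedTree.GraphsIn]
  | @node k d c i l b h ih =>
    have hj := h.rootIsJoin_iff
    have hu := h.rootIsUnion_iff
    cases d with
    | join =>
      simp only [Decoration.blossom, BlossomTree.IsDecorated, ih, hj, DecoratedTree.IsDecorated,
        DecoratedTree.IsReduced, DecoratedTree.GraphsIn, Fin.forall_iff_succAbove i, forall_and]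
      tauto
    | union =>
      simp only [Decoration.blossom, BlossomTree.IsDecorated, ih, hu, DecoratedTree.IsDecorated,
        DecoratedTree.IsReduced, DecoratedTree.GraphsIn, Fin.forall_iff_succAbove i, forall_and]
      tauto
    | graph G =>
      simp only [Decoration.blossom, BlossomTree.IsDecorated, ih, DecoratedTree.IsDecorated,
        DecoratedTree.IsReduced, DecoratedTree.GraphsIn, Fin.forall_iff_succAbove i, forall_and,
        Decoration.blossom_graph_mem_iff hP]
      -- Reduced trees require prime graphs, while decorated blossomed trees only record membership
      -- in `P`.
      have := hprime _ G
      tauto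

/-- Blossoming can be undone with any unused label: going up the path, the subtree carrying the new
leaf is put back at the place dictated by its minimal label, and the graph decoration is renumbered
accordingly. -/
lemma BlossomTree.IsTree.exists_blossoms {b : BlossomTree} (hb : b.IsTree) {l : ℕ}
    (hl : l ∉ b.labels) : ∃ t : DecoratedTree, Blossoms t l b ∧ t.IsTree ∧
      t.labels = insert l b.labels := by
  induction b with
  | blossom => exact ⟨.leaf l, .leaf l, trivial, by simp [DecoratedTree.labels, labels]⟩
  | node k d b c ih =>
    obtain ⟨hk, hb, hc, hbd, hd, hm⟩ := hb
    obtain ⟨t, hbt, ht, htl⟩ := ih hb fun h => hl (Or.inl h)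
    have hdt : ∀ i, Disjoint t.labels (c i).labels := by
      intro i
      rw [htl, Set.disjoint_insert_left]
      exact ⟨fun h => hl (Or.inr (Set.mem_iUnion.2 ⟨i, h⟩)), hbd i⟩
    obtain ⟨i, hi⟩ := Fin.exists_strictMono_insertNth hm (m := t.minLabel) fun i h =>
      Set.disjoint_left.1 (hdt i) ht.minLabel_mem (h ▸ (hc i).minLabel_mem)
    let c' : Fin (k + 1) → DecoratedTree := i.insertNth (α := fun _ => DecoratedTree) t c
    have h0 : c' i = t := by simp [c']
    have hs : ∀ j, c' (i.succAbove j) = c j := fun j => by simp [c']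
    let d' : Decoration (Fin (k + 1)) := match d with
      | .join => .join
      | .union => .union
      | .graph G => .graph (G.comap (finSuccEquiv' i))
    have hd' : d'.blossom i = d := by
      cases d with
      | join => rfl
      | union => rfl
      | graph G => simp [d', Decoration.blossom, SimpleGraph.comap_comap]
    refine ⟨.node (k + 1) d' c', ?_, ⟨by lia, ?_, ?_, ?_⟩, ?_⟩
    · have := Blossoms.node d' c' i (l := l) (b := b) (h0 ▸ hbt)
      simpa only [hd', hs] using this
    · rw [Fin.forall_iff_succAbove i]
      simpa [h0, hs] using ⟨ht, hc⟩
    · rw [Fin.forall_iff_succAbove i]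
      simp only [Fin.forall_iff_succAbove i, h0, hs, ne_eq, not_true_eq_false, false_implies,
        true_and]
      exact ⟨fun j _ => hdt j, fun j => ⟨fun _ => (hdt j).symm, fun j' hj => hd _ _ fun h =>
        hj (congrArg _ h)⟩⟩
    · convert hi using 1
      ext j
      rcases Fin.eq_self_or_eq_succAbove i j with rfl | ⟨j, rfl⟩
      · simp [h0]
      · simp [hs]
    · ext a
      simp only [DecoratedTree.labels, Set.mem_iUnion, Fin.exists_iff_succAbove i, h0, hs, htl,
        labels, Set.mem_insert_iff, Set.mem_union]
      tauto

lemma strictMonoOn_reduceLabel (l : ℕ) : StrictMonoOn (reduceLabel l) {l}ᶜ := by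
  intro a ha b hb hab
  simp only [Set.mem_compl_iff, Set.mem_singleton_iff] at ha hb
  unfold reduceLabel
  split_ifs <;> lia

/-- The same blossomed tree may come from several pairs of a tree and a leaf. This intrinsic
description forgets them, so that blossomed trees can be counted by decomposition at the root. -/
lemma mem_blossomedClass_iff {P : GraphSet} (hprime : ∀ (n : ℕ), ∀ G ∈ P n, G.IsPrimeGraph)
    (hP : P.StableByRelabeling) (b : BlossomTree) : b ∈ blossomedClass P ↔
      b.IsTree ∧ b.labels = Set.Icc 1 b.size ∧ b.IsDecorated P := by
  constructor
  · rintro ⟨t, ⟨⟨⟨ht, htl⟩, htr⟩, htg⟩, l, b, h, rfl⟩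
    obtain ⟨hb, hbl⟩ := h.isTree_and_labels ht
    have hf : StrictMonoOn (reduceLabel l) b.labels := (strictMonoOn_reduceLabel l).mono <| by
      rw [hbl]; exact fun a ha => ha.2
    have hl := h.mem_labels
    rw [htl, Set.mem_Icc] at hl
    have hlab : (b.relabel (reduceLabel l)).labels = Set.Icc 1 (t.size - 1) := by
      rw [BlossomTree.labels_relabel, hbl, htl]
      ext a
      simp only [Set.mem_image, Set.mem_sdiff, Set.mem_Icc, Set.mem_singleton_iff, reduceLabel]
      constructor
      · rintro ⟨j, hj, rfl⟩
        split_ifs <;> lia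
      · intro ha
        by_cases hal : a < l
        · exact ⟨a, by lia, by rw [if_neg (by lia)]⟩
        · exact ⟨a + 1, by lia, by rw [if_pos (by lia)]; lia⟩
    refine ⟨hb.relabel hf, ?_, ?_⟩
    · rw [← (hb.relabel hf).ncard_labels, hlab]
      congr 1
      rw [← Finset.coe_Icc, Set.ncard_coe_finset, Nat.card_Icc]
      lia
    · exact (BlossomTree.labelFree_isDecorated P _ _).2
        ((h.isDecorated_iff hprime hP).2 ⟨htr, htg⟩)
  · rintro ⟨hb, hl, hd⟩
    -- If the blossom receives the largest label, the final reduction of the labels is the identity.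
    obtain ⟨t, hbt, ht, htl⟩ := hb.exists_blossoms (l := b.size + 1) (by rw [hl]; simp)
    have hdt := (hbt.isDecorated_iff hprime hP).1 hd
    refine ⟨t, ⟨⟨⟨ht, ?_⟩, hdt.1⟩, hdt.2⟩, b.size + 1, b, hbt, ?_⟩
    · have hIcc : t.labels = Set.Icc 1 (b.size + 1) := by
        rw [htl, hl]
        ext a
        simp only [Set.mem_insert_iff, Set.mem_Icc]
        lia
      rw [← ht.ncard_labels, hIcc]
      congr 1
      rw [← Finset.coe_Icc, Set.ncard_coe_finset, Nat.card_Icc]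
      lia
    · refine (BlossomTree.relabel_eq_self fun a ha => ?_).symm
      rw [hl, Set.mem_Icc] at ha
      rw [reduceLabel, if_neg (by lia)]

/-! ### Counting blossomed trees -/

namespace BlossomTree

open DecoratedTree (forestsOn treesOn treeCount forestCount finite_forestsOn finite_treesOn)

/-- The blossomed trees with property `B` and label set `S`. -/
def blossomsOn (B : BlossomTree → Prop) (S : Finset ℕ) : Set BlossomTree :=
  {b | b.IsTree ∧ b.labels = S ∧ B b}

lemma node_isTree_labels_iff {k : ℕ} {d : Decoration (Option (Fin k))} {b : BlossomTree}
    {c : Fin k → DecoratedTree} {S : Finset ℕ} :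
    ((node k d b c).IsTree ∧ (node k d b c).labels = S) ↔ 1 ≤ k ∧
      ∃ S₀ ⊆ S, b ∈ blossomsOn (fun _ => True) S₀ ∧ c ∈ forestsOn (fun _ => True) k (S \ S₀) := by
  constructor
  · rintro ⟨⟨hk, hb, hc, hbd, hd, hm⟩, hl⟩
    have hbS : b.labels ⊆ S := by rw [← hl]; exact fun a ha => Or.inl ha
    refine ⟨hk, b.finite_labels.toFinset, by simpa using hbS, ⟨hb, by simp, trivial⟩,
      fun i => ⟨hc i, trivial⟩, hd, hm, ?_⟩
    rw [Finset.coe_sdiff, Set.Finite.coe_toFinset, ← hl, labels, Set.union_sdiff_left,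
      sdiff_eq_left.2]
    exact (Set.disjoint_iUnion_right.2 hbd).symm
  · rintro ⟨hk, S₀, hS₀, ⟨hb, hbl, -⟩, hc, hd, hm, hl⟩
    refine ⟨⟨hk, hb, fun i => (hc i).1, fun i => ?_, hd, hm⟩, ?_⟩
    · have : (c i).labels ⊆ (S \ S₀ : Finset ℕ) := by
        rw [← hl]; exact Set.subset_iUnion (fun i => (c i).labels) i
      rw [hbl]
      refine Disjoint.mono_right this ?_
      rw [Finset.disjoint_coe]
      exact Finset.disjoint_sdiff
    · rw [labels, hbl, hl, Finset.coe_sdiff, Set.union_sdiff_cancel (by simpa using hS₀)]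

/-- A node on the path has at least one subtree off the path, so the branch carrying the blossom has
fewer labels. The bound in the induction is strict because the bare blossom has no label at all. -/
lemma finite_blossomsOn (B : BlossomTree → Prop) (S : Finset ℕ) : (blossomsOn B S).Finite := by
  suffices h : ∀ n (S : Finset ℕ), S.card < n → (blossomsOn (fun _ => True) S).Finite from
    (h _ S (Nat.lt_succ_self _)).subset fun t ht => ⟨ht.1, ht.2.1, trivial⟩
  intro n
  induction n with
  | zero => exact fun S hS => absurd hS (by lia)
  | succ n ih =>
    intro S hS
    let A : Set BlossomTree := ⋃ S' ∈ {S' ∈ S.powerset | S'.card < n}, blossomsOn (fun _ => True) S'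
    have hA : A.Finite := Set.Finite.biUnion (Finset.finite_toSet _) fun S' hS' =>
      ih S' (Finset.mem_filter.1 hS').2
    let C : ∀ k, Set (Fin k → DecoratedTree) := fun k =>
      ⋃ S' ∈ S.powerset, forestsOn (fun _ => True) k S'
    have hC : ∀ k, (C k).Finite := fun k => Set.Finite.biUnion (Finset.finite_toSet _)
      fun S' _ => finite_forestsOn _ k S'
    have hfin : ({blossom} ∪ ⋃ k ∈ Finset.range (S.card + 1), ⋃ d : Decoration (Option (Fin k)),
        (fun p : BlossomTree × (Fin k → DecoratedTree) => node k d p.1 p.2) ''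
          (A ×ˢ C k)).Finite :=
      (Set.finite_singleton _).union (Set.Finite.biUnion (Finset.finite_toSet _)
        fun k _ => Set.finite_iUnion fun d => Set.Finite.image _ (hA.prod (hC k)))
    refine hfin.subset ?_
    rintro (_ | ⟨k, d, b, c⟩) ⟨ht, hl, -⟩
    · exact Or.inl rfl
    · obtain ⟨hk, S₀, hS₀, hb, hc⟩ := node_isTree_labels_iff.1 ⟨ht, hl⟩
      have hkS := DecoratedTree.card_le_of_mem_forestsOn hc
      rw [Finset.card_sdiff_of_subset hS₀] at hkS
      right
      simp only [Set.mem_iUnion]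
      refine ⟨k, by simp; lia, d, ⟨b, c⟩, ⟨?_, ?_⟩, rfl⟩
      · simp only [A, Set.mem_iUnion]
        exact ⟨S₀, by simp [hS₀]; lia, hb⟩
      · simp only [C, Set.mem_iUnion]
        exact ⟨S \ S₀, by simp, hc⟩

/-- The number of blossomed trees with property `B` and labels `0, …, n - 1`. -/
noncomputable def blossomCount (B : BlossomTree → Prop) (n : ℕ) : ℕ :=
  (blossomsOn B (Finset.range n)).ncard

lemma ncard_blossomsOn_le {B : BlossomTree → Prop} (hB : LabelFree B) {S S' : Finset ℕ}
    (h : S.card = S'.card) : (blossomsOn B S).ncard ≤ (blossomsOn B S').ncard := by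
  obtain ⟨f, hf, hfS⟩ := exists_strictMonoOn_image_eq h
  refine Set.ncard_le_ncard_of_injOn (relabel f) ?_ ?_ (finite_blossomsOn B S')
  · rintro t ⟨ht, hl, hq⟩
    refine ⟨ht.relabel (hl ▸ hf), ?_, (hB f t).2 hq⟩
    rw [labels_relabel, hl, ← hfS, Finset.coe_image]
  · intro t ht t' ht' htt
    have key : ∀ t ∈ blossomsOn B S, (t.relabel f).relabel (Function.invFunOn f S) = t := by
      rintro t ⟨-, hl, -⟩
      rw [relabel_relabel]
      refine relabel_eq_self fun a ha => ?_
      exact hf.injOn.leftInvOn_invFunOn (hl ▸ ha)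
    rw [← key t ht, htt, key t' ht']

lemma ncard_blossomsOn {B : BlossomTree → Prop} (hB : LabelFree B) (S : Finset ℕ) :
    (blossomsOn B S).ncard = blossomCount B S.card :=
  le_antisymm (ncard_blossomsOn_le hB (by simp)) (ncard_blossomsOn_le hB (by simp))

/-- The root is an internal node with decoration in `D`, whose subtree containing the blossom has
property `B` and whose other subtrees have property `Q`. -/
def RootIn (D : ∀ k, Set (Decoration (Option (Fin k)))) (B : BlossomTree → Prop)
    (Q : DecoratedTree → Prop) : BlossomTree → Prop
  | blossom => False
  | node k d b c => d ∈ D k ∧ B b ∧ ∀ i, Q (c i)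

/-- The branch with the blossom is distinguished from its siblings, so its label set is an arbitrary
subset and a binomial convolution appears: the branch times the forest of the `k ≥ 1` other
subtrees. -/
lemma blossomCount_rootIn (D : ∀ k, Set (Decoration (Option (Fin k)))) {B : BlossomTree → Prop}
    {Q : DecoratedTree → Prop} (hB : LabelFree B) (hQ : DecoratedTree.LabelFree Q) (n : ℕ) :
    blossomCount (RootIn D B Q) n = ∑ j ∈ Finset.range (n + 1), n.choose j * (blossomCount B j *
      ∑ k ∈ Finset.range (n - j + 1),
        (if 1 ≤ k then (D k).ncard else 0) * forestCount Q k (n - j)) := by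
  have hsum := Finset.sum_powerset_apply_card (fun j => blossomCount B j *
      ∑ k ∈ Finset.range (n - j + 1),
        (if 1 ≤ k then (D k).ncard else 0) * forestCount Q k (n - j)) (x := Finset.range n)
  simp only [smul_eq_mul, Finset.card_range] at hsum
  rw [← hsum, blossomCount, Set.ncard_eq_sum_of_mem_iff
    ((Finset.range n).powerset.sigma fun S₀ => {k ∈ Finset.range (n - S₀.card + 1) | 1 ≤ k})
    (fun p => (fun q : Decoration (Option (Fin p.2)) × BlossomTree × (Fin p.2 → DecoratedTree) =>
        node p.2 q.1 q.2.1 q.2.2) ''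
      (D p.2 ×ˢ blossomsOn B p.1 ×ˢ forestsOn Q p.2 (Finset.range n \ p.1))), Finset.sum_sigma]
  · refine Finset.sum_congr rfl fun S₀ hS₀ => ?_
    rw [Finset.sum_filter, Finset.mul_sum]
    refine Finset.sum_congr rfl fun k _ => ?_
    split_ifs
    · rw [Set.ncard_image_of_injective, Set.ncard_prod, Set.ncard_prod, ncard_blossomsOn hB,
        DecoratedTree.ncard_forestsOn hQ, Finset.card_sdiff_of_subset (Finset.mem_powerset.1 hS₀),
        Finset.card_range]
      · ring
      · rintro ⟨d, b, c⟩ ⟨d', b', c'⟩ h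
        simpa using h
    · simp
  · exact fun p _ => ((Set.toFinite _).prod
      ((finite_blossomsOn _ _).prod (finite_forestsOn _ _ _))).image _
  · rintro ⟨S₀, k⟩ - ⟨S₁, k'⟩ - _ ⟨⟨d, b, c⟩, ⟨-, hb, -⟩, rfl⟩ ⟨⟨d', b', c'⟩, ⟨-, hb', -⟩, h⟩
    simp only [node.injEq] at h
    obtain ⟨rfl, -, rfl, -⟩ := h
    have := hb.2.1.symm.trans hb'.2.1
    rw [Finset.coe_inj] at this
    dsimp only at this
    rw [this]
  · rintro (_ | ⟨k, d, b, c⟩)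
    · simp [blossomsOn, RootIn]
    · constructor
      · rintro ⟨ht, hl, hD, hB, hQ⟩
        obtain ⟨hk, S₀, hS₀, hb, hc⟩ := node_isTree_labels_iff.1 ⟨ht, hl⟩
        have := DecoratedTree.card_le_of_mem_forestsOn hc
        rw [Finset.card_sdiff_of_subset hS₀, Finset.card_range] at this
        exact ⟨⟨S₀, k⟩, by simp [hS₀, hk]; lia, ⟨d, b, c⟩,
          ⟨hD, ⟨hb.1, hb.2.1, hB⟩, fun i => ⟨(hc.1 i).1, hQ i⟩, hc.2⟩, rfl⟩
      · rintro ⟨⟨S₀, k'⟩, hk', ⟨d', b', c'⟩, ⟨hd', hb', hc'⟩, h⟩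
        simp only [node.injEq] at h
        obtain ⟨rfl, h1, rfl, h2⟩ := h
        obtain rfl := eq_of_heq h1
        obtain rfl := eq_of_heq h2
        simp only [Finset.mem_sigma, Finset.mem_powerset, Finset.mem_filter] at hk'
        obtain ⟨h3, h4⟩ := node_isTree_labels_iff.2 ⟨hk'.2.2, S₀, hk'.1,
          ⟨hb'.1, hb'.2.1, trivial⟩, fun i => ⟨(hc'.1 i).1, trivial⟩, hc'.2⟩
        exact ⟨h3, h4, hd', hb'.2.2, fun i => (hc'.1 i).2⟩

lemma blossomCount_or {B B' : BlossomTree → Prop} (h : ∀ t, B t → ¬ B' t) (n : ℕ) :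
    blossomCount (fun t => B t ∨ B' t) n = blossomCount B n + blossomCount B' n := by
  rw [blossomCount, blossomCount, blossomCount, ← Set.ncard_union_eq _ (finite_blossomsOn _ _)
    (finite_blossomsOn _ _)]
  · congr 1
    ext t
    simp only [blossomsOn, Set.mem_ofPred_eq, Set.mem_union]
    tauto
  · exact Set.disjoint_left.2 fun t ht ht' => h t ht.2.2 ht'.2.2

lemma blossomCount_congr {B B' : BlossomTree → Prop} (h : ∀ t, B t ↔ B' t) :
    blossomCount B = blossomCount B' := by
  rw [show B = B' from funext fun t => propext (h t)]

lemma blossomCount_eq_blossom (n : ℕ) :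
    blossomCount (fun b => b = blossom) n = if n = 0 then 1 else 0 := by
  have h : ∀ t, t ∈ blossomsOn (fun b => b = blossom) (Finset.range n) ↔ t = blossom ∧ n = 0 := by
    intro t
    constructor
    · rintro ⟨-, hl, rfl⟩
      refine ⟨rfl, ?_⟩
      rw [labels, eq_comm, Finset.coe_eq_empty, Finset.range_eq_empty_iff] at hl
      exact hl
    · rintro ⟨rfl, rfl⟩
      exact ⟨trivial, by simp [labels], rfl⟩
  rw [blossomCount]
  split_ifs with hn
  · rw [Set.ncard_eq_one]
    exact ⟨blossom, by ext t; rw [h]; simp [hn]⟩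
  · rw [Set.eq_empty_of_forall_notMem (fun t ht => hn ((h t).1 ht).2), Set.ncard_empty]

end BlossomTree

/-! ### The root decompositions -/

section Classes

open DecoratedTree BlossomTree

variable (P : GraphSet)

lemma ncard_treesOn_Icc {Q : DecoratedTree → Prop} (hQ : DecoratedTree.LabelFree Q)
    {X : Set DecoratedTree} (hX : ∀ t, t ∈ X ↔ t.IsSubstitutionTree ∧ Q t) (n : ℕ) :
    {t | t ∈ X ∧ t.size = n}.ncard = treeCount Q n := by
  have : {t | t ∈ X ∧ t.size = n} = treesOn Q (Finset.Icc 1 n) := by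
    ext t
    simp only [Set.mem_ofPred_eq, hX, treesOn, IsSubstitutionTree, Finset.coe_Icc]
    constructor
    · rintro ⟨⟨⟨ht, hl⟩, hQ⟩, rfl⟩
      exact ⟨ht, hl, hQ⟩
    · rintro ⟨ht, hl, hQ⟩
      have hs : t.size = n := by
        rw [← ht.ncard_labels, hl, ← Finset.coe_Icc, Set.ncard_coe_finset]; simp
      exact ⟨⟨⟨ht, by rw [hl, hs]⟩, hQ⟩, hs⟩
  rw [this, ncard_treesOn hQ]
  simp

lemma ncard_treeClass (n : ℕ) : {t | t ∈ treeClass P ∧ t.size = n}.ncard =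
    treeCount (DecoratedTree.IsDecorated P) n :=
  ncard_treesOn_Icc (labelFree_isDecorated P) (fun t => by
    simp [treeClass, IsModularDecompositionTree, DecoratedTree.IsDecorated, and_assoc]) n

/-- Decorated trees whose root is not a `⊕`-node. -/
def DecoratedTree.NotJoin (t : DecoratedTree) : Prop := t.IsDecorated P ∧ ¬ t.RootIsJoin

/-- Decorated trees whose root is not a `⊖`-node. -/
def DecoratedTree.NotUnion (t : DecoratedTree) : Prop := t.IsDecorated P ∧ ¬ t.RootIsUnion

lemma DecoratedTree.labelFree_notJoin : DecoratedTree.LabelFree (NotJoin P) :=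
  (labelFree_isDecorated P).and DecoratedTree.labelFree_rootIsJoin.not

lemma DecoratedTree.labelFree_notUnion : DecoratedTree.LabelFree (NotUnion P) :=
  (labelFree_isDecorated P).and DecoratedTree.labelFree_rootIsUnion.not

lemma ncard_treeClassNotJoin (n : ℕ) : {t | t ∈ treeClassNotJoin P ∧ t.size = n}.ncard =
    treeCount (NotJoin P) n :=
  ncard_treesOn_Icc (labelFree_notJoin P) (fun t => by
    simp [treeClassNotJoin, treeClass, IsModularDecompositionTree, NotJoin,
      DecoratedTree.IsDecorated, and_assoc]) n

/-- Trees with a `⊕`-root. -/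
def DecoratedTree.JoinRoot : DecoratedTree → Prop :=
  DecoratedTree.RootIn (fun _ => {.join}) (NotJoin P)

/-- Trees with a `⊖`-root. -/
def DecoratedTree.UnionRoot : DecoratedTree → Prop :=
  DecoratedTree.RootIn (fun _ => {.union}) (NotUnion P)

/-- Trees whose root is decorated with a graph. -/
def DecoratedTree.GraphRoot : DecoratedTree → Prop :=
  DecoratedTree.RootIn (fun k => .graph '' P k) (DecoratedTree.IsDecorated P)

variable {P}

lemma DecoratedTree.notJoin_iff (hprime : ∀ (n : ℕ), ∀ G ∈ P n, G.IsPrimeGraph)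
    (t : DecoratedTree) : t.NotJoin P ↔ t.IsLeaf ∨ t.UnionRoot P ∨ t.GraphRoot P := by
  rcases t with a | ⟨k, _ | _ | G, c⟩ <;>
  simp only [NotJoin, DecoratedTree.IsDecorated, IsReduced, GraphsIn, DecoratedTree.RootIsJoin,
    IsLeaf, UnionRoot, GraphRoot, DecoratedTree.RootIn, Set.mem_singleton_iff, Set.mem_image,
    NotUnion, DecoratedTree.RootIsUnion, forall_and, reduceCtorEq, Decoration.graph.injEq,
    exists_eq_right, and_false, exists_false]
  · tauto
  · tauto
  · tauto
  · have := hprime _ G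
    tauto

lemma DecoratedTree.notUnion_iff (hprime : ∀ (n : ℕ), ∀ G ∈ P n, G.IsPrimeGraph)
    (t : DecoratedTree) : t.NotUnion P ↔ t.IsLeaf ∨ t.JoinRoot P ∨ t.GraphRoot P := by
  rcases t with a | ⟨k, _ | _ | G, c⟩ <;>
  simp only [NotJoin, DecoratedTree.IsDecorated, IsReduced, GraphsIn, DecoratedTree.RootIsJoin,
    IsLeaf, JoinRoot, GraphRoot, DecoratedTree.RootIn, Set.mem_singleton_iff, Set.mem_image,
    NotUnion, DecoratedTree.RootIsUnion, forall_and, reduceCtorEq, Decoration.graph.injEq,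
    exists_eq_right, and_false, exists_false]
  · tauto
  · tauto
  · tauto
  · have := hprime _ G
    tauto

lemma DecoratedTree.isDecorated_iff (t : DecoratedTree) :
    t.IsDecorated P ↔ t.NotJoin P ∨ t.JoinRoot P := by
  rcases t with a | ⟨k, _ | _ | G, c⟩ <;>
  simp only [NotJoin, DecoratedTree.IsDecorated, IsReduced, GraphsIn, DecoratedTree.RootIsJoin,
    JoinRoot, DecoratedTree.RootIn, Set.mem_singleton_iff, forall_and, reduceCtorEq] <;>
  tauto

lemma DecoratedTree.not_rootIn_of_disjoint {D D' : ∀ k, Set (Decoration (Fin k))}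
    {Q Q' : DecoratedTree → Prop} (h : ∀ k, ∀ d ∈ D k, d ∉ D' k) (t : DecoratedTree)
    (ht : DecoratedTree.RootIn D Q t) : ¬ DecoratedTree.RootIn D' Q' t := by
  rcases t with a | ⟨k, d, c⟩
  · exact fun h => h
  · exact fun h' => h k d ht.1 h'.1

lemma treeCount_notJoin (hprime : ∀ (n : ℕ), ∀ G ∈ P n, G.IsPrimeGraph) (n : ℕ) :
    treeCount (NotJoin P) n =
      (if n = 1 then 1 else 0) + (treeCount (UnionRoot P) n + treeCount (GraphRoot P) n) := by
  rw [treeCount_congr (notJoin_iff hprime), treeCount_or, treeCount_or, treeCount_isLeaf]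
  · exact DecoratedTree.not_rootIn_of_disjoint fun k d hd => by simp_all
  · rintro (a | ⟨k, d, c⟩)
    · exact fun _ h => h.elim id id
    · exact fun h => h.elim

lemma treeCount_notUnion (hprime : ∀ (n : ℕ), ∀ G ∈ P n, G.IsPrimeGraph) (n : ℕ) :
    treeCount (NotUnion P) n =
      (if n = 1 then 1 else 0) + (treeCount (JoinRoot P) n + treeCount (GraphRoot P) n) := by
  rw [treeCount_congr (notUnion_iff hprime), treeCount_or, treeCount_or, treeCount_isLeaf]
  · exact DecoratedTree.not_rootIn_of_disjoint fun k d hd => by simp_all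
  · rintro (a | ⟨k, d, c⟩)
    · exact fun _ h => h.elim id id
    · exact fun h => h.elim

lemma treeCount_isDecorated (n : ℕ) : treeCount (DecoratedTree.IsDecorated P) n =
    treeCount (NotJoin P) n + treeCount (JoinRoot P) n := by
  rw [treeCount_congr isDecorated_iff, treeCount_or]
  rintro (a | ⟨k, d, c⟩)
  · exact fun _ h => h
  · rintro ⟨-, h⟩ ⟨h', -⟩
    rw [Set.mem_singleton_iff] at h'
    subst h'
    exact h trivial

variable (P)

/-- Blossomed trees with a `⊕`-replaceable blossom. -/
def BlossomTree.Replaceable (b : BlossomTree) : Prop := b.IsDecorated P ∧ b.JoinReplaceable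

lemma BlossomTree.labelFree_replaceable : BlossomTree.LabelFree (Replaceable P) :=
  fun f b => and_congr (labelFree_isDecorated P f b) (labelFree_joinReplaceable f b)

/-- Blossomed trees with a `⊕`-replaceable blossom, that may hang from a `⊕`-node. -/
def BlossomTree.BelowJoin (b : BlossomTree) : Prop :=
  b.Replaceable P ∧ ¬ b.RootIsJoin ∧ b ≠ blossom

/-- Blossomed trees with a `⊕`-replaceable blossom, that may hang from a `⊖`-node. -/
def BlossomTree.BelowUnion (b : BlossomTree) : Prop := b.Replaceable P ∧ ¬ b.RootIsUnion

lemma BlossomTree.labelFree_belowJoin : BlossomTree.LabelFree (BelowJoin P) := fun f b => by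
  refine and_congr (labelFree_replaceable P f b) (and_congr (not_congr
    (labelFree_rootIsJoin f b)) (not_congr ?_))
  cases b <;> simp [BlossomTree.relabel]

lemma BlossomTree.labelFree_belowUnion : BlossomTree.LabelFree (BelowUnion P) := fun f b =>
  and_congr (labelFree_replaceable P f b) (not_congr (labelFree_rootIsUnion f b))

/-- Blossomed trees with a `⊕`-root. -/
def BlossomTree.JoinRoot : BlossomTree → Prop :=
  BlossomTree.RootIn (fun _ => {.join}) (BelowJoin P) (NotJoin P)

/-- Blossomed trees with a `⊖`-root. -/
def BlossomTree.UnionRoot : BlossomTree → Prop :=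
  BlossomTree.RootIn (fun _ => {.union}) (BelowUnion P) (NotUnion P)

/-- Blossomed trees whose root is decorated with a graph. -/
def BlossomTree.GraphRoot : BlossomTree → Prop :=
  BlossomTree.RootIn (fun k => .graph '' P.blossomed k) (Replaceable P)
    (DecoratedTree.IsDecorated P)

variable {P}

/-- The bare blossom is absent, since just below a `⊕`-node it would not be replaceable. It is
present in `belowUnion_iff`, where it provides the constant term of the linear system. -/
lemma BlossomTree.belowJoin_iff (b : BlossomTree) :
    b.BelowJoin P ↔ b.UnionRoot P ∨ b.GraphRoot P := by
  rcases b with _ | ⟨k, _ | _ | G, b, c⟩ <;>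
  simp only [BelowJoin, Replaceable, joinReplaceable_node, BlossomTree.IsDecorated,
    BlossomTree.RootIsJoin, BlossomTree.UnionRoot, BlossomTree.GraphRoot, BlossomTree.RootIn,
    Set.mem_singleton_iff, Set.mem_image, BelowUnion, NotUnion, BlossomTree.RootIsUnion,
    reduceCtorEq, Decoration.graph.injEq, exists_eq_right, and_false, exists_false, ne_eq,
    not_true_eq_false, not_false_eq_true] <;>
  tauto

lemma BlossomTree.belowUnion_iff (b : BlossomTree) :
    b.BelowUnion P ↔ b = blossom ∨ b.JoinRoot P ∨ b.GraphRoot P := by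
  rcases b with _ | ⟨k, _ | _ | G, b, c⟩ <;>
  simp only [BelowJoin, Replaceable, joinReplaceable_node, BlossomTree.IsDecorated,
    BlossomTree.RootIsJoin, BlossomTree.JoinRoot, BlossomTree.GraphRoot, BlossomTree.RootIn,
    Set.mem_singleton_iff, Set.mem_image, BelowUnion, NotJoin, BlossomTree.RootIsUnion,
    reduceCtorEq, Decoration.graph.injEq, exists_eq_right, and_false, exists_false, ne_eq,
    not_true_eq_false, not_false_eq_true, JoinReplaceable] <;>
  tauto

lemma BlossomTree.replaceable_iff (b : BlossomTree) :
    b.Replaceable P ↔ b.BelowUnion P ∨ b.UnionRoot P := by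
  rcases b with _ | ⟨k, _ | _ | G, b, c⟩ <;>
  simp only [Replaceable, joinReplaceable_node, BlossomTree.IsDecorated,
    BlossomTree.UnionRoot, BlossomTree.RootIn,
    Set.mem_singleton_iff, BelowUnion, NotUnion, BlossomTree.RootIsUnion,
    reduceCtorEq, JoinReplaceable] <;>
  tauto

lemma BlossomTree.not_rootIn_of_disjoint {D D' : ∀ k, Set (Decoration (Option (Fin k)))}
    {B B' : BlossomTree → Prop} {Q Q' : DecoratedTree → Prop} (h : ∀ k, ∀ d ∈ D k, d ∉ D' k)
    (t : BlossomTree) (ht : BlossomTree.RootIn D B Q t) : ¬ BlossomTree.RootIn D' B' Q' t := by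
  rcases t with _ | ⟨k, d, b, c⟩
  · exact fun h => h
  · exact fun h' => h k d ht.1 h'.1

lemma blossomCount_belowJoin (n : ℕ) : blossomCount (BelowJoin P) n =
    blossomCount (BlossomTree.UnionRoot P) n + blossomCount (BlossomTree.GraphRoot P) n := by
  rw [blossomCount_congr belowJoin_iff, blossomCount_or]
  exact BlossomTree.not_rootIn_of_disjoint fun k d hd => by simp_all

lemma blossomCount_belowUnion (n : ℕ) : blossomCount (BelowUnion P) n = (if n = 0 then 1 else 0) +
    (blossomCount (BlossomTree.JoinRoot P) n + blossomCount (BlossomTree.GraphRoot P) n) := by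
  rw [blossomCount_congr belowUnion_iff, blossomCount_or, blossomCount_or,
    blossomCount_eq_blossom]
  · exact BlossomTree.not_rootIn_of_disjoint fun k d hd => by simp_all
  · rintro _ rfl h
    exact h.elim id id

lemma blossomCount_replaceable (n : ℕ) : blossomCount (Replaceable P) n =
    blossomCount (BelowUnion P) n + blossomCount (BlossomTree.UnionRoot P) n := by
  rw [blossomCount_congr replaceable_iff, blossomCount_or]
  rintro (_ | ⟨k, d, b, c⟩)
  · exact fun _ h => h
  · rintro ⟨-, h⟩ ⟨h', -⟩
    rw [Set.mem_singleton_iff] at h'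
    subst h'
    exact h trivial

lemma ncard_blossomedClassJoin (hprime : ∀ (n : ℕ), ∀ G ∈ P n, G.IsPrimeGraph)
    (hP : P.StableByRelabeling) (n : ℕ) :
    {b | b ∈ blossomedClassJoin P ∧ b.size = n}.ncard = blossomCount (Replaceable P) n := by
  have : {b | b ∈ blossomedClassJoin P ∧ b.size = n} =
      blossomsOn (Replaceable P) (Finset.Icc 1 n) := by
    ext b
    simp only [Set.mem_ofPred_eq, blossomedClassJoin, mem_blossomedClass_iff hprime hP,
      blossomsOn, Finset.coe_Icc, Replaceable]
    constructor
    · rintro ⟨⟨⟨ht, hl, hd⟩, hj⟩, rfl⟩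
      exact ⟨ht, hl, hd, hj⟩
    · rintro ⟨ht, hl, hd, hj⟩
      have hs : b.size = n := by
        rw [← ht.ncard_labels, hl, ← Finset.coe_Icc, Set.ncard_coe_finset]; simp
      exact ⟨⟨⟨ht, by rw [hl, hs], hd⟩, hj⟩, hs⟩
  rw [this, ncard_blossomsOn (labelFree_replaceable P)]
  simp

end Classes

/-! ### Exponential generating series as formal power series -/

section Formal

open PowerSeries

/-- The formal exponential generating series with counting sequence `a`. -/
noncomputable def egfSeries (a : ℕ → ℕ) : ℂ⟦X⟧ := .mk fun n => (a n : ℂ) / (n ! : ℂ)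

lemma coeff_egfSeries (a : ℕ → ℕ) (n : ℕ) : coeff n (egfSeries a) = (a n : ℂ) / (n ! : ℂ) :=
  coeff_mk _ _

lemma egfSeries_add (a b : ℕ → ℕ) :
    egfSeries (fun n => a n + b n) = egfSeries a + egfSeries b := by
  ext n
  simp [coeff_egfSeries, add_div]

lemma egfSeries_mul (a b : ℕ → ℕ) :
    egfSeries (fun n => ∑ j ∈ Finset.range (n + 1), n.choose j * (a j * b (n - j))) =
      egfSeries a * egfSeries b := by
  ext n
  rw [coeff_mul, Finset.Nat.sum_antidiagonal_eq_sum_range_succ_mk, coeff_egfSeries, Nat.cast_sum,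
    Finset.sum_div]
  refine Finset.sum_congr rfl fun j hj => ?_
  have hj' : j ≤ n := by simpa [Nat.lt_succ_iff] using hj
  rw [coeff_egfSeries, coeff_egfSeries, Nat.cast_mul, Nat.cast_mul, Nat.cast_choose ℂ hj']
  have h1 : (n ! : ℂ) ≠ 0 := mod_cast n.factorial_ne_zero
  have h2 : (j ! : ℂ) ≠ 0 := mod_cast j.factorial_ne_zero
  have h3 : ((n - j)! : ℂ) ≠ 0 := mod_cast (n - j).factorial_ne_zero
  field_simp

lemma derivative_egfSeries (a : ℕ → ℕ) :
    derivative ℂ (egfSeries a) = egfSeries fun n => a (n + 1) := by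
  ext n
  rw [coeff_derivative, coeff_egfSeries, coeff_egfSeries, Nat.factorial_succ]
  have h1 : (n ! : ℂ) ≠ 0 := mod_cast n.factorial_ne_zero
  have h2 : (n + 1 : ℂ) ≠ 0 := mod_cast n.succ_ne_zero
  push_cast
  field_simp

/-- Since `g` has no constant term, `g ^ k` has order at least `k` and only the indices `k ≤ n`
contribute. -/
lemma coeff_subst_eq_sum {g : ℂ⟦X⟧} (hg : constantCoeff g = 0) (f : ℂ⟦X⟧) (n : ℕ) :
    coeff n (f.subst g) = ∑ k ∈ Finset.range (n + 1), coeff k f * coeff n (g ^ k) := by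
  rw [coeff_subst' (HasSubst.of_constantCoeff_zero' hg), finsum_eq_sum_of_support_subset (s := Finset.range (n + 1))]
  · simp only [smul_eq_mul]
  · intro k hk
    rw [Finset.coe_range, Set.mem_Iio]
    by_contra hkn
    refine hk ?_
    have hlt : (n : ℕ∞) < (g ^ k).order := by
      refine lt_of_lt_of_le ?_ (le_order_pow_of_constantCoeff_eq_zero k hg)
      exact_mod_cast (by lia : n < k)
    show coeff k f • coeff n (g ^ k) = 0
    rw [show coeff n (g ^ k) = 0 from coeff_of_lt_order n hlt, smul_zero]

open DecoratedTree BlossomTree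

lemma constantCoeff_egfSeries_treeCount (Q : DecoratedTree → Prop) :
    constantCoeff (egfSeries (treeCount Q)) = 0 := by
  rw [← coeff_zero_eq_constantCoeff_apply, coeff_egfSeries, treeCount_zero]
  simp

/-- Induction on `k` by comparing derivatives, which single out the smallest label:
`forestCount_succ_succ` says that the derivative of the series of forests of `k + 1` trees is the
derivative of the tree series times the series of forests of `k` trees. -/
lemma egfSeries_forestCount {Q : DecoratedTree → Prop} (hQ : DecoratedTree.LabelFree Q) (k : ℕ) :
    (k ! : ℂ) • egfSeries (forestCount Q k) = egfSeries (treeCount Q) ^ k := by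
  induction k with
  | zero =>
    ext n
    rw [PowerSeries.coeff_smul, coeff_egfSeries, forestCount_zero, pow_zero, coeff_one]
    split_ifs with h <;> simp [h]
  | succ k ih =>
    apply derivative.ext
    · rw [derivative_pow, Derivation.map_smul, derivative_egfSeries, derivative_egfSeries]
      have : egfSeries (fun n => forestCount Q (k + 1) (n + 1)) =
          egfSeries (fun n => treeCount Q (n + 1)) * egfSeries (forestCount Q k) := by
        rw [← egfSeries_mul]
        exact congrArg _ (funext fun n => forestCount_succ_succ hQ k n)
      rw [this, Nat.factorial_succ, Nat.cast_mul, mul_smul, ← mul_smul_comm, ih,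
        Nat.add_sub_cancel, Algebra.smul_def, map_natCast]
      ring
    · rw [map_pow, constantCoeff_egfSeries_treeCount, zero_pow k.succ_ne_zero,
        ← coeff_zero_eq_constantCoeff_apply, PowerSeries.coeff_smul, coeff_egfSeries,
        forestCount_succ_zero]
      simp

lemma egfSeries_sum_forestCount {Q : DecoratedTree → Prop} (hQ : DecoratedTree.LabelFree Q)
    (w : ℕ → ℕ) :
    egfSeries (fun n => ∑ k ∈ Finset.range (n + 1), w k * forestCount Q k n) =
      (egfSeries w).subst (egfSeries (treeCount Q)) := by
  ext n
  rw [coeff_subst_eq_sum (constantCoeff_egfSeries_treeCount Q), coeff_egfSeries, Nat.cast_sum,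
    Finset.sum_div]
  refine Finset.sum_congr rfl fun k _ => ?_
  rw [← egfSeries_forestCount hQ, PowerSeries.coeff_smul, coeff_egfSeries, coeff_egfSeries]
  have h1 : (k ! : ℂ) ≠ 0 := mod_cast k.factorial_ne_zero
  rw [Nat.cast_mul, smul_eq_mul]
  field_simp

lemma egfSeries_treeCount_rootIn (D : ∀ k, Set (Decoration (Fin k))) {Q : DecoratedTree → Prop}
    (hQ : DecoratedTree.LabelFree Q) {w : ℕ → ℕ}
    (hw : ∀ k, (if 2 ≤ k then (D k).ncard else 0) = w k) :
    egfSeries (treeCount (DecoratedTree.RootIn D Q)) =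
      (egfSeries w).subst (egfSeries (treeCount Q)) := by
  rw [← egfSeries_sum_forestCount hQ]
  refine congrArg _ (funext fun n => ?_)
  rw [treeCount_rootIn]
  exact Finset.sum_congr rfl fun k _ => by rw [hw]

lemma egfSeries_blossomCount_rootIn (D : ∀ k, Set (Decoration (Option (Fin k))))
    {B : BlossomTree → Prop} {Q : DecoratedTree → Prop} (hB : BlossomTree.LabelFree B)
    (hQ : DecoratedTree.LabelFree Q) {w : ℕ → ℕ}
    (hw : ∀ k, (if 1 ≤ k then (D k).ncard else 0) = w k) :
    egfSeries (blossomCount (BlossomTree.RootIn D B Q)) =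
      egfSeries (blossomCount B) * (egfSeries w).subst (egfSeries (treeCount Q)) := by
  rw [← egfSeries_sum_forestCount hQ, ← egfSeries_mul]
  refine congrArg _ (funext fun n => ?_)
  rw [blossomCount_rootIn D hB hQ]
  simp only [hw]

lemma egfSeries_one_le : egfSeries (fun k => if 1 ≤ k then 1 else 0) = exp ℂ - 1 := by
  ext n
  rcases n with _ | n <;> simp [coeff_egfSeries, coeff_exp, coeff_one]

lemma egfSeries_two_le : egfSeries (fun k => if 2 ≤ k then 1 else 0) = exp ℂ - 1 - X := by
  ext n
  rcases n with _ | _ | n <;> simp [coeff_egfSeries, coeff_exp, coeff_one, coeff_X]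

lemma subst_exp_sub_one {g : ℂ⟦X⟧} (hg : constantCoeff g = 0) :
    (exp ℂ - 1).subst g = (exp ℂ).subst g - 1 := by
  have h := HasSubst.of_constantCoeff_zero' hg
  rw [← coe_substAlgHom h, map_sub, map_one]

lemma subst_exp_sub_one_sub_X {g : ℂ⟦X⟧} (hg : constantCoeff g = 0) :
    (exp ℂ - 1 - X).subst g = (exp ℂ).subst g - 1 - g := by
  have h := HasSubst.of_constantCoeff_zero' hg
  rw [← coe_substAlgHom h, map_sub, map_sub, map_one, coe_substAlgHom h, subst_X h]

lemma derivative_subst_exp {g : ℂ⟦X⟧} (hg : constantCoeff g = 0) :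
    derivative ℂ ((exp ℂ).subst g) = (exp ℂ).subst g * derivative ℂ g := by
  rw [derivative_subst (HasSubst.of_constantCoeff_zero' hg), derivative_exp]

lemma constantCoeff_subst_exp {g : ℂ⟦X⟧} (hg : constantCoeff g = 0) :
    constantCoeff ((exp ℂ).subst g) = 1 := by
  rw [← coeff_zero_eq_constantCoeff_apply, coeff_subst_eq_sum hg]
  simp

/-- Differentiating the equality of exponentials and cancelling the exponential, which is nonzero,
gives equal derivatives. It serves to deduce `M = N` from `exp M = exp N`. -/
lemma subst_exp_injective {g h : ℂ⟦X⟧} (hg : constantCoeff g = 0) (hh : constantCoeff h = 0)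
    (hgh : (exp ℂ).subst g = (exp ℂ).subst h) : g = h := by
  apply derivative.ext
  · have h1 := derivative_subst_exp hg
    rw [hgh, derivative_subst_exp hh] at h1
    refine (mul_left_cancel₀ (fun h0 => ?_) h1).symm
    have := constantCoeff_subst_exp hh
    rw [h0] at this
    simp at this
  · rw [hg, hh]

lemma GraphSet.ncard_eq_zero {P : GraphSet} (hprime : ∀ (n : ℕ), ∀ G ∈ P n, G.IsPrimeGraph)
    {n : ℕ} (hn : n < 3) : (P n).ncard = 0 := by
  rw [Set.eq_empty_of_forall_notMem (s := P n) fun G hG => absurd (hprime n G hG).1 (by lia),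
    Set.ncard_empty]

variable {P : GraphSet}

/-- The functional equations of the generating series of trees. -/
lemma egfSeries_equations (hprime : ∀ (n : ℕ), ∀ G ∈ P n, G.IsPrimeGraph) :
    egfSeries (treeCount (DecoratedTree.IsDecorated P)) =
        (exp ℂ).subst (egfSeries (treeCount (NotJoin P))) - 1 ∧
      egfSeries (treeCount (NotUnion P)) = egfSeries (treeCount (NotJoin P)) ∧
      egfSeries (treeCount (NotJoin P)) = X + (egfSeries (treeCount (DecoratedTree.IsDecorated P)) -
          egfSeries (treeCount (NotJoin P))) + (egfSeries fun k => (P k).ncard).subst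
            (egfSeries (treeCount (DecoratedTree.IsDecorated P))) := by
  have hX : egfSeries (fun n => if n = 1 then 1 else 0) = X := by
    ext n
    rcases n with _ | _ | n <;> simp [coeff_egfSeries, coeff_X]
  have hN : egfSeries (treeCount (NotJoin P)) = X + (egfSeries (treeCount (UnionRoot P)) +
      egfSeries (treeCount (GraphRoot P))) := by
    rw [← hX, ← egfSeries_add, ← egfSeries_add]
    exact congrArg _ (funext fun n => treeCount_notJoin hprime n)
  have hM : egfSeries (treeCount (NotUnion P)) = X + (egfSeries (treeCount (JoinRoot P)) +
      egfSeries (treeCount (GraphRoot P))) := by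
    rw [← hX, ← egfSeries_add, ← egfSeries_add]
    exact congrArg _ (funext fun n => treeCount_notUnion hprime n)
  have hT : egfSeries (treeCount (DecoratedTree.IsDecorated P)) =
      egfSeries (treeCount (NotJoin P)) + egfSeries (treeCount (JoinRoot P)) := by
    rw [← egfSeries_add]
    exact congrArg _ (funext fun n => treeCount_isDecorated n)
  have hJ : egfSeries (treeCount (JoinRoot P)) =
      (exp ℂ).subst (egfSeries (treeCount (NotJoin P))) - 1 - egfSeries (treeCount (NotJoin P)) := by
    rw [← subst_exp_sub_one_sub_X (constantCoeff_egfSeries_treeCount _), ← egfSeries_two_le]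
    exact egfSeries_treeCount_rootIn _ (labelFree_notJoin P) fun k => by simp
  have hU : egfSeries (treeCount (UnionRoot P)) = (exp ℂ).subst (egfSeries (treeCount (NotUnion P)))
      - 1 - egfSeries (treeCount (NotUnion P)) := by
    rw [← subst_exp_sub_one_sub_X (constantCoeff_egfSeries_treeCount _), ← egfSeries_two_le]
    exact egfSeries_treeCount_rootIn _ (labelFree_notUnion P) fun k => by simp
  have hG : egfSeries (treeCount (GraphRoot P)) = (egfSeries fun k => (P k).ncard).subst
      (egfSeries (treeCount (DecoratedTree.IsDecorated P))) := by
    refine egfSeries_treeCount_rootIn _ (labelFree_isDecorated P) fun k => ?_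
    rw [Set.ncard_image_of_injective _ fun G G' h => by simpa using h]
    split_ifs with hk
    · rfl
    · rw [GraphSet.ncard_eq_zero hprime (by lia)]
  have hT' : egfSeries (treeCount (DecoratedTree.IsDecorated P)) =
      (exp ℂ).subst (egfSeries (treeCount (NotJoin P))) - 1 := by
    rw [hT, hJ]; ring
  -- Adding the missing root type to either side gives all trees: `M + U = N + J`, where the left
  -- side is `exp M - 1` and the right side `exp N - 1`.
  have hNM : egfSeries (treeCount (NotUnion P)) = egfSeries (treeCount (NotJoin P)) := by
    refine subst_exp_injective (constantCoeff_egfSeries_treeCount _)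
      (constantCoeff_egfSeries_treeCount _) ?_
    linear_combination hM - hN + hJ - hU
  refine ⟨hT', hNM, ?_⟩
  rw [← hG]
  rw [hNM] at hU
  linear_combination hN + hU - hT'

/-- The series of blossomed trees with `⊕`-replaceable blossom is the derivative of the series of
trees whose root is not a `⊕`-node. -/
lemma egfSeries_blossomCount_replaceable (hprime : ∀ (n : ℕ), ∀ G ∈ P n, G.IsPrimeGraph) :
    egfSeries (blossomCount (Replaceable P)) =
      derivative ℂ (egfSeries (treeCount (NotJoin P))) := by
  obtain ⟨hT, hM, hN⟩ := egfSeries_equations hprime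
  have h1 : egfSeries (fun n => if n = 0 then 1 else 0) = 1 := by
    ext n
    rcases n with _ | n <;> simp [coeff_egfSeries, coeff_one]
  have hBJ : egfSeries (blossomCount (BelowJoin P)) =
      egfSeries (blossomCount (BlossomTree.UnionRoot P)) +
        egfSeries (blossomCount (BlossomTree.GraphRoot P)) := by
    rw [← egfSeries_add]
    exact congrArg _ (funext fun n => blossomCount_belowJoin n)
  have hBU : egfSeries (blossomCount (BelowUnion P)) =
      1 + (egfSeries (blossomCount (BlossomTree.JoinRoot P)) +
        egfSeries (blossomCount (BlossomTree.GraphRoot P))) := by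
    rw [← h1, ← egfSeries_add, ← egfSeries_add]
    exact congrArg _ (funext fun n => blossomCount_belowUnion n)
  have hA : egfSeries (blossomCount (Replaceable P)) = egfSeries (blossomCount (BelowUnion P)) +
      egfSeries (blossomCount (BlossomTree.UnionRoot P)) := by
    rw [← egfSeries_add]
    exact congrArg _ (funext fun n => blossomCount_replaceable n)
  have hJ : egfSeries (blossomCount (BlossomTree.JoinRoot P)) =
      egfSeries (blossomCount (BelowJoin P)) *
        egfSeries (treeCount (DecoratedTree.IsDecorated P)) := by
    rw [hT, ← subst_exp_sub_one (constantCoeff_egfSeries_treeCount _), ← egfSeries_one_le]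
    exact egfSeries_blossomCount_rootIn _ (labelFree_belowJoin P) (labelFree_notJoin P)
      fun k => by simp
  have hU : egfSeries (blossomCount (BlossomTree.UnionRoot P)) =
      egfSeries (blossomCount (BelowUnion P)) *
        egfSeries (treeCount (DecoratedTree.IsDecorated P)) := by
    rw [hT, ← subst_exp_sub_one (constantCoeff_egfSeries_treeCount _), ← hM, ← egfSeries_one_le]
    exact egfSeries_blossomCount_rootIn _ (labelFree_belowUnion P) (labelFree_notUnion P)
      fun k => by simp
  have hG : egfSeries (blossomCount (BlossomTree.GraphRoot P)) =
      egfSeries (blossomCount (Replaceable P)) *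
        (derivative ℂ (egfSeries fun k => (P k).ncard)).subst
          (egfSeries (treeCount (DecoratedTree.IsDecorated P))) := by
    rw [derivative_egfSeries]
    refine egfSeries_blossomCount_rootIn _ (labelFree_replaceable P) (labelFree_isDecorated P)
      fun k => ?_
    rw [Set.ncard_image_of_injective _ fun G G' h => by simpa using h, GraphSet.ncard_blossomed]
    -- For `k = 0` the weight should be the number of graphs of size `1` in `P`, which is zero.
    split_ifs with hk
    · rfl
    · rw [GraphSet.ncard_eq_zero hprime (by lia)]
  have hdT := congrArg (derivative ℂ) hT
  rw [map_sub, derivative_subst_exp (constantCoeff_egfSeries_treeCount _), derivative_one] at hdT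
  have hdN := congrArg (derivative ℂ) hN
  rw [map_add, map_add, map_sub, derivative_X, derivative_subst
    (HasSubst.of_constantCoeff_zero' (constantCoeff_egfSeries_treeCount _))] at hdN
  generalize (derivative ℂ (egfSeries fun k => (P k).ncard)).subst
    (egfSeries (treeCount (DecoratedTree.IsDecorated P))) = D at *
  have hE : (exp ℂ).subst (egfSeries (treeCount (NotJoin P))) =
      1 + egfSeries (treeCount (DecoratedTree.IsDecorated P)) := by rw [hT]; ring
  rw [hE] at hdT
  have hT0 := constantCoeff_egfSeries_treeCount (DecoratedTree.IsDecorated P)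
  generalize egfSeries (treeCount (DecoratedTree.IsDecorated P)) = T at *
  generalize egfSeries (treeCount (NotJoin P)) = N at *
  generalize egfSeries (blossomCount (Replaceable P)) = A at *
  generalize egfSeries (blossomCount (BelowJoin P)) = B at *
  generalize egfSeries (blossomCount (BelowUnion P)) = C at *
  generalize egfSeries (blossomCount (BlossomTree.JoinRoot P)) = J at *
  generalize egfSeries (blossomCount (BlossomTree.UnionRoot P)) = U at *
  generalize egfSeries (blossomCount (BlossomTree.GraphRoot P)) = G at *
  -- With `D = P'(T)`, adding the equations gives `A = 1 + (B + C) T + A D`, and `B + C = A + G = A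
  -- + A D`.
  have hAeq : A * (1 - T - (1 + T) * D) = 1 := by
    linear_combination hA + hBU + hJ + T * hBJ + hU - T * hA + (1 + T) * hG
  -- Differentiate `2 N = X + T + P(T)` and use `T' = (1 + T) N'`.
  have hNeq : derivative ℂ N * (1 - T - (1 + T) * D) = 1 := by
    linear_combination hdN + (1 + D) * hdT
  refine mul_right_cancel₀ (fun h0 => ?_) (hAeq.trans hNeq.symm)
  rw [h0, mul_zero] at hAeq
  exact zero_ne_one hAeq

end Formal

/-! ### Taylor series at the origin as formal power series -/

section Taylor

open PowerSeries

/-- The Taylor series of `f` at `0`, as a formal power series. -/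
noncomputable def taylorSeries (f : ℂ → ℂ) : ℂ⟦X⟧ := .mk fun n => iteratedDeriv n f 0 / (n ! : ℂ)

lemma coeff_taylorSeries (f : ℂ → ℂ) (n : ℕ) :
    coeff n (taylorSeries f) = iteratedDeriv n f 0 / (n ! : ℂ) := coeff_mk _ _

lemma constantCoeff_taylorSeries (f : ℂ → ℂ) : constantCoeff (taylorSeries f) = f 0 := by
  rw [← coeff_zero_eq_constantCoeff_apply, coeff_taylorSeries]
  simp

lemma taylorSeries_congr {f g : ℂ → ℂ} (h : f =ᶠ[𝓝 0] g) : taylorSeries f = taylorSeries g := by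
  ext n
  rw [coeff_taylorSeries, coeff_taylorSeries, h.iteratedDeriv_eq]

lemma taylorSeries_add {f g : ℂ → ℂ} (hf : AnalyticAt ℂ f 0) (hg : AnalyticAt ℂ g 0) :
    taylorSeries (fun z => f z + g z) = taylorSeries f + taylorSeries g := by
  ext n
  rw [map_add, coeff_taylorSeries, coeff_taylorSeries, coeff_taylorSeries,
    iteratedDeriv_fun_add hf.contDiffAt hg.contDiffAt, add_div]

lemma taylorSeries_mul {f g : ℂ → ℂ} (hf : AnalyticAt ℂ f 0) (hg : AnalyticAt ℂ g 0) :
    taylorSeries (fun z => f z * g z) = taylorSeries f * taylorSeries g := by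
  ext n
  rw [coeff_mul, Finset.Nat.sum_antidiagonal_eq_sum_range_succ_mk, coeff_taylorSeries,
    iteratedDeriv_fun_mul hf.contDiffAt hg.contDiffAt, Finset.sum_div]
  refine Finset.sum_congr rfl fun j hj => ?_
  have hj' : j ≤ n := by simpa [Nat.lt_succ_iff] using hj
  rw [coeff_taylorSeries, coeff_taylorSeries, Nat.cast_choose ℂ hj']
  have h1 : (n ! : ℂ) ≠ 0 := mod_cast n.factorial_ne_zero
  have h2 : (j ! : ℂ) ≠ 0 := mod_cast j.factorial_ne_zero
  have h3 : ((n - j)! : ℂ) ≠ 0 := mod_cast (n - j).factorial_ne_zero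
  field_simp

lemma taylorSeries_const (c : ℂ) : taylorSeries (fun _ => c) = C c := by
  ext n
  rw [coeff_taylorSeries, coeff_C, iteratedDeriv_const]
  rcases n with _ | n <;> simp

lemma taylorSeries_id : taylorSeries (fun z => z) = X := by
  ext n
  rw [coeff_taylorSeries, coeff_X]
  rcases n with _ | _ | n
  · simp
  · simp [iteratedDeriv_one]
  · rw [iteratedDeriv_succ', iteratedDeriv_succ']
    simp

lemma taylorSeries_deriv (f : ℂ → ℂ) :
    taylorSeries (deriv f) = derivative ℂ (taylorSeries f) := by
  ext n
  rw [coeff_derivative, coeff_taylorSeries, coeff_taylorSeries, iteratedDeriv_succ',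
    Nat.factorial_succ]
  have h1 : (n ! : ℂ) ≠ 0 := mod_cast n.factorial_ne_zero
  have h2 : (n + 1 : ℂ) ≠ 0 := mod_cast n.succ_ne_zero
  push_cast
  field_simp

lemma taylorSeries_exp : taylorSeries Complex.exp = exp ℂ := by
  ext n
  rw [coeff_taylorSeries, coeff_exp, iteratedDeriv_eq_iterate, Complex.iter_deriv_exp]
  simp

lemma eq_of_forall_X_pow_dvd_sub {f g : ℂ⟦X⟧} (h : ∀ n, X ^ n ∣ f - g) : f = g := by
  ext n
  have := X_pow_dvd_iff.1 (h (n + 1)) n (Nat.lt_succ_self n)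
  rwa [map_sub, sub_eq_zero] at this

lemma AnalyticAt.dslope_self {f : ℂ → ℂ} {z : ℂ} (hf : AnalyticAt ℂ f z) :
    AnalyticAt ℂ (dslope f z) z := by
  obtain ⟨p, hp⟩ := hf
  exact ⟨_, hp.has_fpower_series_dslope_fslope⟩

lemma eq_add_mul_dslope (f : ℂ → ℂ) : f = fun z => f 0 + z * dslope f 0 z := by
  ext z
  have := sub_smul_dslope f 0 z
  rw [smul_eq_mul, sub_zero] at this
  rw [this]
  ring

/-- Congruence modulo `X ^ n` by induction on `n`, for all `f` at once: writing `f w = f 0 + w *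
dslope f 0 w`, composition with `g` puts a factor divisible by `X` in front of the same statement
for `dslope f 0`. -/
lemma taylorSeries_comp {f g : ℂ → ℂ} (hf : AnalyticAt ℂ f 0) (hg : AnalyticAt ℂ g 0)
    (hg0 : g 0 = 0) : taylorSeries (fun z => f (g z)) = (taylorSeries f).subst (taylorSeries g) := by
  have hc : constantCoeff (taylorSeries g) = 0 := by rw [constantCoeff_taylorSeries, hg0]
  have hs := HasSubst.of_constantCoeff_zero' hc
  refine eq_of_forall_X_pow_dvd_sub fun n => ?_
  induction n generalizing f with
  | zero => simp
  | succ n ih =>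
    have hd := hf.dslope_self
    have hdg : AnalyticAt ℂ (fun z => dslope f 0 (g z)) 0 := by
      rw [← hg0] at hd
      exact hd.comp hg |>.congr (by simp [hg0]; rfl)
    have h1 : taylorSeries f = C (f 0) + X * taylorSeries (dslope f 0) := by
      have hX := taylorSeries_mul (f := fun z => z) analyticAt_id hd
      have := taylorSeries_add (f := fun _ => f 0) (g := fun z => z * dslope f 0 z)
        analyticAt_const (analyticAt_id.mul hd)
      rwa [← eq_add_mul_dslope f, taylorSeries_const, hX, taylorSeries_id] at this
    have h2 : taylorSeries (fun z => f (g z)) =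
        C (f 0) + taylorSeries g * taylorSeries (fun z => dslope f 0 (g z)) := by
      have := taylorSeries_add (f := fun _ => f 0) (g := fun z => g z * dslope f 0 (g z))
        analyticAt_const (hg.mul hdg)
      rw [taylorSeries_const, taylorSeries_mul hg hdg] at this
      rw [← this]
      exact congrArg taylorSeries (funext fun z => congrFun (eq_add_mul_dslope f) (g z))
    have h3 : (taylorSeries f).subst (taylorSeries g) = C (f 0) +
        taylorSeries g * (taylorSeries (dslope f 0)).subst (taylorSeries g) := by
      rw [h1, ← coe_substAlgHom hs, map_add, map_mul, coe_substAlgHom hs, subst_X hs]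
      congr 1
      rw [← coe_substAlgHom hs]
      exact (substAlgHom hs).commutes (f 0)
    rw [h2, h3, add_sub_add_left_eq_sub, ← mul_sub, pow_succ']
    exact mul_dvd_mul (X_dvd_iff.2 hc) (ih hd)

lemma X_pow_dvd_subst_sub_subst {g h f : ℂ⟦X⟧} (hg : constantCoeff g = 0)
    (hh : constantCoeff h = 0) {n : ℕ} (hgh : X ^ n ∣ g - h) :
    X ^ n ∣ f.subst g - f.subst h := by
  rw [X_pow_dvd_iff]
  intro m hm
  rw [map_sub, coeff_subst_eq_sum hg, coeff_subst_eq_sum hh, ← Finset.sum_sub_distrib]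
  refine Finset.sum_eq_zero fun k _ => ?_
  rw [← mul_sub, ← map_sub, X_pow_dvd_iff.1 (hgh.trans (sub_dvd_pow_sub_pow g h k)) m hm, mul_zero]

/-- Without a linear term in `f`, only powers `k ≥ 2` matter, and the cofactor of `g - h` in `g ^ k
- h ^ k` is then divisible by `X`. This gain of one power drives the uniqueness of the formal
solution. -/
lemma X_pow_succ_dvd_subst_sub_subst {g h f : ℂ⟦X⟧} (hg : constantCoeff g = 0)
    (hh : constantCoeff h = 0) (hf : coeff 1 f = 0) {n : ℕ} (hgh : X ^ n ∣ g - h) :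
    X ^ (n + 1) ∣ f.subst g - f.subst h := by
  rw [X_pow_dvd_iff]
  intro m hm
  rw [map_sub, coeff_subst_eq_sum hg, coeff_subst_eq_sum hh, ← Finset.sum_sub_distrib]
  refine Finset.sum_eq_zero fun k _ => ?_
  rcases k with _ | _ | k
  · simp
  · simp [hf]
  · have hX : X ∣ ∑ i ∈ Finset.range (k + 2), g ^ i * h ^ (k + 2 - 1 - i) := by
      refine Finset.dvd_sum fun i hi => ?_
      rcases i with _ | i
      · exact ((X_dvd_iff.2 hh).trans (dvd_pow_self h (by lia))).mul_left _
      · exact ((X_dvd_iff.2 hg).trans (dvd_pow_self g (by lia))).mul_right _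
    have : X ^ (n + 1) ∣ g ^ (k + 2) - h ^ (k + 2) := by
      rw [← (Commute.all g h).geom_sum₂_mul, pow_succ']
      exact mul_dvd_mul hX hgh
    rw [← mul_sub, ← map_sub, X_pow_dvd_iff.1 this m hm, mul_zero]

/-- Uniqueness of the formal solution of `N = X + (exp N - 1 - N) + f (exp N - 1)`. -/
lemma eq_of_functional_equation {f g h : ℂ⟦X⟧} (hf : coeff 1 f = 0) (hg : constantCoeff g = 0)
    (hh : constantCoeff h = 0)
    (hge : g = X + ((exp ℂ).subst g - 1 - g) + f.subst ((exp ℂ).subst g - 1))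
    (hhe : h = X + ((exp ℂ).subst h - 1 - h) + f.subst ((exp ℂ).subst h - 1)) : g = h := by
  refine eq_of_forall_X_pow_dvd_sub fun n => ?_
  induction n with
  | zero => simp
  | succ n ih =>
    -- Neither `exp - 1 - X` nor `f` has a linear term, so the right-hand side of the equation is a
    -- contraction for the `X`-adic topology.
    have h1 := X_pow_succ_dvd_subst_sub_subst (f := exp ℂ - 1 - X) hg hh
      (by simp [coeff_exp, coeff_one]) ih
    have h2 := X_pow_dvd_subst_sub_subst (f := exp ℂ) hg hh ih
    have h3 := X_pow_succ_dvd_subst_sub_subst (f := f) (g := (exp ℂ).subst g - 1)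
      (h := (exp ℂ).subst h - 1) (by rw [map_sub, constantCoeff_subst_exp hg]; simp)
      (by rw [map_sub, constantCoeff_subst_exp hh]; simp) hf
      (by rwa [sub_sub_sub_cancel_right])
    rw [subst_exp_sub_one_sub_X hg, subst_exp_sub_one_sub_X hh] at h1
    have := dvd_add h1 h3
    convert this using 1
    linear_combination hge - hhe

lemma egf_eq_ofScalars {a : ℕ → ℕ} {f : ℂ → ℂ} (h : taylorSeries f = egfSeries a) :
    egf ℂ a = FormalMultilinearSeries.ofScalars ℂ fun n => iteratedDeriv n f 0 / (n ! : ℂ) := by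
  refine congrArg (FormalMultilinearSeries.ofScalars ℂ) (funext fun n => ?_)
  have := congrArg (coeff n) h
  rw [coeff_taylorSeries, coeff_egfSeries] at this
  exact this.symm

/-- Cauchy's formula gives an expansion on every smaller disk, and all these expansions agree with
the Taylor series at `0`. The radius is allowed to be infinite. -/
lemma hasFPowerSeriesOnBall_egf {a : ℕ → ℕ} {f : ℂ → ℂ} {R : ℝ≥0∞} (hR : 0 < R)
    (hf : DifferentiableOn ℂ f (Metric.eball 0 R)) (h : taylorSeries f = egfSeries a) :
    HasFPowerSeriesOnBall f (egf ℂ a) 0 R := by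
  have hfa : AnalyticAt ℂ f 0 := hf.analyticAt (Metric.eball_mem_nhds 0 hR)
  have h1 := hfa.hasFPowerSeriesAt
  rw [← egf_eq_ofScalars h] at h1
  have key : ∀ r : NNReal, 0 < r → (r : ℝ≥0∞) < R → HasFPowerSeriesOnBall f (egf ℂ a) 0 r := by
    intro r hr hrR
    have hsub : Metric.closedBall (0 : ℂ) r ⊆ Metric.eball 0 R := by
      intro z hz
      rw [Metric.mem_eball, edist_zero_right]
      refine lt_of_le_of_lt ?_ hrR
      rw [mem_closedBall_zero_iff] at hz
      exact_mod_cast hz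
    have h2 := (hf.mono hsub).hasFPowerSeriesOnBall hr
    rwa [h2.hasFPowerSeriesAt.eq_formalMultilinearSeries h1] at h2
  refine ⟨le_of_forall_lt fun x hx => ?_, hR, fun {y} hy => ?_⟩
  · obtain ⟨r, hxr, hrR⟩ := ENNReal.lt_iff_exists_nnreal_btwn.1 hx
    have hr : 0 < r := by
      rw [← ENNReal.coe_pos]
      exact lt_of_le_of_lt bot_le hxr
    exact hxr.trans_le (key r hr hrR).r_le
  · obtain ⟨r, hyr, hrR⟩ := ENNReal.lt_iff_exists_nnreal_btwn.1 (Metric.mem_eball.1 hy)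
    have hr : 0 < r := by
      rw [← ENNReal.coe_pos]
      exact lt_of_le_of_lt bot_le hyr
    exact (key r hr hrR).hasSum hyr

lemma taylorSeries_of_hasFPowerSeriesAt {a : ℕ → ℕ} {f : ℂ → ℂ}
    (h : HasFPowerSeriesAt f (egf ℂ a) 0) : taylorSeries f = egfSeries a := by
  have h1 := h.analyticAt.hasFPowerSeriesAt
  have h2 := h1.eq_formalMultilinearSeries h
  have h3 := FormalMultilinearSeries.ofScalars_series_injective ℂ ℂ h2
  ext n
  rw [coeff_taylorSeries, coeff_egfSeries]
  exact congrFun h3 n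

end Taylor

/-! ### Inversion of `w ↦ w - L w` at a square-root singularity -/

/-- The hypotheses on `L` under which the inverse of `w ↦ w - L w` has a square-root singularity
at `κ - L κ`, and no other dominant singularity. -/
structure InversionData (L : ℂ → ℂ) (κ lam d : ℝ) : Prop where
  pos : 0 < κ
  analytic : AnalyticOnNhd ℂ L (Metric.closedBall 0 κ)
  map_zero : L 0 = 0
  norm_deriv_lt : ∀ w, ‖w‖ < κ → ‖deriv L w‖ < 1
  deriv_eq : deriv L κ = 1
  map_eq : L κ = lam
  norm_lt : ∀ w : ℂ, ‖w‖ = κ → w ≠ κ → ‖L w‖ < lam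
  lam_lt : lam < κ
  deriv_deriv_eq : deriv (deriv L) κ = d
  d_pos : 0 < d

namespace InversionData

open Metric Filter

variable {L : ℂ → ℂ} {κ lam d : ℝ}

/-- On a closed disk of radius `r < κ` the maximum of `‖deriv L‖` is less than `1`, so `L` is a
strict contraction there and `w - L w` cannot take a value twice. -/
lemma injOn (h : InversionData L κ lam d) : Set.InjOn (fun w => w - L w) (ball 0 κ) := by
  intro a ha b hb hab
  by_contra hne
  rw [mem_ball_zero_iff] at ha hb
  let r := max ‖a‖ ‖b‖
  have hr : r < κ := max_lt ha hb
  have hsub : closedBall (0 : ℂ) r ⊆ closedBall 0 κ := closedBall_subset_closedBall hr.le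
  have hc : ContinuousOn (fun w => ‖deriv L w‖) (closedBall 0 r) :=
    ((h.analytic.mono hsub).deriv.continuousOn).norm
  obtain ⟨m, hm, hmax⟩ := (isCompact_closedBall (0 : ℂ) r).exists_isMaxOn
    ⟨a, mem_closedBall_zero_iff.2 (le_max_left _ _)⟩ hc
  have h1 : ‖deriv L m‖ < 1 :=
    h.norm_deriv_lt m ((mem_closedBall_zero_iff.1 hm).trans_lt hr)
  have h2 := (convex_closedBall (0 : ℂ) r).norm_image_sub_le_of_norm_deriv_le
    (fun x hx => (h.analytic x (hsub hx)).differentiableAt) (fun x hx => hmax hx)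
    (mem_closedBall_zero_iff.2 (le_max_left _ _)) (mem_closedBall_zero_iff.2 (le_max_right _ _))
  have h3 : L b - L a = b - a := by
    have : a - L a = b - L b := hab
    linear_combination this
  rw [h3] at h2
  have h4 : 0 < ‖b - a‖ := norm_pos_iff.2 (sub_ne_zero.2 (Ne.symm hne))
  nlinarith

lemma analyticAt_sub (h : InversionData L κ lam d) {w : ℂ} (hw : ‖w‖ ≤ κ) :
    AnalyticAt ℂ (fun w => w - L w) w :=
  analyticAt_id.sub (h.analytic w (mem_closedBall_zero_iff.2 hw))

lemma deriv_sub_eq (h : InversionData L κ lam d) {w : ℂ} (hw : ‖w‖ ≤ κ) :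
    deriv (fun w => w - L w) w = 1 - deriv L w := by
  have := (hasDerivAt_id w).sub
    (h.analytic w (mem_closedBall_zero_iff.2 hw)).differentiableAt.hasDerivAt
  exact this.deriv

lemma deriv_sub_ne_zero (h : InversionData L κ lam d) {w : ℂ} (hw : ‖w‖ < κ) :
    deriv (fun w => w - L w) w ≠ 0 := by
  rw [h.deriv_sub_eq hw.le, sub_ne_zero]
  intro h1
  have := h.norm_deriv_lt w hw
  rw [← h1, norm_one] at this
  exact lt_irrefl _ this

lemma isOpen_image (h : InversionData L κ lam d) :
    IsOpen ((fun w => w - L w) '' ball 0 κ) := by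
  rw [isOpen_iff_mem_nhds]
  rintro _ ⟨w, hw, rfl⟩
  have hw' := mem_ball_zero_iff.1 hw
  have hs := (h.analyticAt_sub hw'.le).hasStrictDerivAt
  rw [← hs.map_nhds_eq (h.deriv_sub_ne_zero hw')]
  exact image_mem_map (isOpen_ball.mem_nhds hw)

lemma lam_nonneg (h : InversionData L κ lam d) : 0 ≤ lam := by
  refine (norm_nonneg _).trans (h.norm_lt (-κ) (by simp [abs_of_pos h.pos]) fun h0 => ?_).le
  have := h.pos
  have h1 := congrArg Complex.re h0
  simp at h1
  linarith

lemma norm_map_le (h : InversionData L κ lam d) {w : ℂ} (hw : ‖w‖ = κ) : ‖L w‖ ≤ lam := by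
  by_cases hwκ : w = κ
  · rw [hwκ, h.map_eq, Complex.norm_real, Real.norm_eq_abs, abs_of_nonneg h.lam_nonneg]
  · exact (h.norm_lt w hw hwκ).le

/-- Connectedness. The image is open; a point of its closure is attained on the closed disk, and on
the circle `‖w‖ = κ` one has `‖w - L w‖ ≥ κ - lam`, so inside the ball the image is also closed. -/
lemma ball_subset_image (h : InversionData L κ lam d) :
    ball 0 (κ - lam) ⊆ (fun w => w - L w) '' ball 0 κ := by
  have hc : IsClosed ((fun w => w - L w) '' closedBall 0 κ) :=
    ((isCompact_closedBall (0 : ℂ) κ).image_of_continuousOn fun w hw =>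
      (h.analyticAt_sub (mem_closedBall_zero_iff.1 hw)).continuousAt.continuousWithinAt).isClosed
  have hR : 0 < κ - lam := sub_pos.2 h.lam_lt
  refine (isPreconnected_ball).subset_of_closure_inter_subset h.isOpen_image
    ⟨0, by simpa using hR, 0, by simpa using h.pos, by simp [h.map_zero]⟩ ?_
  rintro z ⟨hz, hzR⟩
  have h1 : z ∈ (fun w => w - L w) '' closedBall 0 κ :=
    closure_minimal (Set.image_mono ball_subset_closedBall) hc hz
  obtain ⟨w, hw, rfl⟩ := h1
  rw [mem_closedBall_zero_iff] at hw
  rcases hw.lt_or_eq with hw | hw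
  · exact ⟨w, mem_ball_zero_iff.2 hw, rfl⟩
  · rw [mem_ball_zero_iff] at hzR
    have := norm_sub_norm_le w (L w)
    have := h.norm_map_le hw
    dsimp only at hzR
    linarith

/-- On the circle the inequality `‖w - L w‖ > κ - lam` is strict except at `w = κ`, whose image is
the excluded point. -/
lemma closedBall_subset_image (h : InversionData L κ lam d) {z : ℂ} (hz : ‖z‖ ≤ κ - lam)
    (hzR : z ≠ ((κ - lam : ℝ) : ℂ)) : z ∈ (fun w => w - L w) '' ball 0 κ := by
  have hc : IsClosed ((fun w => w - L w) '' closedBall 0 κ) :=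
    ((isCompact_closedBall (0 : ℂ) κ).image_of_continuousOn fun w hw =>
      (h.analyticAt_sub (mem_closedBall_zero_iff.1 hw)).continuousAt.continuousWithinAt).isClosed
  have hR : κ - lam ≠ 0 := (sub_pos.2 h.lam_lt).ne'
  have h1 : z ∈ closure (ball (0 : ℂ) (κ - lam)) := by
    rw [closure_ball _ hR]
    exact mem_closedBall_zero_iff.2 hz
  obtain ⟨w, hw, rfl⟩ := closure_minimal (h.ball_subset_image.trans
    (Set.image_mono ball_subset_closedBall)) hc h1
  rw [mem_closedBall_zero_iff] at hw
  rcases hw.lt_or_eq with hw | hw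
  · exact ⟨w, mem_ball_zero_iff.2 hw, rfl⟩
  · dsimp only at hz hzR
    have h2 : w ≠ κ := by
      rintro rfl
      rw [h.map_eq] at hzR
      exact hzR (by push_cast; rfl)
    have := norm_sub_norm_le w (L w)
    have := h.norm_lt w hw h2
    linarith

/-- The inverse of `w ↦ w - L w` on the disk of radius `κ`. -/
noncomputable def inverse (_ : InversionData L κ lam d) : ℂ → ℂ :=
  Function.invFunOn (fun w => w - L w) (ball 0 κ)

lemma norm_inverse_lt (h : InversionData L κ lam d) {z : ℂ}
    (hz : z ∈ (fun w => w - L w) '' ball 0 κ) : ‖h.inverse z‖ < κ :=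
  mem_ball_zero_iff.1 (Function.invFunOn_mem hz)

lemma inverse_sub (h : InversionData L κ lam d) {z : ℂ}
    (hz : z ∈ (fun w => w - L w) '' ball 0 κ) : h.inverse z - L (h.inverse z) = z :=
  Function.invFunOn_eq hz

lemma inverse_eq (h : InversionData L κ lam d) {w z : ℂ} (hw : ‖w‖ < κ) (hz : w - L w = z) :
    h.inverse z = w := by
  have hz' : z ∈ (fun w => w - L w) '' ball 0 κ := ⟨w, mem_ball_zero_iff.2 hw, hz⟩
  refine h.injOn (mem_ball_zero_iff.2 (h.norm_inverse_lt hz')) (mem_ball_zero_iff.2 hw) ?_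
  exact (h.inverse_sub hz').trans hz.symm

lemma inverse_zero (h : InversionData L κ lam d) : h.inverse 0 = 0 :=
  h.inverse_eq (by simpa using h.pos) (by simp [h.map_zero])

/-- The local inverse given by the inverse function theorem takes its values in the disk, where
injectivity identifies it with `h.inverse`. -/
lemma analyticAt_inverse (h : InversionData L κ lam d) {z : ℂ}
    (hz : z ∈ (fun w => w - L w) '' ball 0 κ) : AnalyticAt ℂ h.inverse z := by
  obtain ⟨w, hw, rfl⟩ := hz
  have hw' := mem_ball_zero_iff.1 hw
  have ha := h.analyticAt_sub hw'.le
  have hd := h.deriv_sub_ne_zero hw'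
  refine (ha.analyticAt_localInverse hd).congr ?_
  have hs := ha.hasStrictDerivAt
  have hcont : Tendsto (hs.localInverse _ _ _ hd) (𝓝 (w - L w)) (𝓝 w) := by
    have h1 := (hs.to_localInverse hd).hasDerivAt.continuousAt
    have h2 : hs.localInverse _ _ _ hd (w - L w) = w :=
      (hs.hasStrictFDerivAt_equiv hd).localInverse_apply_image
    rw [ContinuousAt, h2] at h1
    exact h1
  filter_upwards [hs.eventually_right_inverse hd, hcont (isOpen_ball.mem_nhds hw)] with z hz hzw
  exact (h.inverse_eq (mem_ball_zero_iff.1 hzw) hz).symm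

lemma deriv_inverse (h : InversionData L κ lam d) {z : ℂ}
    (hz : z ∈ (fun w => w - L w) '' ball 0 κ) :
    deriv h.inverse z * (1 - deriv L (h.inverse z)) = 1 := by
  have h1 := (h.analyticAt_inverse hz).differentiableAt.hasDerivAt
  have hn := (h.norm_inverse_lt hz).le
  have h2 := (h.analyticAt_sub hn).differentiableAt.hasDerivAt
  rw [h.deriv_sub_eq hn] at h2
  have h3 := h2.comp z h1
  have h4 : (fun w => w - L w) ∘ h.inverse =ᶠ[𝓝 z] id := by
    filter_upwards [h.isOpen_image.mem_nhds hz] with z hz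
    exact h.inverse_sub hz
  rw [mul_comm]
  exact (h3.congr_of_eventuallyEq h4.symm).unique (hasDerivAt_id z)

end InversionData

/-! ### Taylor expansions to second order -/

section LocalExpansions

open Filter Asymptotics

lemma AnalyticAt.isBigO_sub_sub_deriv_mul {v : ℂ → ℂ} (hv : AnalyticAt ℂ v 0) :
    (fun s => v s - v 0 - deriv v 0 * s) =O[𝓝 0] fun s => s ^ 2 := by
  have h1 : (fun s => dslope v 0 s - dslope v 0 0) =O[𝓝 0] fun s => s - 0 :=
    hv.dslope_self.differentiableAt.isBigO_sub
  have h2 := (isBigO_refl (fun s : ℂ => s) (𝓝 0)).mul h1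
  refine (h2.congr (fun s => ?_) fun s => ?_)
  · rw [dslope_same, mul_sub]
    have h3 : v s = v 0 + s * dslope v 0 s := congrFun (eq_add_mul_dslope v) s
    rw [h3]
    ring
  · ring

/-- The quotient is `dslope` taken twice; its value at `κ` comes from differentiating `G w = (w - κ)
* dslope G κ w` twice. -/
lemma AnalyticAt.eq_sq_mul_of_deriv_eq_zero {G : ℂ → ℂ} {κ : ℂ} (hG : AnalyticAt ℂ G κ)
    (h0 : G κ = 0) (h1 : deriv G κ = 0) : ∃ q : ℂ → ℂ, AnalyticAt ℂ q κ ∧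
      2 * q κ = deriv (deriv G) κ ∧ ∀ w, G w = (w - κ) ^ 2 * q w := by
  have hd := hG.dslope_self
  refine ⟨dslope (dslope G κ) κ, hd.dslope_self, ?_, fun w => ?_⟩
  · have hGw : ∀ w, G w = (w - κ) * dslope G κ w := fun w => by
      have := sub_smul_dslope G κ w
      rw [smul_eq_mul, h0, sub_zero] at this
      exact this.symm
    have hev : deriv G =ᶠ[𝓝 κ] fun w => dslope G κ w + (w - κ) * deriv (dslope G κ) w := by
      filter_upwards [hd.eventually_analyticAt] with w hw
      have h2 := ((hasDerivAt_id w).sub_const κ).mul hw.differentiableAt.hasDerivAt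
      have h3 : G = fun w => (w - κ) * dslope G κ w := funext hGw
      have h4 : deriv G w = 1 * dslope G κ w + (w - κ) * deriv (dslope G κ) w := by
        conv_lhs => rw [h3]
        exact h2.deriv
      rw [h4, one_mul]
    rw [hev.deriv_eq, dslope_same]
    have h5 := hd.differentiableAt.hasDerivAt.add
      (((hasDerivAt_id κ).sub_const κ).mul hd.deriv.differentiableAt.hasDerivAt)
    have h6 := h5.deriv
    simp only [id, sub_self, zero_mul, add_zero, one_mul] at h6
    rw [← two_mul] at h6
    exact h6.symm
  · have h2 := sub_smul_dslope G κ w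
    have h3 := sub_smul_dslope (dslope G κ) κ w
    rw [dslope_same, h1, sub_zero] at h3
    rw [h0, sub_zero, ← h3] at h2
    simp only [smul_eq_mul] at h2
    rw [← h2]
    ring

end LocalExpansions

/-! ### Local uniformization of the inverse at the branch point -/

namespace InversionData

open Metric Filter

variable {L : ℂ → ℂ} {κ lam d : ℝ}

/-- The local parametrization of the inverse by `s = √(1 - z / R)`. -/
lemma exists_local_param (h : InversionData L κ lam d) : ∃ ω : ℂ → ℂ, AnalyticAt ℂ ω 0 ∧
    ω 0 = κ ∧ deriv ω 0 = -(√(2 * (κ - lam) / d) : ℝ) ∧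
    ∀ᶠ s in 𝓝 0, ω s - L (ω s) = (κ - lam : ℝ) * (1 - s ^ 2) := by
  have hR : 0 < κ - lam := sub_pos.2 h.lam_lt
  have hRc : ((κ - lam : ℝ) : ℂ) ≠ 0 := by exact_mod_cast hR.ne'
  have hκ : ‖(κ : ℂ)‖ ≤ κ := by simp [abs_of_pos h.pos]
  have hLa : AnalyticAt ℂ L κ := h.analytic _ (mem_closedBall_zero_iff.2 hκ)
  -- `G` has a double zero at `κ`, with second derivative `d`, because `deriv L κ = 1`.
  let G : ℂ → ℂ := fun w => (κ - lam : ℝ) - (w - L w)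
  have hG : AnalyticAt ℂ G κ := analyticAt_const.sub (h.analyticAt_sub hκ)
  have hdG : deriv G =ᶠ[𝓝 (κ : ℂ)] fun w => deriv L w - 1 := by
    filter_upwards [hLa.eventually_analyticAt] with w hw
    have := ((hasDerivAt_id w).sub hw.differentiableAt.hasDerivAt).const_sub ((κ - lam : ℝ) : ℂ)
    have h2 := this.deriv
    rw [neg_sub] at h2
    exact h2
  obtain ⟨q, hq, hq2, hGq⟩ := hG.eq_sq_mul_of_deriv_eq_zero (by simp [G, h.map_eq])
    (by rw [hdG.eq_of_nhds, h.deriv_eq, sub_self])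
  rw [hdG.deriv_eq, deriv_sub_const, h.deriv_deriv_eq] at hq2
  have hc : 0 < d / (2 * (κ - lam)) := div_pos h.d_pos (by linarith)
  have hqR : q κ / (κ - lam : ℝ) = (d / (2 * (κ - lam)) : ℝ) := by
    have : q κ = d / 2 := by linear_combination hq2 / 2
    rw [this]
    push_cast
    field_simp
  have hslit : q κ / (κ - lam : ℝ) ∈ Complex.slitPlane := by
    rw [hqR]; exact Complex.ofReal_mem_slitPlane.2 hc
  -- An analytic square root of `q / (κ - lam)` near `κ`, where this quotient is positive.
  let r : ℂ → ℂ := fun w => Complex.exp (Complex.log (q w / (κ - lam : ℝ)) / 2)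
  have hqR' : AnalyticAt ℂ (fun w => q w / (κ - lam : ℝ)) κ := hq.div_const
  have hr : AnalyticAt ℂ r κ := ((hqR'.clog hslit).div_const).cexp
  have hrκ : r κ = (√(d / (2 * (κ - lam))) : ℝ) := by
    simp only [r, hqR, ← Complex.ofReal_log hc.le]
    rw [Real.sqrt_eq_rpow, Real.rpow_def_of_pos hc]
    push_cast
    congr 1
    ring
  have hr2 : ∀ᶠ w in 𝓝 (κ : ℂ), r w ^ 2 = q w / (κ - lam : ℝ) := by
    filter_upwards [hqR'.continuousAt.eventually_ne (Complex.slitPlane_ne_zero hslit)] with w hw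
    rw [← Complex.exp_nat_mul, Nat.cast_ofNat, mul_div_cancel₀ _ two_ne_zero, Complex.exp_log hw]
  -- A square root of `G / (κ - lam)` with a simple zero at `κ`; its local inverse is `ω`. The sign
  -- is chosen so that small `s > 0` correspond to `w < κ`, inside the disk.
  let χ : ℂ → ℂ := fun w => (κ - w) * r w
  have hχ : AnalyticAt ℂ χ κ := (analyticAt_const.sub analyticAt_id).mul hr
  have hχ' : deriv χ κ = -(√(d / (2 * (κ - lam))) : ℝ) := by
    have := (((hasDerivAt_id (κ : ℂ)).const_sub (κ : ℂ)).mul hr.differentiableAt.hasDerivAt).deriv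
    simp only [id, sub_self, zero_mul, add_zero] at this
    rw [hrκ, neg_one_mul] at this
    exact this
  have hd0 : deriv χ κ ≠ 0 := by
    rw [hχ', neg_ne_zero]
    exact_mod_cast (Real.sqrt_pos.2 hc).ne'
  have hχκ : χ κ = 0 := by simp [χ]
  have hs := hχ.hasStrictDerivAt
  have hinv := hs.to_localInverse hd0
  have hκ' : hs.localInverse _ _ _ hd0 0 = κ := by
    rw [← hχκ]; exact (hs.hasStrictFDerivAt_equiv hd0).localInverse_apply_image
  have hanal := hχ.analyticAt_localInverse hd0
  have hright := hs.eventually_right_inverse hd0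
  rw [hχκ] at hinv hanal hright
  refine ⟨hs.localInverse _ _ _ hd0, hanal, hκ', ?_, ?_⟩
  · rw [hinv.hasDerivAt.deriv, hχ', inv_neg, ← Complex.ofReal_inv, ← Real.sqrt_inv, inv_div]
  · have hcont : Tendsto (hs.localInverse _ _ _ hd0) (𝓝 0) (𝓝 (κ : ℂ)) := by
      have := hinv.hasDerivAt.continuousAt
      rwa [ContinuousAt, hκ'] at this
    filter_upwards [hright, hcont.eventually hr2] with s hs1 hs2
    set w := hs.localInverse _ _ _ hd0 s
    have h1 : G w = (w - κ) ^ 2 * q w := hGq w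
    have h2 : s ^ 2 = (κ - w) ^ 2 * (q w / (κ - lam : ℝ)) := by
      rw [← hs2, ← mul_pow]
      exact congrArg (· ^ 2) hs1.symm
    have h3 : (κ - lam : ℝ) * s ^ 2 = G w := by
      rw [h1, h2]
      field_simp
      ring
    simp only [G] at h3
    linear_combination h3

/-- In a sector, the local parametrization takes values in the disk of radius `κ`. -/
lemma eventually_norm_lt_of_sector (h : InversionData L κ lam d) {ω : ℂ → ℂ}
    (hω : AnalyticAt ℂ ω 0) (h0 : ω 0 = κ) {β : ℝ} (hβ : 0 < β) (hd : deriv ω 0 = -(β : ℝ))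
    {δ : ℝ} (hδ : 0 < δ) : ∀ᶠ s : ℂ in 𝓝 0, s ≠ 0 → δ * ‖s‖ ≤ s.re → ‖ω s‖ < κ := by
  have hκ := h.pos
  have hder := hω.differentiableAt.hasDerivAt.isLittleO
  -- In `ω s = κ - β s + e`, the inward displacement is at least `β * δ * ‖s‖`. Allowing the error
  -- `e` half of it leaves `‖ω s‖ ^ 2 ≤ κ ^ 2 - κ * β * δ * ‖s‖ + O(‖s‖ ^ 2)`.
  have hη : 0 < β * δ / 2 := by positivity
  have hlim : Tendsto (fun s : ℂ => (β + β * δ / 2) ^ 2 * ‖s‖) (𝓝 0) (𝓝 0) := by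
    have : Tendsto (fun s : ℂ => (β + β * δ / 2) ^ 2 * ‖s‖) (𝓝 0)
        (𝓝 ((β + β * δ / 2) ^ 2 * ‖(0 : ℂ)‖)) := by
      exact (continuous_const.mul continuous_norm).tendsto 0
    simpa using this
  have hpos : 0 < κ * (β * δ) := by positivity
  filter_upwards [hder.def hη, hlim.eventually (gt_mem_nhds hpos)] with s hs hs2 hs0 hre
  have hs0' : 0 < ‖s‖ := norm_pos_iff.2 hs0
  rw [h0, hd, smul_eq_mul, sub_zero] at hs
  set e : ℂ := ω s - κ - s * -(β : ℝ) with he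
  have hω' : ω s = κ + (e - β * s) := by rw [he]; ring
  have hre' : e.re ≤ β * δ / 2 * ‖s‖ := (Complex.re_le_norm e).trans hs
  have hn : ‖e - β * s‖ ≤ (β + β * δ / 2) * ‖s‖ := by
    refine (norm_sub_le _ _).trans ?_
    rw [norm_mul, Complex.norm_real, Real.norm_eq_abs, abs_of_pos hβ]
    linarith
  have hsq : ‖ω s‖ ^ 2 = κ ^ 2 + 2 * κ * (e.re - β * s.re) + ‖e - β * s‖ ^ 2 := by
    rw [hω', ← Complex.normSq_eq_norm_sq, ← Complex.normSq_eq_norm_sq, Complex.normSq_apply,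
      Complex.normSq_apply]
    simp
    ring
  have hn2 : ‖e - β * s‖ ^ 2 ≤ ((β + β * δ / 2) * ‖s‖) ^ 2 :=
    pow_le_pow_left₀ (norm_nonneg _) hn 2
  have h3 : β * (δ * ‖s‖) ≤ β * s.re := mul_le_mul_of_nonneg_left hre hβ.le
  have h4 : ‖ω s‖ ^ 2 < κ ^ 2 := by
    rw [hsq]
    have h5 : 2 * κ * (e.re - β * s.re) ≤ 2 * κ * (-(β * δ / 2 * ‖s‖)) :=
      mul_le_mul_of_nonneg_left (by linarith) (by linarith)
    have h6 : ((β + β * δ / 2) * ‖s‖) ^ 2 = ((β + β * δ / 2) ^ 2 * ‖s‖) * ‖s‖ := by ring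
    have h7 : ((β + β * δ / 2) ^ 2 * ‖s‖) * ‖s‖ < κ * (β * δ) * ‖s‖ :=
      mul_lt_mul_of_pos_right hs2 hs0'
    linarith
  exact lt_of_pow_lt_pow_left₀ 2 hκ.le h4

end InversionData

/-! ### The principal square root near a branch point -/

section SquareRoot

open Filter Asymptotics

lemma Complex.cpow_half_sq (u : ℂ) : (u ^ (1 / 2 : ℂ)) ^ 2 = u := by
  rw [one_div]
  exact Complex.cpow_ofNat_inv_pow u 2

/-- The principal square root halves the argument. For `θ < π` the cosine is positive, so a slit
neighbourhood of `0` is sent into a cone of the right half-plane. -/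
lemma Complex.norm_mul_cos_le_re_cpow_half {u : ℂ} {θ : ℝ} (hθ : θ ≤ 2 * Real.pi)
    (hu : |u.arg| ≤ θ) : Real.cos (θ / 2) * ‖u ^ (1 / 2 : ℂ)‖ ≤ (u ^ (1 / 2 : ℂ)).re := by
  by_cases h0 : u = 0
  · simp [h0]
  · have hlog : Complex.log u * (1 / 2) = ⟨Real.log ‖u‖ / 2, u.arg / 2⟩ := by
      apply Complex.ext <;> simp [Complex.log_re, Complex.log_im] <;> ring
    rw [Complex.cpow_def_of_ne_zero h0, hlog, Complex.norm_exp, Complex.exp_re, mul_comm]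
    refine mul_le_mul_of_nonneg_left ?_ (Real.exp_pos _).le
    simp only
    rw [← Real.cos_abs (u.arg / 2)]
    refine Real.cos_le_cos_of_nonneg_of_le_pi (abs_nonneg _) (by linarith) ?_
    rw [abs_div, abs_two]
    linarith

lemma tendsto_sqrt_one_sub_div {R : ℝ} (hR : 0 < R) :
    Tendsto (fun z : ℂ => (1 - z / R) ^ (1 / 2 : ℂ)) (𝓝 (R : ℂ)) (𝓝 0) := by
  have hRc : (R : ℂ) ≠ 0 := by exact_mod_cast hR.ne'
  have h1 : Tendsto (fun z : ℂ => √‖1 - z / R‖) (𝓝 (R : ℂ)) (𝓝 0) := by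
    have : Continuous fun z : ℂ => √‖1 - z / R‖ := by fun_prop
    have h := this.tendsto (R : ℂ)
    simpa [div_self hRc] using h
  refine tendsto_zero_iff_norm_tendsto_zero.2 (h1.congr fun z => ?_)
  rw [Real.sqrt_eq_iff_mul_self_eq (norm_nonneg _) (norm_nonneg _), ← norm_mul, ← sq,
    Complex.cpow_half_sq]

end SquareRoot

/-! ### Continuation to a `Δ`-domain and singular expansions -/

namespace InversionData

open Metric Filter Asymptotics

variable {L : ℂ → ℂ} {κ lam d : ℝ}

/-- In the sector, `ω s` is a preimage of `z` lying in the disk, so it is the only one. Any angle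
strictly between `π / 2` and `π` would do in place of `3 * π / 4`; the bound below `π` keeps `s` in
a cone of the right half-plane. -/
lemma eventually_inverse_eq_param (h : InversionData L κ lam d) : ∃ ω : ℂ → ℂ, AnalyticAt ℂ ω 0 ∧
    ω 0 = κ ∧ deriv ω 0 = -(√(2 * (κ - lam) / d) : ℝ) ∧
    (∀ᶠ s in 𝓝 0, ω s - L (ω s) = (κ - lam : ℝ) * (1 - s ^ 2)) ∧
    ∀ᶠ z : ℂ in 𝓝 ((κ - lam : ℝ) : ℂ), z ≠ (κ - lam : ℝ) →
      |(1 - z / (κ - lam : ℝ)).arg| < 3 * Real.pi / 4 →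
      z ∈ (fun w => w - L w) '' ball 0 κ ∧
        h.inverse z = ω ((1 - z / (κ - lam : ℝ)) ^ (1 / 2 : ℂ)) := by
  obtain ⟨ω, hω, h0, hd, heq⟩ := h.exists_local_param
  refine ⟨ω, hω, h0, hd, heq, ?_⟩
  have hR : 0 < κ - lam := sub_pos.2 h.lam_lt
  have hRc : ((κ - lam : ℝ) : ℂ) ≠ 0 := by exact_mod_cast hR.ne'
  have hβ : 0 < √(2 * (κ - lam) / d) := Real.sqrt_pos.2 (div_pos (by linarith) h.d_pos)
  have hδ : 0 < Real.cos (3 * Real.pi / 4 / 2) :=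
    Real.cos_pos_of_mem_Ioo ⟨by linarith [Real.pi_pos], by linarith [Real.pi_pos]⟩
  have hlim := tendsto_sqrt_one_sub_div hR
  filter_upwards [hlim.eventually heq,
    hlim.eventually (h.eventually_norm_lt_of_sector hω h0 hβ hd hδ)] with z hz1 hz2 hz0 harg
  set s := (1 - z / (κ - lam : ℝ)) ^ (1 / 2 : ℂ) with hs
  have hs2 : s ^ 2 = 1 - z / (κ - lam : ℝ) := Complex.cpow_half_sq _
  have hs0 : s ≠ 0 := by
    intro hs0
    rw [hs0, zero_pow two_ne_zero, eq_comm, sub_eq_zero, eq_div_iff hRc, one_mul] at hs2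
    exact hz0 hs2.symm
  have hlt := hz2 hs0 (Complex.norm_mul_cos_le_re_cpow_half (by linarith [Real.pi_pos]) harg.le)
  have hval : ω s - L (ω s) = z := by
    rw [hz1, hs2]
    field_simp
    ring
  exact ⟨⟨ω s, mem_ball_zero_iff.2 hlt, hval⟩, h.inverse_eq hlt hval⟩

/-- The inverse extends to a `Δ`-domain. -/
lemma exists_deltaDomain (h : InversionData L κ lam d) : ∃ D : Set ℂ,
    IsDeltaDomain ((κ - lam : ℝ) : ℂ) D ∧ D ⊆ (fun w => w - L w) '' ball 0 κ ∧
    (∀ z : ℂ, ‖z‖ ≤ κ - lam → z ≠ (κ - lam : ℝ) → z ∈ D) ∧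
    ∀ z ∈ D, z ≠ (κ - lam : ℝ) ∧ |(1 - z / (κ - lam : ℝ)).arg| < 3 * Real.pi / 4 := by
  have hR : 0 < κ - lam := sub_pos.2 h.lam_lt
  have hRc : ((κ - lam : ℝ) : ℂ) ≠ 0 := by exact_mod_cast hR.ne'
  obtain ⟨ω, -, -, -, -, hnear⟩ := h.eventually_inverse_eq_param
  obtain ⟨ε, hε, hεz⟩ := Metric.eventually_nhds_iff.1 hnear
  generalize hRR : κ - lam = R at *
  -- Away from `R`, the closed disk is a compact subset of the open image, so a whole
  -- `δ`-neighbourhood of it is in the image. Near `R` the sector is handled by `hnear`.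
  have hK : IsCompact (closedBall (0 : ℂ) R \ ball (R : ℂ) (ε / 2)) :=
    (isCompact_closedBall _ _).diff isOpen_ball
  have hKU : closedBall (0 : ℂ) R \ ball (R : ℂ) (ε / 2) ⊆ (fun w => w - L w) '' ball 0 κ := by
    rintro z ⟨hz, hz'⟩
    refine h.closedBall_subset_image (by rw [hRR]; exact mem_closedBall_zero_iff.1 hz) ?_
    rw [hRR]
    rintro rfl
    exact hz' (mem_ball_self (half_pos hε))
  obtain ⟨δ, hδ, hδU⟩ := hK.exists_thickening_subset_open h.isOpen_image hKU
  let η := min (ε / 2) (δ / 2)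
  have hη : 0 < η := lt_min (half_pos hε) (half_pos hδ)
  have hmem : ∀ z : ℂ, z ∈ (fun z : ℂ => z * R) '' {z : ℂ | ‖z‖ ≤ 1 + η / R ∧ z ≠ 1 ∧
      |Complex.arg (1 - z)| < 3 * Real.pi / 4} ↔
      ‖z‖ ≤ R + η ∧ z ≠ R ∧ |(1 - z / R).arg| < 3 * Real.pi / 4 := by
    intro z
    have h1 : ‖z / R‖ ≤ 1 + η / R ↔ ‖z‖ ≤ R + η := by
      rw [norm_div, Complex.norm_real, Real.norm_eq_abs, abs_of_pos hR, div_le_iff₀ hR, add_mul,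
        div_mul_cancel₀ _ hR.ne', one_mul]
    have h2 : z / R ≠ 1 ↔ z ≠ R := by rw [ne_eq, div_eq_one_iff_eq hRc]
    rw [← h1, ← h2]
    constructor
    · rintro ⟨w, hw, rfl⟩
      simp only [mul_div_cancel_right₀ _ hRc]
      exact hw
    · intro hz
      exact ⟨z / R, hz, div_mul_cancel₀ _ hRc⟩
  refine ⟨_, ⟨1 + η / R, 3 * Real.pi / 4, by linarith [div_pos hη hR], by linarith [Real.pi_pos],
    by linarith [Real.pi_pos], rfl⟩, fun z hz => ?_, fun z hz hzR => ?_, fun z hz => ?_⟩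
  · obtain ⟨hz1, hz2, hz3⟩ := (hmem z).1 hz
    by_cases hzε : dist z R < ε
    · exact (hεz hzε hz2 hz3).1
    · by_cases hzn : ‖z‖ ≤ R
      · refine hKU ⟨mem_closedBall_zero_iff.2 hzn, fun hb => hzε ?_⟩
        exact (mem_ball.1 hb).trans (by linarith)
      · have hz0 : 0 < ‖z‖ := hR.trans (not_le.1 hzn)
        have hz0' : (‖z‖ : ℂ) ≠ 0 := by exact_mod_cast hz0.ne'
        -- The radial projection of `z` to the circle of radius `R`; it moves `z` by `‖z‖ - R ≤ η`.
        let z' : ℂ := z * ((R / ‖z‖ : ℝ) : ℂ)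
        have hz'n : ‖z'‖ = R := by
          simp only [z']
          rw [norm_mul, Complex.norm_real, Real.norm_eq_abs, abs_of_pos (div_pos hR hz0)]
          field_simp
        have hdist : dist z z' ≤ η := by
          have : z - z' = z * ((1 - R / ‖z‖ : ℝ) : ℂ) := by simp only [z']; push_cast; ring
          rw [dist_eq_norm, this, norm_mul, Complex.norm_real, Real.norm_eq_abs, abs_of_nonneg]
          · rw [mul_sub, mul_one, mul_div_cancel₀ _ hz0.ne']
            linarith
          · rw [sub_nonneg, div_le_one hz0]
            exact (not_le.1 hzn).le
        refine hδU (mem_thickening_iff.2 ⟨z', ⟨mem_closedBall_zero_iff.2 hz'n.le, fun hb => hzε ?_⟩,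
          hdist.trans_lt ((min_le_right _ _).trans_lt (by linarith))⟩)
        have h1 := dist_triangle z z' R
        have h2 : η ≤ ε / 2 := min_le_left _ _
        have h3 := mem_ball.1 hb
        linarith
  · refine (hmem z).2 ⟨by linarith, hzR, ?_⟩
    -- On the closed disk `1 - z / R` lies in the right half-plane, so its argument is at most `π /
    -- 2`.
    have hre : 0 ≤ (1 - z / R).re := by
      rw [Complex.sub_re, Complex.one_re, sub_nonneg, Complex.div_ofReal_re, div_le_one hR]
      exact (Complex.re_le_norm z).trans hz
    have := Complex.abs_arg_le_pi_div_two_iff.2 hre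
    linarith [Real.pi_pos]
  · exact ((hmem z).1 hz).2

/-- `v ∘ ω` is analytic in `s`, and the remainder `O(s ^ 2)` of its first-order expansion is `O(1 -
z / R)`. -/
lemma isBigO_comp_inverse (h : InversionData L κ lam d) {D : Set ℂ}
    (hD : ∀ z ∈ D, z ≠ (κ - lam : ℝ) ∧ |(1 - z / (κ - lam : ℝ)).arg| < 3 * Real.pi / 4)
    {v : ℂ → ℂ} (hv : AnalyticAt ℂ v κ) :
    (fun z => v (h.inverse z) - (v κ - deriv v κ * (√(2 * (κ - lam) / d) : ℝ) *
      (1 - z / (κ - lam : ℝ)) ^ (1 / 2 : ℂ))) =O[𝓝[D] ((κ - lam : ℝ) : ℂ)]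
        fun z => 1 - z / (κ - lam : ℝ) := by
  obtain ⟨ω, hω, h0, hd, heq, hnear⟩ := h.eventually_inverse_eq_param
  have hR : 0 < κ - lam := sub_pos.2 h.lam_lt
  have hv' : AnalyticAt ℂ v (ω 0) := by rwa [h0]
  have hvω : AnalyticAt ℂ (v ∘ ω) 0 := hv'.comp hω
  have hder : deriv (v ∘ ω) 0 = -(deriv v κ * (√(2 * (κ - lam) / d) : ℝ)) := by
    rw [deriv_comp 0 hv'.differentiableAt hω.differentiableAt, h0, hd]
    ring
  have h1 := (hvω.isBigO_sub_sub_deriv_mul.comp_tendsto (tendsto_sqrt_one_sub_div hR)).mono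
    (nhdsWithin_le_nhds (s := D))
  refine h1.congr' ?_ ?_
  · filter_upwards [nhdsWithin_le_nhds hnear, self_mem_nhdsWithin] with z hz hzD
    rw [(hz (hD z hzD).1 (hD z hzD).2).2]
    simp only [Function.comp_apply, h0] at hder ⊢
    rw [hder]
    ring
  · exact Eventually.of_forall fun z => Complex.cpow_half_sq _

/-- The expansion of the inverse is not differentiated. Instead its derivative is computed exactly
as `-deriv ω s / (2 * R * s)` with `R = κ - lam`, and `deriv ω s = deriv ω 0 + O(s)`, so the error
is bounded. -/
lemma isBigO_deriv_inverse (h : InversionData L κ lam d) {D : Set ℂ}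
    (hD : ∀ z ∈ D, z ≠ (κ - lam : ℝ) ∧ |(1 - z / (κ - lam : ℝ)).arg| < 3 * Real.pi / 4) :
    (fun z => deriv h.inverse z - (1 / √(2 * (κ - lam) * d) : ℝ) *
      (1 - z / (κ - lam : ℝ)) ^ (-1 / 2 : ℂ)) =O[𝓝[D] ((κ - lam : ℝ) : ℂ)]
        fun _ => (1 : ℂ) := by
  obtain ⟨ω, hω, h0, hd, heq, hnear⟩ := h.eventually_inverse_eq_param
  have hR : 0 < κ - lam := sub_pos.2 h.lam_lt
  have hRc : ((κ - lam : ℝ) : ℂ) ≠ 0 := by exact_mod_cast hR.ne'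
  have hlim := tendsto_sqrt_one_sub_div hR
  have hμ : √(2 * (κ - lam) / d) / (2 * (κ - lam)) = 1 / √(2 * (κ - lam) * d) := by
    have h2R : (0 : ℝ) ≤ 2 * (κ - lam) := by linarith
    have hd0 := h.d_pos
    rw [Real.sqrt_div h2R, Real.sqrt_mul h2R]
    have h1 : √(2 * (κ - lam)) ≠ 0 := (Real.sqrt_pos.2 (by linarith)).ne'
    have h2 : √d ≠ 0 := (Real.sqrt_pos.2 hd0).ne'
    have h3 : √(2 * (κ - lam)) * √(2 * (κ - lam)) = 2 * (κ - lam) := Real.mul_self_sqrt h2R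
    rw [div_div, div_eq_div_iff (by positivity) (by positivity)]
    linear_combination √d * h3
  have h1 : (fun s => deriv ω s - deriv ω 0) =O[𝓝 0] fun s : ℂ => s - 0 :=
    hω.deriv.differentiableAt.isBigO_sub
  have h1' := (h1.comp_tendsto hlim).mono (nhdsWithin_le_nhds (s := D))
  have h2 := h1'.mul (isBigO_refl (fun z : ℂ => -1 / (2 * (κ - lam : ℝ) *
    (1 - z / (κ - lam : ℝ)) ^ (1 / 2 : ℂ))) (𝓝[D] ((κ - lam : ℝ) : ℂ)))
  have hs0 : ∀ z : ℂ, z ≠ (κ - lam : ℝ) → (1 - z / (κ - lam : ℝ)) ^ (1 / 2 : ℂ) ≠ 0 := by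
    intro z hz hs0
    have hs2 := Complex.cpow_half_sq (1 - z / (κ - lam : ℝ))
    rw [hs0, zero_pow two_ne_zero, eq_comm, sub_eq_zero, eq_div_iff hRc, one_mul] at hs2
    exact hz hs2.symm
  -- The derivative in `s` of the identity `ω s - L (ω s) = R * (1 - s ^ 2)`.
  have hdω : ∀ᶠ s in 𝓝 (0 : ℂ),
      (1 - deriv L (ω s)) * deriv ω s = (κ - lam : ℝ) * (-(2 * s)) := by
    have hκ : ‖ω 0‖ ≤ κ := by rw [h0]; simp [abs_of_pos h.pos]
    have hLa : AnalyticAt ℂ L (ω 0) := h.analytic _ (mem_closedBall_zero_iff.2 hκ)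
    filter_upwards [heq.eventually_nhds, hω.eventually_analyticAt,
      hω.continuousAt.eventually hLa.eventually_analyticAt] with s hs1 hs2 hs3
    have e1 := hs2.differentiableAt.hasDerivAt
    have e2 := (hasDerivAt_id (ω s)).sub hs3.differentiableAt.hasDerivAt
    have e3 := e2.comp s e1
    have e4 := ((hasDerivAt_pow 2 s).const_sub 1).const_mul ((κ - lam : ℝ) : ℂ)
    have e5 := e3.unique (e4.congr_of_eventuallyEq hs1)
    rw [e5]
    simp
  refine (h2.congr' ?_ ?_).trans (isBigO_const_const (-1 / (2 * (κ - lam : ℝ)) : ℂ)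
    one_ne_zero _)
  · filter_upwards [nhdsWithin_le_nhds hnear, self_mem_nhdsWithin,
      nhdsWithin_le_nhds (hlim.eventually hdω)] with z hz hzD hz3
    obtain ⟨hzU, hzω⟩ := hz (hD z hzD).1 (hD z hzD).2
    have hs := hs0 z (hD z hzD).1
    have hinv := h.deriv_inverse hzU
    have hhalf : (1 - z / (κ - lam : ℝ)) ^ (-1 / 2 : ℂ) =
        ((1 - z / (κ - lam : ℝ)) ^ (1 / 2 : ℂ))⁻¹ := by
      rw [← Complex.cpow_neg]
      congr 1
      ring
    rw [hzω] at hinv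
    rw [hhalf, ← hμ]
    simp only [Function.comp_apply, hd]
    generalize (1 - z / (κ - lam : ℝ)) ^ (1 / 2 : ℂ) = s at *
    have hval : deriv h.inverse z = -deriv ω s / (2 * (κ - lam : ℝ) * s) := by
      rw [eq_div_iff (by simp [hs]; exact_mod_cast hR.ne')]
      have hne : (1 - deriv L (ω s)) ≠ 0 := fun h0 => by
        rw [h0, mul_zero] at hinv
        exact zero_ne_one hinv
      refine mul_left_cancel₀ hne ?_
      linear_combination 2 * (κ - lam : ℝ) * s * hinv + hz3
    rw [hval]
    generalize √(2 * (κ - lam) / d) = β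
    push_cast at hRc ⊢
    field_simp
    ring
  · filter_upwards [self_mem_nhdsWithin] with z hzD
    have hs := hs0 z (hD z hzD).1
    simp only [Function.comp_apply, sub_zero]
    generalize (1 - z / (κ - lam : ℝ)) ^ (1 / 2 : ℂ) = s at *
    field_simp

/-- The derivative of the inverse is unbounded at `R = κ - L κ`. -/
lemma not_eventually_deriv_inverse_eq (h : InversionData L κ lam d) {g : ℂ → ℂ}
    (hg : ContinuousAt g ((κ - lam : ℝ) : ℂ)) :
    ¬ ∀ᶠ z in 𝓝[ball 0 (κ - lam)] ((κ - lam : ℝ) : ℂ), deriv h.inverse z = g z := by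
  intro hev
  have hR : 0 < κ - lam := sub_pos.2 h.lam_lt
  have hRc : ((κ - lam : ℝ) : ℂ) ≠ 0 := by exact_mod_cast hR.ne'
  obtain ⟨D, -, -, hsub, hD⟩ := h.exists_deltaDomain
  have hne : ∀ z ∈ ball (0 : ℂ) (κ - lam), z ≠ (κ - lam : ℝ) := by
    rintro z hz rfl
    rw [mem_ball_zero_iff, Complex.norm_real, Real.norm_eq_abs, abs_of_pos hR] at hz
    exact lt_irrefl _ hz
  have hbD : ball (0 : ℂ) (κ - lam) ⊆ D := fun z hz =>
    hsub z (mem_ball_zero_iff.1 hz).le (hne z hz)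
  have hbot : (𝓝[ball 0 (κ - lam)] ((κ - lam : ℝ) : ℂ)).NeBot := by
    rw [← mem_closure_iff_nhdsWithin_neBot, closure_ball _ hR.ne', mem_closedBall_zero_iff,
      Complex.norm_real, Real.norm_eq_abs, abs_of_pos hR]
  have hlim := (tendsto_sqrt_one_sub_div hR).mono_left
    (nhdsWithin_le_nhds (s := ball 0 (κ - lam)))
  have h1 := (h.isBigO_deriv_inverse hD).mono (nhdsWithin_mono _ hbD)
  have h2 : g =O[𝓝[ball 0 (κ - lam)] ((κ - lam : ℝ) : ℂ)] fun _ => (1 : ℂ) :=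
    (hg.isBigO_one ℂ).mono nhdsWithin_le_nhds
  have h3 := (h2.congr' (hev.mono fun z hz => hz.symm) EventuallyEq.rfl).sub h1
  -- Multiplying by `s → 0` would make the nonzero constant `1 / √(2 * R * d)`, with `R = κ - lam`,
  -- tend to `0`.
  have h4 := (isBigO_refl (fun z : ℂ => (1 - z / (κ - lam : ℝ)) ^ (1 / 2 : ℂ))
    (𝓝[ball 0 (κ - lam)] ((κ - lam : ℝ) : ℂ))).mul h3
  simp only [mul_one, sub_sub_cancel] at h4
  have h5 := h4.trans_tendsto hlim
  have hμ : 0 < 1 / √(2 * (κ - lam) * d) :=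
    one_div_pos.2 (Real.sqrt_pos.2 (mul_pos (by linarith) h.d_pos))
  have h6 : Tendsto (fun _ : ℂ => ((1 / √(2 * (κ - lam) * d) : ℝ) : ℂ))
      (𝓝[ball 0 (κ - lam)] ((κ - lam : ℝ) : ℂ)) (𝓝 0) := by
    refine h5.congr' ?_
    filter_upwards [self_mem_nhdsWithin] with z hz
    have hu : 1 - z / (κ - lam : ℝ) ≠ 0 := by
      rw [sub_ne_zero, ne_comm, ne_eq, div_eq_one_iff_eq hRc]
      exact hne z hz
    have hhalf : (1 - z / (κ - lam : ℝ)) ^ (-1 / 2 : ℂ) =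
        ((1 - z / (κ - lam : ℝ)) ^ (1 / 2 : ℂ))⁻¹ := by
      rw [← Complex.cpow_neg]
      congr 1
      ring
    have hs : (1 - z / (κ - lam : ℝ)) ^ (1 / 2 : ℂ) ≠ 0 := fun h0 =>
      hu ((Complex.cpow_eq_zero_iff _ _).1 h0).1
    rw [hhalf, mul_left_comm, mul_inv_cancel₀ hs, mul_one]
  have h7 := tendsto_nhds_unique h6 tendsto_const_nhds
  exact hμ.ne (by exact_mod_cast h7)

end InversionData

/-! ### Sums of exponential generating functions -/

section EgfSums

variable {a : ℕ → ℕ} {f : ℂ → ℂ} {r : ℝ≥0∞}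

lemma hasSum_egf (hf : HasFPowerSeriesOnBall f (egf ℂ a) 0 r) {z : ℂ} (hz : ‖z‖ₑ < r) :
    HasSum (fun n => (a n : ℂ) / (n ! : ℂ) * z ^ n) (f z) := by
  have h := hf.hasSum (y := z) (by rwa [Metric.mem_eball, edist_zero_right])
  rw [zero_add] at h
  refine h.congr_fun fun n => ?_
  rw [egf, FormalMultilinearSeries.ofScalars_apply_eq, smul_eq_mul]

lemma hasSum_egf_re (hf : HasFPowerSeriesOnBall f (egf ℂ a) 0 r) {x : ℝ} (hx : ‖x‖ₑ < r) :
    HasSum (fun n => (a n : ℝ) / (n ! : ℝ) * x ^ n) (f x).re := by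
  have h := Complex.hasSum_re (hasSum_egf hf (z := x) (by
    rwa [← enorm_norm, Complex.norm_real, enorm_norm]))
  refine h.congr_fun fun n => ?_
  rw [← Complex.ofReal_re ((a n : ℝ) / (n ! : ℝ) * x ^ n)]
  push_cast
  rfl

lemma ofReal_re_egf (hf : HasFPowerSeriesOnBall f (egf ℂ a) 0 r) {x : ℝ} (hx : ‖x‖ₑ < r) :
    (((f x).re : ℝ) : ℂ) = f x := by
  have h := hasSum_egf hf (z := x) (by rwa [← enorm_norm, Complex.norm_real, enorm_norm])
  rw [← (hasSum_egf_re hf hx).tsum_eq, ← h.tsum_eq, Complex.ofReal_tsum]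
  exact tsum_congr fun n => by push_cast; rfl

lemma enorm_norm_lt {z : ℂ} (hz : ‖z‖ₑ < r) : ‖(‖z‖ : ℝ)‖ₑ < r := by rwa [enorm_norm]

lemma norm_le_re_of_egf (hf : HasFPowerSeriesOnBall f (egf ℂ a) 0 r) {z : ℂ} (hz : ‖z‖ₑ < r) :
    ‖f z‖ ≤ (f (‖z‖ : ℝ)).re := by
  have h1 := hasSum_egf hf hz
  have h2 := hasSum_egf_re hf (enorm_norm_lt hz)
  rw [← h1.tsum_eq, ← h2.tsum_eq]
  refine (norm_tsum_le_tsum_norm ?_).trans (le_of_eq ?_)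
  · refine h2.summable.congr fun n => ?_
    simp
  · refine tsum_congr fun n => ?_
    simp

lemma re_egf_nonneg (hf : HasFPowerSeriesOnBall f (egf ℂ a) 0 r) {x : ℝ} (hx0 : 0 ≤ x)
    (hx : ‖x‖ₑ < r) : 0 ≤ (f x).re :=
  (hasSum_egf_re hf hx).nonneg fun n => by positivity

lemma re_egf_mono (hf : HasFPowerSeriesOnBall f (egf ℂ a) 0 r) {x y : ℝ} (hx0 : 0 ≤ x)
    (hxy : x ≤ y) (hy : ‖y‖ₑ < r) : (f x).re ≤ (f y).re := by
  have hx : ‖x‖ₑ < r := by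
    refine lt_of_le_of_lt ?_ hy
    rw [enorm_le_iff_norm_le, Real.norm_of_nonneg hx0, Real.norm_of_nonneg (hx0.trans hxy)]
    exact hxy
  refine hasSum_le (fun n => ?_) (hasSum_egf_re hf hx) (hasSum_egf_re hf hy)
  gcongr

lemma hasFPowerSeriesOnBall_deriv_egf (hf : HasFPowerSeriesOnBall f (egf ℂ a) 0 r) :
    HasFPowerSeriesOnBall (deriv f) (egf ℂ fun n => a (n + 1)) 0 r := by
  refine hasFPowerSeriesOnBall_egf hf.r_pos
    (hf.differentiableOn.deriv Metric.isOpen_eball) ?_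
  rw [taylorSeries_deriv, taylorSeries_of_hasFPowerSeriesAt hf.hasFPowerSeriesAt,
    derivative_egfSeries]

/-- Condition (C) concerns the real series `P`, while the inversion takes place in the complex
plane. -/
lemma radius_egf_complex (a : ℕ → ℕ) : (egf ℂ a).radius = (egf ℝ a).radius := by
  have h : ∀ n, ‖egf ℂ a n‖ = ‖egf ℝ a n‖ := fun n => by
    rw [egf, egf, FormalMultilinearSeries.ofScalars_norm, FormalMultilinearSeries.ofScalars_norm]
    simp
  simp only [FormalMultilinearSeries.radius, h]

lemma ofReal_sum_egf (a : ℕ → ℕ) (x : ℝ) : (((egf ℝ a).sum x : ℝ) : ℂ) = (egf ℂ a).sum x := by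
  rw [FormalMultilinearSeries.sum, FormalMultilinearSeries.sum, Complex.ofReal_tsum]
  refine tsum_congr fun n => ?_
  rw [egf, egf, FormalMultilinearSeries.ofScalars_apply_eq,
    FormalMultilinearSeries.ofScalars_apply_eq]
  simp

end EgfSums

/-! ### The function `Λ` on the complex plane -/

section Lambda

open Metric Filter

/-- Monotonicity of the exponential from `EReal` to `ℝ≥0∞` covers finite and infinite radii alike.
-/
lemma lt_radiusLam_iff (P : GraphSet) {x : ℝ} (hx : 0 ≤ x) :
    (x : EReal) < radiusLam P ↔ ‖Real.exp x - 1‖ₑ < (seriesP P).radius := by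
  have h1 : 0 ≤ Real.exp x - 1 := by linarith [Real.add_one_le_exp x]
  rw [radiusLam, ← EReal.exp_lt_exp_iff, ENNReal.exp_log, EReal.exp_coe,
    show Real.exp x = 1 + (Real.exp x - 1) by ring, ENNReal.ofReal_add zero_le_one h1,
    ENNReal.ofReal_one, ENNReal.add_lt_add_iff_left ENNReal.one_ne_top, add_sub_cancel_left,
    Real.enorm_of_nonneg h1]

/-- The series `P` as a function on the complex plane. -/
noncomputable def graphSum (P : GraphSet) : ℂ → ℂ := (egf ℂ fun n => (P n).ncard).sum

/-- The function `Λ` on the complex plane. -/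
noncomputable def LamC (P : GraphSet) (w : ℂ) : ℂ :=
  graphSum P (Complex.exp w - 1) + Complex.exp w - 1 - w

lemma ofReal_Lam (P : GraphSet) (x : ℝ) : ((Lam P x : ℝ) : ℂ) = LamC P x := by
  rw [Lam, LamC, graphSum, seriesP]
  push_cast
  rw [ofReal_sum_egf]
  push_cast
  rfl

variable {P : GraphSet}

lemma hasFPowerSeriesOnBall_graphSum (hR : 0 < (seriesP P).radius) :
    HasFPowerSeriesOnBall (graphSum P) (egf ℂ fun n => (P n).ncard) 0 (seriesP P).radius := by
  rw [seriesP, ← radius_egf_complex] at hR ⊢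
  exact FormalMultilinearSeries.hasFPowerSeriesOnBall _ hR

lemma norm_exp_sub_one_le (w : ℂ) : ‖Complex.exp w - 1‖ ≤ Real.exp ‖w‖ - 1 := by
  simpa using Complex.norm_exp_sub_sum_le_exp_norm_sub_sum w 1

lemma exp_sub_one_nonneg {x : ℝ} (hx : 0 ≤ x) : 0 ≤ Real.exp x - 1 := by
  linarith [Real.add_one_le_exp x]

lemma enorm_exp_sub_one_lt {w : ℂ} {x : ℝ} (hwx : ‖w‖ ≤ x) (hx : (x : EReal) < radiusLam P) :
    ‖Complex.exp w - 1‖ₑ < (seriesP P).radius := by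
  have hx0 : 0 ≤ x := (norm_nonneg w).trans hwx
  refine lt_of_le_of_lt ?_ ((lt_radiusLam_iff P hx0).1 hx)
  rw [enorm_le_iff_norm_le, Real.norm_of_nonneg (exp_sub_one_nonneg hx0)]
  refine (norm_exp_sub_one_le w).trans ?_
  have := Real.exp_le_exp.2 hwx
  linarith

lemma pos_radius_of_lt_radiusLam {x : ℝ} (hx0 : 0 ≤ x) (hx : (x : EReal) < radiusLam P) :
    0 < (seriesP P).radius :=
  lt_of_le_of_lt bot_le ((lt_radiusLam_iff P hx0).1 hx)

lemma analyticAt_LamC {w : ℂ} {x : ℝ} (hwx : ‖w‖ ≤ x) (hx : (x : EReal) < radiusLam P) :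
    AnalyticAt ℂ (LamC P) w := by
  have hf := hasFPowerSeriesOnBall_graphSum
    (pos_radius_of_lt_radiusLam ((norm_nonneg w).trans hwx) hx)
  have he : AnalyticAt ℂ (fun w => Complex.exp w - 1) w := analyticAt_cexp.sub analyticAt_const
  have hP : AnalyticAt ℂ (graphSum P) (Complex.exp w - 1) := hf.analyticAt_of_mem (by
    rw [Metric.mem_eball, edist_zero_right]; exact enorm_exp_sub_one_lt hwx hx)
  have hc : AnalyticAt ℂ (fun w => graphSum P (Complex.exp w - 1)) w :=
    AnalyticAt.comp (f := fun w => Complex.exp w - 1) hP he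
  exact ((hc.add analyticAt_cexp).sub analyticAt_const).sub analyticAt_id

lemma hasDerivAt_LamC {w : ℂ} {x : ℝ} (hwx : ‖w‖ ≤ x) (hx : (x : EReal) < radiusLam P) :
    HasDerivAt (LamC P) (deriv (graphSum P) (Complex.exp w - 1) * Complex.exp w +
      (Complex.exp w - 1)) w := by
  have hf := hasFPowerSeriesOnBall_graphSum
    (pos_radius_of_lt_radiusLam ((norm_nonneg w).trans hwx) hx)
  have hP : AnalyticAt ℂ (graphSum P) (Complex.exp w - 1) := hf.analyticAt_of_mem (by
    rw [Metric.mem_eball, edist_zero_right]; exact enorm_exp_sub_one_lt hwx hx)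
  have h1 := hP.differentiableAt.hasDerivAt.comp w ((Complex.hasDerivAt_exp w).sub_const 1)
  have h2 := ((h1.add (Complex.hasDerivAt_exp w)).sub_const 1).sub (hasDerivAt_id w)
  exact h2.congr_deriv (by ring)

lemma eventually_lt_radiusLam {x : ℝ} (hx : (x : EReal) < radiusLam P) :
    ∃ y : ℝ, x < y ∧ (y : EReal) < radiusLam P := by
  obtain ⟨y, hxy, hy⟩ := EReal.lt_iff_exists_real_btwn.1 hx
  exact ⟨y, EReal.coe_lt_coe_iff.1 hxy, hy⟩

lemma hasDerivAt_deriv_LamC {w : ℂ} {x : ℝ} (hwx : ‖w‖ ≤ x) (hx : (x : EReal) < radiusLam P) :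
    HasDerivAt (deriv (LamC P)) (deriv (deriv (graphSum P)) (Complex.exp w - 1) *
      Complex.exp w * Complex.exp w + deriv (graphSum P) (Complex.exp w - 1) * Complex.exp w +
      Complex.exp w) w := by
  have hf := hasFPowerSeriesOnBall_deriv_egf (hasFPowerSeriesOnBall_graphSum
    (pos_radius_of_lt_radiusLam ((norm_nonneg w).trans hwx) hx))
  have hP : AnalyticAt ℂ (deriv (graphSum P)) (Complex.exp w - 1) := hf.analyticAt_of_mem (by
    rw [Metric.mem_eball, edist_zero_right]; exact enorm_exp_sub_one_lt hwx hx)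
  have he := (Complex.hasDerivAt_exp w).sub_const 1
  have h1 := (hP.differentiableAt.hasDerivAt.comp w he).mul (Complex.hasDerivAt_exp w)
  have h2 := h1.add he
  obtain ⟨y, hxy, hy⟩ := eventually_lt_radiusLam hx
  refine h2.congr_of_eventuallyEq ?_
  have hmem : ball (0 : ℂ) y ∈ 𝓝 w :=
    isOpen_ball.mem_nhds (mem_ball_zero_iff.2 (hwx.trans_lt hxy))
  filter_upwards [hmem] with v hv
  exact (hasDerivAt_LamC (mem_ball_zero_iff.1 hv).le hy).deriv

lemma hasDerivAt_Lam {x : ℝ} (hx0 : 0 ≤ x) (hx : (x : EReal) < radiusLam P) :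
    HasDerivAt (Lam P) (deriv (LamC P) x).re x := by
  have hn : ‖(x : ℂ)‖ ≤ x := by simp [abs_of_nonneg hx0]
  have h1 := (analyticAt_LamC hn hx).differentiableAt.hasDerivAt.real_of_complex
  refine h1.congr_of_eventuallyEq (Eventually.of_forall fun y => ?_)
  show Lam P y = (LamC P y).re
  rw [← ofReal_Lam, Complex.ofReal_re]

lemma re_deriv_LamC {x : ℝ} (hx0 : 0 ≤ x) (hx : (x : EReal) < radiusLam P) :
    (deriv (LamC P) x).re = (deriv (graphSum P) (Real.exp x - 1 : ℝ)).re * Real.exp x +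
      (Real.exp x - 1) := by
  have hn : ‖(x : ℂ)‖ ≤ x := by simp [abs_of_nonneg hx0]
  rw [(hasDerivAt_LamC hn hx).deriv]
  have : Complex.exp x - 1 = ((Real.exp x - 1 : ℝ) : ℂ) := by push_cast; rfl
  rw [this, ← Complex.ofReal_exp, Complex.add_re, Complex.re_mul_ofReal, Complex.ofReal_re]

/-- In `P'(exp x - 1) * exp x + (exp x - 1)` the first term is nondecreasing, as `P'` has
nonnegative coefficients, and the second is strictly increasing, even when `P` is empty. -/
lemma deriv_Lam_strictMono {x y : ℝ} (hx0 : 0 ≤ x) (hxy : x < y)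
    (hy : (y : EReal) < radiusLam P) : deriv (Lam P) x < deriv (Lam P) y := by
  have hy0 := hx0.trans hxy.le
  have hx : (x : EReal) < radiusLam P := (EReal.coe_lt_coe_iff.2 hxy).trans hy
  have hf := hasFPowerSeriesOnBall_deriv_egf
    (hasFPowerSeriesOnBall_graphSum (pos_radius_of_lt_radiusLam hy0 hy))
  have he := Real.exp_lt_exp.2 hxy
  have hm := re_egf_mono hf (exp_sub_one_nonneg hx0) (by linarith : Real.exp x - 1 ≤ Real.exp y - 1)
    ((lt_radiusLam_iff P hy0).1 hy)
  have hn := re_egf_nonneg hf (exp_sub_one_nonneg hx0) ((lt_radiusLam_iff P hx0).1 hx)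
  rw [(hasDerivAt_Lam hx0 hx).deriv, (hasDerivAt_Lam hy0 hy).deriv, re_deriv_LamC hx0 hx,
    re_deriv_LamC hy0 hy]
  have := mul_le_mul hm he.le (Real.exp_pos x).le (hn.trans hm)
  linarith

lemma norm_deriv_LamC_le {w : ℂ} (hw : ((‖w‖ : ℝ) : EReal) < radiusLam P) :
    ‖deriv (LamC P) w‖ ≤ deriv (Lam P) ‖w‖ := by
  have hf := hasFPowerSeriesOnBall_deriv_egf
    (hasFPowerSeriesOnBall_graphSum (pos_radius_of_lt_radiusLam (norm_nonneg w) hw))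
  rw [(hasDerivAt_Lam (norm_nonneg w) hw).deriv, re_deriv_LamC (norm_nonneg w) hw,
    (hasDerivAt_LamC le_rfl hw).deriv]
  refine (norm_add_le _ _).trans (add_le_add ?_ (norm_exp_sub_one_le w))
  rw [norm_mul]
  have h1 := norm_le_re_of_egf hf (enorm_exp_sub_one_lt le_rfl hw)
  have h2 := re_egf_mono hf (norm_nonneg _) (norm_exp_sub_one_le w)
    ((lt_radiusLam_iff P (norm_nonneg w)).1 hw)
  refine mul_le_mul (h1.trans h2) ?_ (norm_nonneg _) ((norm_nonneg _).trans (h1.trans h2))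
  exact Complex.norm_exp_le_exp_norm w

/-- Aperiodicity: the consecutive powers `w ^ 2` and `w ^ 3` both occur, and `‖3 + w‖ < 3 + x`
unless `w = x`. The terms from degree `4` on only need the triangle inequality. -/
lemma norm_exp_sub_one_sub_lt {w : ℂ} {x : ℝ} (hw : ‖w‖ = x) (hwx : w ≠ x) :
    ‖Complex.exp w - 1 - w‖ < Real.exp x - 1 - x := by
  have h1 := Complex.norm_exp_sub_sum_le_exp_norm_sub_sum w 4
  rw [hw] at h1
  simp only [Finset.sum_range_succ, Finset.sum_range_zero, Nat.factorial] at h1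
  norm_num at h1
  have hx0 : 0 < x := by
    rcases (norm_nonneg w).eq_or_lt with h | h
    · rw [← h] at hw
      rw [← hw] at hwx
      exact absurd (norm_eq_zero.1 h.symm) (by simpa using hwx)
    · rwa [hw] at h
  have hre : w.re < x := by
    refine lt_of_le_of_ne (hw ▸ Complex.re_le_norm w) fun h => hwx ?_
    have hsq : w.re ^ 2 + w.im ^ 2 = x ^ 2 := by
      rw [← hw, ← Complex.normSq_eq_norm_sq, Complex.normSq_apply]; ring
    rw [h] at hsq
    have him : w.im = 0 := by
      have : w.im ^ 2 = 0 := by linarith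
      exact pow_eq_zero_iff two_ne_zero |>.1 this
    exact Complex.ext (by simpa using h) (by simpa using him)
  have h2 : ‖w ^ 2 / 2 + w ^ 3 / 6‖ < x ^ 2 / 2 + x ^ 3 / 6 := by
    have e : w ^ 2 / 2 + w ^ 3 / 6 = w ^ 2 * ((3 + w) / 6) := by ring
    have h3 : ‖3 + w‖ < 3 + x := by
      refine lt_of_pow_lt_pow_left₀ 2 (by linarith) ?_
      have hsq : w.re ^ 2 + w.im ^ 2 = x ^ 2 := by
        rw [← hw, ← Complex.normSq_eq_norm_sq, Complex.normSq_apply]; ring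
      rw [← Complex.normSq_eq_norm_sq, Complex.normSq_apply]
      simp
      nlinarith
    rw [e, norm_mul, norm_pow, norm_div, hw]
    have h6 : ‖(6 : ℂ)‖ = 6 := by norm_num
    rw [h6]
    have : x ^ 2 * (‖3 + w‖ / 6) < x ^ 2 * ((3 + x) / 6) := by gcongr
    linarith
  have h4 : Complex.exp w - 1 - w =
      (Complex.exp w - (1 + w + w ^ 2 / 2 + w ^ 3 / 6)) + (w ^ 2 / 2 + w ^ 3 / 6) := by ring
  rw [h4]
  refine (norm_add_le _ _).trans_lt ?_
  linarith

/-- The part coming from `P` satisfies a weak inequality; strictness comes from the exponential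
part, whatever `P` is. -/
lemma norm_LamC_lt {w : ℂ} {x : ℝ} (hw : ‖w‖ = x) (hwx : w ≠ x) (hx : (x : EReal) < radiusLam P) :
    ‖LamC P w‖ < Lam P x := by
  subst hw
  have hf := hasFPowerSeriesOnBall_graphSum (pos_radius_of_lt_radiusLam (norm_nonneg w) hx)
  have h1 := norm_le_re_of_egf hf (enorm_exp_sub_one_lt le_rfl hx)
  have h2 := re_egf_mono hf (norm_nonneg _) (norm_exp_sub_one_le w)
    ((lt_radiusLam_iff P (norm_nonneg w)).1 hx)
  have h3 : (graphSum P (Real.exp ‖w‖ - 1 : ℝ)).re = (seriesP P).sum (Real.exp ‖w‖ - 1) := by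
    rw [graphSum, ← ofReal_sum_egf, Complex.ofReal_re]
    rfl
  have h4 : LamC P w = graphSum P (Complex.exp w - 1) + (Complex.exp w - 1 - w) := by
    rw [LamC]; ring
  rw [h4, Lam, ← h3]
  have := norm_add_le (graphSum P (Complex.exp w - 1)) (Complex.exp w - 1 - w)
  have := norm_exp_sub_one_sub_lt rfl hwx
  linarith

end Lambda

/-! ### The critical point `κ` -/

section Kappa

open Metric Filter

variable {P : GraphSet}

lemma radiusLam_pos (hR : 0 < (seriesP P).radius) : 0 < radiusLam P := by
  rw [radiusLam, ENNReal.zero_lt_log_iff]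
  exact ENNReal.lt_add_right ENNReal.one_ne_top hR.ne'

lemma ConditionC.exists_one_lt_deriv (hC : ConditionC P) :
    ∃ w : ℝ, 0 < w ∧ (w : EReal) < radiusLam P ∧ 1 < deriv (Lam P) w := by
  obtain ⟨hR, l, hl, hlim⟩ := hC
  have hpos := radiusLam_pos hR
  have hev := hlim.eventually (lt_mem_nhds hl)
  rw [eventually_comap] at hev
  obtain ⟨b, hb, hbs⟩ := (mem_nhdsLT_iff_exists_Ioo_subset' hpos).1 hev
  obtain ⟨w, hw1, hw2⟩ := EReal.lt_iff_exists_real_btwn.1 (max_lt hpos hb)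
  refine ⟨w, EReal.coe_lt_coe_iff.1 ((le_max_left _ _).trans_lt hw1), hw2, ?_⟩
  have := hbs ⟨(le_max_right _ _).trans_lt hw1, hw2⟩ w rfl
  exact EReal.coe_lt_coe_iff.1 this

/-- The constant term of `P'` counts graphs of size `1`, none of which is prime. -/
lemma deriv_Lam_zero (hprime : ∀ (n : ℕ), ∀ G ∈ P n, G.IsPrimeGraph)
    (hR : 0 < (seriesP P).radius) : deriv (Lam P) 0 = 0 := by
  have hpos := radiusLam_pos hR
  have hf := hasFPowerSeriesOnBall_deriv_egf (hasFPowerSeriesOnBall_graphSum hR)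
  have h1 := re_deriv_LamC le_rfl (P := P) (x := 0) (by simpa using hpos)
  rw [(hasDerivAt_Lam le_rfl (P := P) (x := 0) (by simpa using hpos)).deriv, h1]
  have h2 := constantCoeff_taylorSeries (deriv (graphSum P))
  rw [taylorSeries_of_hasFPowerSeriesAt hf.hasFPowerSeriesAt,
    ← PowerSeries.coeff_zero_eq_constantCoeff_apply, coeff_egfSeries,
    GraphSet.ncard_eq_zero hprime (by norm_num)] at h2
  simp at h2
  simp [← h2]

lemma graphSum_zero (hprime : ∀ (n : ℕ), ∀ G ∈ P n, G.IsPrimeGraph)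
    (hR : 0 < (seriesP P).radius) : graphSum P 0 = 0 := by
  have hf := hasFPowerSeriesOnBall_graphSum hR
  have h2 := constantCoeff_taylorSeries (graphSum P)
  rw [taylorSeries_of_hasFPowerSeriesAt hf.hasFPowerSeriesAt,
    ← PowerSeries.coeff_zero_eq_constantCoeff_apply, coeff_egfSeries,
    GraphSet.ncard_eq_zero hprime (by norm_num)] at h2
  simpa using h2.symm

lemma LamC_zero (hprime : ∀ (n : ℕ), ∀ G ∈ P n, G.IsPrimeGraph)
    (hR : 0 < (seriesP P).radius) : LamC P 0 = 0 := by
  simp [LamC, graphSum_zero hprime hR]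

lemma continuousOn_deriv_Lam {x : ℝ} (hx : (x : EReal) < radiusLam P) :
    ContinuousOn (deriv (Lam P)) (Set.Icc 0 x) := by
  have h1 : ContinuousOn (fun y : ℝ => (deriv (LamC P) y).re) (Set.Icc 0 x) := by
    intro y hy
    have hn : ‖(y : ℂ)‖ ≤ x := by simpa [abs_of_nonneg hy.1] using hy.2
    have h2 := (analyticAt_LamC hn hx).deriv.continuousAt
    exact (Complex.continuous_re.continuousAt.comp
      (ContinuousAt.comp (f := fun y : ℝ => (y : ℂ)) h2
        Complex.continuous_ofReal.continuousAt)).continuousWithinAt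
  exact h1.congr fun y hy =>
    (hasDerivAt_Lam hy.1 ((EReal.coe_le_coe_iff.2 hy.2).trans_lt hx)).deriv

lemma ConditionC.exists_deriv_eq_one (hprime : ∀ (n : ℕ), ∀ G ∈ P n, G.IsPrimeGraph)
    (hC : ConditionC P) :
    ∃ κ : ℝ, 0 < κ ∧ (κ : EReal) < radiusLam P ∧ deriv (Lam P) κ = 1 := by
  obtain ⟨w, hw0, hw, hw1⟩ := hC.exists_one_lt_deriv
  have h0 := deriv_Lam_zero hprime hC.1
  obtain ⟨κ, hκ, hκ1⟩ := intermediate_value_Icc hw0.le (continuousOn_deriv_Lam hw)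
    (show (1 : ℝ) ∈ Set.Icc (deriv (Lam P) 0) (deriv (Lam P) w) from ⟨by rw [h0]; norm_num, hw1.le⟩)
  refine ⟨κ, lt_of_le_of_ne hκ.1 ?_, (EReal.coe_le_coe_iff.2 hκ.2).trans_lt hw, hκ1⟩
  rintro rfl
  rw [h0] at hκ1
  exact zero_ne_one hκ1

lemma deriv_Lam_injective {x y : ℝ} (hx0 : 0 ≤ x) (hx : (x : EReal) < radiusLam P) (hy0 : 0 ≤ y)
    (hy : (y : EReal) < radiusLam P) (hxy : deriv (Lam P) x = deriv (Lam P) y) : x = y := by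
  rcases lt_trichotomy x y with h | h | h
  · exact absurd hxy (deriv_Lam_strictMono hx0 h hy).ne
  · exact h
  · exact absurd hxy (deriv_Lam_strictMono hy0 h hx).ne'

lemma ofReal_exp_sub_one (x : ℝ) : Complex.exp x - 1 = ((Real.exp x - 1 : ℝ) : ℂ) := by
  push_cast; rfl

lemma inversionData_LamC (hprime : ∀ (n : ℕ), ∀ G ∈ P n, G.IsPrimeGraph) {κ : ℝ} (hκ0 : 0 < κ)
    (hκ : (κ : EReal) < radiusLam P) (hκ1 : deriv (Lam P) κ = 1) :
    InversionData (LamC P) κ (Lam P κ) (deriv (deriv (Lam P)) κ) := by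
  have hR := pos_radius_of_lt_radiusLam hκ0.le hκ
  have hn : ‖(κ : ℂ)‖ ≤ κ := by simp [abs_of_pos hκ0]
  have hf1 := hasFPowerSeriesOnBall_deriv_egf (hasFPowerSeriesOnBall_graphSum hR)
  have hf2 := hasFPowerSeriesOnBall_deriv_egf hf1
  have hlt := (lt_radiusLam_iff P hκ0.le).1 hκ
  have hE := exp_sub_one_nonneg hκ0.le
  have hd2 : deriv (deriv (Lam P)) κ = (deriv (deriv (LamC P)) κ).re := by
    obtain ⟨y, hκy, hy⟩ := eventually_lt_radiusLam hκ
    have hev : deriv (Lam P) =ᶠ[𝓝 κ] fun x : ℝ => (deriv (LamC P) x).re := by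
      filter_upwards [Ioo_mem_nhds hκ0 hκy] with x hx
      exact (hasDerivAt_Lam hx.1.le ((EReal.coe_lt_coe_iff.2 hx.2).trans hy)).deriv
    rw [hev.deriv_eq]
    exact (hasDerivAt_deriv_LamC hn hκ).differentiableAt.hasDerivAt.real_of_complex.deriv
  have hval : deriv (deriv (LamC P)) κ =
      (((deriv (deriv (graphSum P)) (Real.exp κ - 1 : ℝ)).re * Real.exp κ * Real.exp κ +
        (deriv (graphSum P) (Real.exp κ - 1 : ℝ)).re * Real.exp κ + Real.exp κ : ℝ) : ℂ) := by
    rw [(hasDerivAt_deriv_LamC hn hκ).deriv, ofReal_exp_sub_one]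
    simp only [Complex.ofReal_add, Complex.ofReal_mul]
    rw [ofReal_re_egf hf1 hlt, ofReal_re_egf hf2 hlt, Complex.ofReal_exp]
  refine ⟨hκ0, fun w hw => analyticAt_LamC (mem_closedBall_zero_iff.1 hw) hκ,
    LamC_zero hprime hR, fun w hw => ?_, ?_, (ofReal_Lam P κ).symm,
    fun w hw hwκ => norm_LamC_lt hw hwκ hκ, ?_, ?_, ?_⟩
  · have hw' : ((‖w‖ : ℝ) : EReal) < radiusLam P := (EReal.coe_lt_coe_iff.2 hw).trans hκ
    rw [← hκ1]
    exact (norm_deriv_LamC_le hw').trans_lt (deriv_Lam_strictMono (norm_nonneg w) hw hκ)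
  · rw [← Complex.ofReal_one, ← hκ1, (hasDerivAt_Lam hκ0.le hκ).deriv, re_deriv_LamC hκ0.le hκ,
      (hasDerivAt_LamC hn hκ).deriv, ofReal_exp_sub_one]
    simp only [Complex.ofReal_add, Complex.ofReal_mul]
    rw [ofReal_re_egf hf1 hlt, Complex.ofReal_exp]
  -- `Λ(κ) < κ` by the mean value inequality: `Λ(0) = 0` and `Λ' < 1` on `(0, κ)`.
  · have hlt' : ∀ x ∈ Set.Icc 0 κ, (x : EReal) < radiusLam P := fun x hx =>
      (EReal.coe_le_coe_iff.2 hx.2).trans_lt hκ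
    have h0 : Lam P 0 = 0 := by
      have := ofReal_Lam P 0
      rw [Complex.ofReal_zero, LamC_zero hprime hR] at this
      exact_mod_cast this
    have := (convex_Icc 0 κ).image_sub_lt_mul_sub_of_deriv_lt (f := Lam P) (C := 1)
      (fun x hx => (hasDerivAt_Lam hx.1 (hlt' x hx)).continuousAt.continuousWithinAt)
      (fun x hx => by
        rw [interior_Icc] at hx
        exact (hasDerivAt_Lam hx.1.le
          (hlt' x ⟨hx.1.le, hx.2.le⟩)).differentiableAt.differentiableWithinAt)
      (fun x hx => by
        rw [interior_Icc] at hx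
        rw [← hκ1]
        exact deriv_Lam_strictMono hx.1.le hx.2 hκ)
      0 ⟨le_rfl, hκ0.le⟩ κ ⟨hκ0.le, le_rfl⟩ hκ0
    rw [h0] at this
    linarith
  · rw [hd2, hval, Complex.ofReal_re]
  · rw [hd2, hval, Complex.ofReal_re]
    have h1 := re_egf_nonneg hf1 hE hlt
    have h2 := re_egf_nonneg hf2 hE hlt
    have h3 := Real.exp_pos κ
    positivity

end Kappa

/-! ### Conclusion -/

section Conclusion

open Metric Filter PowerSeries

/-- Used for all three series. Analyticity of `G` gives a radius at least `R`; were it larger, the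
sum of the series would itself be an analytic extension at `R`, against `hsing`. Every other point
of the circle lies in `D`, where `G` is the extension. -/
lemma singularity_of_deltaDomain {a : ℕ → ℕ} {G : ℂ → ℂ} {R : ℝ} {D : Set ℂ} (hR : 0 < R)
    (hG : AnalyticOnNhd ℂ G D) (hD : IsDeltaDomain R D)
    (hsub : ∀ z : ℂ, ‖z‖ ≤ R → z ≠ R → z ∈ D) (ht : taylorSeries G = egfSeries a)
    (hsing : ∀ g : ℂ → ℂ, AnalyticAt ℂ g R → ¬ ∀ᶠ z in 𝓝[ball 0 R] (R : ℂ), g z = G z) :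
    IsDeltaContinuation (egf ℂ a) R D G ∧ HasUniqueDominantSingularity (egf ℂ a) R := by
  have hne : ∀ z : ℂ, ‖z‖ < R → z ≠ R := by
    rintro z hz rfl
    rw [Complex.norm_real, Real.norm_eq_abs, abs_of_pos hR] at hz
    exact lt_irrefl _ hz
  have hball : ∀ z ∈ ball (0 : ℂ) R, z ∈ D := fun z hz =>
    hsub z (mem_ball_zero_iff.1 hz).le (hne z (mem_ball_zero_iff.1 hz))
  have hps : HasFPowerSeriesOnBall G (egf ℂ a) 0 (ENNReal.ofReal R) := by
    refine hasFPowerSeriesOnBall_egf (by simpa using hR) ?_ ht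
    rw [eball_ofReal]
    exact fun z hz => (hG z (hball z hz)).differentiableAt.differentiableWithinAt
  have hsum : ∀ z : ℂ, ‖z‖ < R → G z = (egf ℂ a).sum z := by
    intro z hz
    have := hps.sum (y := z) (by rw [eball_ofReal]; exact mem_ball_zero_iff.2 hz)
    rwa [zero_add] at this
  have hsing' : ∀ g : ℂ → ℂ, AnalyticAt ℂ g R →
      ¬ ∀ᶠ z in 𝓝[ball 0 R] (R : ℂ), g z = (egf ℂ a).sum z := by
    intro g hg hev
    refine hsing g hg ?_
    filter_upwards [hev, self_mem_nhdsWithin] with z hz hzb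
    rw [hz, hsum z (mem_ball_zero_iff.1 hzb)]
  have hrad : (egf ℂ a).radius = ENNReal.ofReal R := by
    refine le_antisymm (not_lt.1 fun hlt => ?_) hps.r_le
    have hs := (egf ℂ a).hasFPowerSeriesOnBall (bot_le.trans_lt hlt)
    refine hsing' _ (hs.analyticAt_of_mem (y := (R : ℂ)) ?_) (Eventually.of_forall fun z => rfl)
    rw [Metric.mem_eball, edist_zero_right, ← enorm_norm, Complex.norm_real, enorm_norm,
      Real.enorm_of_nonneg hR.le]
    exact hlt
  refine ⟨⟨hR, hrad, hD, hG, hsum⟩, hrad, fun ζ hζ => ⟨fun hs => ?_, ?_⟩⟩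
  · by_contra hζR
    refine hs ⟨G, hG ζ (hsub ζ hζ.le hζR), ?_⟩
    filter_upwards [self_mem_nhdsWithin] with z hz
    rw [hζ] at hz
    exact hsum z (mem_ball_zero_iff.1 hz)
  · rintro rfl ⟨g, hg, hev⟩
    rw [hζ] at hev
    exact hsing' g hg hev

variable {P : GraphSet}

lemma taylorSeries_exp_comp_sub_one {F : ℂ → ℂ} (hF : AnalyticAt ℂ F 0) (hF0 : F 0 = 0) :
    taylorSeries (fun z => Complex.exp (F z) - 1) = (exp ℂ).subst (taylorSeries F) - 1 := by
  have h1 := taylorSeries_add (f := fun z => Complex.exp (F z)) (g := fun _ => -1) hF.cexp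
    analyticAt_const
  rw [taylorSeries_const, taylorSeries_comp analyticAt_cexp hF hF0, taylorSeries_exp, map_neg,
    map_one, ← sub_eq_add_neg] at h1
  exact h1

/-- The bridge between combinatorics and analysis: the Taylor series of an analytic inverse and the
counting series satisfy the same formal equation, whose solution is unique. -/
lemma taylorSeries_eq_egfSeries_notJoin (hprime : ∀ (n : ℕ), ∀ G ∈ P n, G.IsPrimeGraph)
    (hR : 0 < (seriesP P).radius) {F : ℂ → ℂ} (hF : AnalyticAt ℂ F 0) (hF0 : F 0 = 0)
    (heq : ∀ᶠ z in 𝓝 0, F z - LamC P (F z) = z) :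
    taylorSeries F = egfSeries (DecoratedTree.treeCount (DecoratedTree.NotJoin P)) := by
  have hps := hasFPowerSeriesOnBall_graphSum hR
  have hN := egfSeries_equations hprime
  have hE : AnalyticAt ℂ (fun z => Complex.exp (F z) - 1) 0 := hF.cexp.sub analyticAt_const
  have hE0 : Complex.exp (F 0) - 1 = 0 := by simp [hF0]
  have hPE : AnalyticAt ℂ (fun z => graphSum P (Complex.exp (F z) - 1)) 0 := by
    refine AnalyticAt.comp (f := fun z => Complex.exp (F z) - 1) ?_ hE
    show AnalyticAt ℂ (graphSum P) (Complex.exp (F 0) - 1)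
    rw [hE0]
    exact hps.analyticAt
  refine eq_of_functional_equation (f := egfSeries fun k => (P k).ncard) ?_
    (by rw [constantCoeff_taylorSeries, hF0]) (constantCoeff_egfSeries_treeCount _) ?_ ?_
  · rw [coeff_egfSeries, GraphSet.ncard_eq_zero hprime (by norm_num)]
    simp
  · have h1 := taylorSeries_comp (f := graphSum P) hps.analyticAt hE hE0
    rw [taylorSeries_of_hasFPowerSeriesAt hps.hasFPowerSeriesAt,
      taylorSeries_exp_comp_sub_one hF hF0] at h1
    rw [← h1, ← taylorSeries_exp_comp_sub_one hF hF0]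
    have h2 : taylorSeries (fun z => F z + F z) = taylorSeries fun z =>
        z + (Complex.exp (F z) - 1 + graphSum P (Complex.exp (F z) - 1)) := by
      refine taylorSeries_congr ?_
      filter_upwards [heq] with z hz
      rw [LamC] at hz
      linear_combination hz
    rw [taylorSeries_add hF hF, taylorSeries_add (f := fun z => z)
      (g := fun z => Complex.exp (F z) - 1 + graphSum P (Complex.exp (F z) - 1)) analyticAt_id
      (hE.add hPE), taylorSeries_add hE hPE, taylorSeries_id] at h2
    linear_combination h2
  · obtain ⟨hT, -, hN⟩ := egfSeries_equations hprime
    rw [← hT]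
    exact hN

end Conclusion

theorem mainTheorem6 (P : GraphSet)
    (hprime : ∀ (n : ℕ), ∀ G ∈ P n, G.IsPrimeGraph)
    (hstable : P.StableByRelabeling)
    (hC : ConditionC P) :
    ∃ κ : ℝ,
      -- `κ` is the only solution in `[0, R_Λ)` of `Λ'(κ) = 1`
      ((0 ≤ κ ∧ (κ : EReal) < radiusLam P ∧ deriv (Lam P) κ = 1) ∧
        ∀ w : ℝ, 0 ≤ w → (w : EReal) < radiusLam P → deriv (Lam P) w = 1 → w = κ) ∧
      ∃ R K μ : ℝ,
        R = κ - Lam P κ ∧ K = Real.exp κ - 1 ∧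
        μ = Real.sqrt (2 * R * deriv (deriv (Lam P)) κ) ∧
        0 < R ∧ 0 < μ ∧
        (seriesT P).radius = ENNReal.ofReal R ∧
        (seriesTNotJoin P).radius = ENNReal.ofReal R ∧
        HasUniqueDominantSingularity (seriesT P) R ∧
        HasUniqueDominantSingularity (seriesTNotJoin P) R ∧
        IsDeltaAnalytic (seriesT P) ∧
        IsDeltaAnalytic (seriesTNotJoin P) ∧
        HasDeltaExpansion (seriesTNotJoin P) R
          (fun z => κ - 2 * R / μ * (1 - z / R) ^ (1 / 2 : ℂ)) (fun z => 1 - z / R) ∧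
        HasDeltaExpansion (seriesT P) R
          (fun z => K - (1 + K) * (2 * R / μ) * (1 - z / R) ^ (1 / 2 : ℂ))
          (fun z => 1 - z / R) ∧
        HasDeltaExpansion (seriesTJoin P) R
          (fun z => 1 / μ * (1 - z / R) ^ (-1 / 2 : ℂ)) (fun _ => 1) := by
  obtain ⟨κ, hκ0, hκ, hκ1⟩ := hC.exists_deriv_eq_one hprime
  refine ⟨κ, ⟨⟨hκ0.le, hκ, hκ1⟩, fun w hw0 hw hw1 =>
    deriv_Lam_injective hw0 hw hκ0.le hκ (hw1.trans hκ1.symm)⟩, ?_⟩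
  have h := inversionData_LamC hprime hκ0 hκ hκ1
  have hR : 0 < κ - Lam P κ := sub_pos.2 h.lam_lt
  have hμ : 0 < √(2 * (κ - Lam P κ) * deriv (deriv (Lam P)) κ) :=
    Real.sqrt_pos.2 (mul_pos (by linarith) h.d_pos)
  -- The slope `√(2R / Λ''(κ))` of the local parametrization equals `2R / μ`.
  have hβ : √(2 * (κ - Lam P κ) / deriv (deriv (Lam P)) κ) =
      2 * (κ - Lam P κ) / √(2 * (κ - Lam P κ) * deriv (deriv (Lam P)) κ) := by
    have h2R : (0 : ℝ) ≤ 2 * (κ - Lam P κ) := by linarith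
    have hd0 := h.d_pos
    have h1 : √(2 * (κ - Lam P κ)) ≠ 0 := (Real.sqrt_pos.2 (by linarith)).ne'
    have h2 : √(deriv (deriv (Lam P)) κ) ≠ 0 := (Real.sqrt_pos.2 hd0).ne'
    have h3 : √(2 * (κ - Lam P κ)) * √(2 * (κ - Lam P κ)) = 2 * (κ - Lam P κ) :=
      Real.mul_self_sqrt h2R
    rw [Real.sqrt_div h2R, Real.sqrt_mul h2R, div_eq_div_iff h2 (mul_ne_zero h1 h2)]
    linear_combination √(deriv (deriv (Lam P)) κ) * h3
  obtain ⟨D, hD, hDU, hsub, hDarg⟩ := h.exists_deltaDomain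
  have hF : AnalyticOnNhd ℂ h.inverse D := fun z hz => h.analyticAt_inverse (hDU hz)
  have h0R : (0 : ℂ) ∈ Metric.ball (0 : ℂ) (κ - Lam P κ) := Metric.mem_ball_self hR
  have hU := h.ball_subset_image
  have hF0 := h.analyticAt_inverse (hU h0R)
  have hnhds : Metric.ball (0 : ℂ) (κ - Lam P κ) ∈ 𝓝 0 := Metric.isOpen_ball.mem_nhds h0R
  have hR0 := pos_radius_of_lt_radiusLam hκ0.le hκ
  have hN : taylorSeries h.inverse = egfSeries (DecoratedTree.treeCount (DecoratedTree.NotJoin P)) :=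
    taylorSeries_eq_egfSeries_notJoin hprime hR0 hF0 h.inverse_zero <| by
      filter_upwards [hnhds] with z hz
      exact h.inverse_sub (hU hz)
  have hT : taylorSeries (fun z => Complex.exp (h.inverse z) - 1) =
      egfSeries (DecoratedTree.treeCount (DecoratedTree.IsDecorated P)) := by
    rw [taylorSeries_exp_comp_sub_one hF0 h.inverse_zero, hN, (egfSeries_equations hprime).1]
  have hA : taylorSeries (deriv h.inverse) =
      egfSeries (BlossomTree.blossomCount (BlossomTree.Replaceable P)) := by
    rw [taylorSeries_deriv, hN, egfSeries_blossomCount_replaceable hprime]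
  have hseriesT : seriesT P = egf ℂ (DecoratedTree.treeCount (DecoratedTree.IsDecorated P)) :=
    congrArg (egf ℂ) (funext fun n => ncard_treeClass P n)
  have hseriesN : seriesTNotJoin P = egf ℂ (DecoratedTree.treeCount (DecoratedTree.NotJoin P)) :=
    congrArg (egf ℂ) (funext fun n => ncard_treeClassNotJoin P n)
  have hseriesA : seriesTJoin P = egf ℂ (BlossomTree.blossomCount (BlossomTree.Replaceable P)) :=
    congrArg (egf ℂ) (funext fun n => ncard_blossomedClassJoin hprime hstable n)
  have hball : ∀ᶠ z in 𝓝[Metric.ball 0 (κ - Lam P κ)] ((κ - Lam P κ : ℝ) : ℂ),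
      z ∈ Metric.ball (0 : ℂ) (κ - Lam P κ) := self_mem_nhdsWithin
  -- Since the disk is open, an equality valid in it near `R` can be differentiated, which reduces
  -- the singularity of `N` and `T` to the unboundedness of `N'`.
  have hderiv : ∀ {g G : ℂ → ℂ},
      (∀ᶠ z in 𝓝[Metric.ball 0 (κ - Lam P κ)] ((κ - Lam P κ : ℝ) : ℂ), g z = G z) →
      ∀ᶠ z in 𝓝[Metric.ball 0 (κ - Lam P κ)] ((κ - Lam P κ : ℝ) : ℂ),
        g z = G z ∧ deriv g z = deriv G z := by
    intro g G hgG
    filter_upwards [eventually_eventually_nhdsWithin.2 hgG, hgG, hball] with z hz hz' hzb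
    rw [Metric.isOpen_ball.nhdsWithin_eq hzb] at hz
    exact ⟨hz', Filter.EventuallyEq.deriv_eq hz⟩
  obtain ⟨hcN, huN⟩ := singularity_of_deltaDomain hR hF hD hsub hN fun g hg hgF =>
    h.not_eventually_deriv_inverse_eq hg.deriv.continuousAt <|
      (hderiv hgF).mono fun z hz => hz.2.symm
  obtain ⟨hcT, huT⟩ := singularity_of_deltaDomain
    (G := fun z => Complex.exp (h.inverse z) - 1) hR
    (fun z hz => (hF z hz).cexp.sub analyticAt_const) hD hsub hT fun g hg hgF => by
      -- For `T` the logarithmic derivative is used: `N' = T' / (1 + T)`. An extension `g` of `T`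
      -- satisfies `1 + g ≠ 0` at `R` because `‖exp N‖ ≥ exp (-κ)` on the disk.
      have hlow : ∀ᶠ z in 𝓝[Metric.ball 0 (κ - Lam P κ)] ((κ - Lam P κ : ℝ) : ℂ),
          Real.exp (-κ) ≤ ‖1 + g z‖ := by
        filter_upwards [hgF, hball] with z hz hzb
        rw [hz, add_sub_cancel, Complex.norm_exp, Real.exp_le_exp]
        have h1 := Complex.abs_re_le_norm (h.inverse z)
        have h2 := h.norm_inverse_lt (hU hzb)
        linarith [neg_abs_le (h.inverse z).re]
      have hbot : (𝓝[Metric.ball 0 (κ - Lam P κ)] ((κ - Lam P κ : ℝ) : ℂ)).NeBot := by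
        rw [← mem_closure_iff_nhdsWithin_neBot, closure_ball _ hR.ne', mem_closedBall_zero_iff,
          Complex.norm_real, Real.norm_eq_abs, abs_of_pos hR]
      have hgR : 1 + g ((κ - Lam P κ : ℝ) : ℂ) ≠ 0 := by
        have h1 : Real.exp (-κ) ≤ ‖1 + g ((κ - Lam P κ : ℝ) : ℂ)‖ :=
          ge_of_tendsto ((continuousAt_const.add hg.continuousAt).norm.mono_left
            nhdsWithin_le_nhds) hlow
        exact norm_pos_iff.1 ((Real.exp_pos _).trans_le h1)
      refine h.not_eventually_deriv_inverse_eq (g := fun z => deriv g z / (1 + g z))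
        (hg.deriv.continuousAt.div (continuousAt_const.add hg.continuousAt) hgR) ?_
      filter_upwards [hderiv hgF, hball] with z hz hzb
      have h1 := ((h.analyticAt_inverse (hU hzb)).differentiableAt.hasDerivAt.cexp).sub_const 1
      rw [hz.1, hz.2, h1.deriv, add_sub_cancel, mul_div_cancel_left₀ _ (Complex.exp_ne_zero _)]
  obtain ⟨hcA, -⟩ := singularity_of_deltaDomain hR hF.deriv hD hsub hA fun g hg hgF =>
    h.not_eventually_deriv_inverse_eq hg.continuousAt (hgF.mono fun z hz => hz.symm)
  -- For `T` the derivative of `exp - 1` at `κ` is `exp κ = 1 + K`, the extra factor in its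
  -- expansion.
  have eN := h.isBigO_comp_inverse hDarg (v := fun z => z) analyticAt_id
  have eT := h.isBigO_comp_inverse hDarg (v := fun z => Complex.exp z - 1)
    (analyticAt_cexp.sub analyticAt_const)
  have eA := h.isBigO_deriv_inverse hDarg
  rw [hseriesT, hseriesN, hseriesA]
  refine ⟨κ - Lam P κ, Real.exp κ - 1, √(2 * (κ - Lam P κ) * deriv (deriv (Lam P)) κ), rfl, rfl,
    rfl, hR, hμ, huT.1, huN.1, huT, huN, ⟨_, D, _, hcT⟩, ⟨_, D, _, hcN⟩, ⟨D, _, hcN, ?_⟩,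
    ⟨D, _, hcT, ?_⟩, ⟨D, _, hcA, ?_⟩⟩
  · refine eN.congr_left fun z => ?_
    rw [hβ, deriv_id'']
    push_cast
    ring
  · refine eT.congr_left fun z => ?_
    have : deriv (fun z => Complex.exp z - 1) (κ : ℂ) = Complex.exp κ :=
      ((Complex.hasDerivAt_exp _).sub_const 1).deriv
    rw [hβ, this]
    push_cast
    ring
  · refine eA.congr_left fun z => ?_
    push_cast
    ring
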